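/- **Setting.** Fix an input dimension $D$, a source task $\mathcal T_1=\{(\bar{\mathbf{x}}_\mu,\bar y_\mu)\}_{\mu=1}^{P_1}$ and a target task $\mathcal T_2=\{(\mathbf{x}_\mu,y_\mu)\}_{\mu=1}^{P_2}$ in $\mathbb R^D\times\mathbb R$, constants $\bar\gamma_0,\gamma_0>0$, $\lambda,\delta\ge 0$ with $\lambda+\delta>0$, and $\bar t\ge 0$. Let $\phi:\mathbb R\to\mathbb R$ be differentiable, with $\phi$ and $\dot\phi$ globally Lipschitz. A two-layer network of width $N$ with parameters $\boldsymbol{\theta}=\mathrm{Vec}(\mathbf{W},\mathbf{w})$, $\mathbf{W}\in\mathbb R^{N\times D}$, $\mathbf{w}\in\mathbb R^N$, and richness $\gamma$ has output $f_{\boldsymbol{\theta}}(\mathbf{x})=\frac1{\gamma N}\,\mathbf{w}\cdot\phi(\mathbf{h}(\mathbf{x}))$, with preactivations $\mathbf{h}(\mathbf{x})=\frac1{\sqrt D}\mathbf{W}\mathbf{x}$. The loss on a task is $\mathcal L=\frac12\sum_\mu (y_\mu-f_{\boldsymbol{\theta}}(\mathbf{x}_\mu))^2$. Put $C(\mathbf{x},\mathbf{x}')=\frac1D\mathbf{x}\cdot\mathbf{x}'$.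 **Two-stage training.** A source network (richness $\bar\gamma_0$) starts from i.i.d. $\bar W_{ij}(0),\bar w_i(0)\sim\mathcal N(0,1)$ and follows $\frac{d\bar{\boldsymbol{\theta}}}{dt}=-\bar\gamma_0^2N\nabla\mathcal L-\lambda\bar{\boldsymbol{\theta}}$ on $\mathcal T_1$ up to time $\bar t$. Write $\bar{\mathbf{W}}$ for its hidden weights at time $\bar t$. A target network (richness $\gamma_0$) starts from $\mathbf{W}(0)=\bar{\mathbf{W}}$ and readouts $w_i(0)\sim\mathcal N(0,1)$, independent of each other and of the source initialization. It follows, for $t\ge0$, the gradient flow of $\gamma_0^2N\mathcal L+\frac\lambda2|\boldsymbol{\theta}|^2+\frac\delta2|\mathbf{W}-\bar{\mathbf{W}}|^2$ on $\mathcal T_2$. Let $f_N(\mathbf{x},t)$ be its predictor. **Single-site processes.** Let $\xi$ be a centred Gaussian field over inputs with covariance $C(\mathbf{x},\mathbf{x}')$, and let $\bar\psi,\psi\sim\mathcal N(0,1)$, with $\xi,\bar\psi,\psi$ independent. Write $h_0$ for the value of a field at the input $\mathbf{x}_0$ and $h_\mu$ for its value at a pattern $\mathbf{x}_\mu$. The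 source system, on $0\le t\le\bar t$ and for every input $\mathbf{x}_0$, is $$\bar h_0(t)=e^{-\lambda t}\xi(\mathbf{x}_0)+\bar\gamma_0\int_0^t e^{-\lambda(t-s)}\sum_{\nu\in\mathcal T_1}\bar\Delta_\nu(s)\bar g_\nu(s)\,C(\mathbf{x}_0,\bar{\mathbf{x}}_\nu)\,ds,$$ $$\bar z(t)=e^{-\lambda t}\bar\psi+\bar\gamma_0\int_0^te^{-\lambda(t-s)}\sum_{\nu\in\mathcal T_1}\bar\Delta_\nu(s)\phi(\bar h_\nu(s))\,ds,$$ with $\bar g_0=\dot\phi(\bar h_0)\bar z$, $\bar\Delta_\nu=\bar y_\nu-\bar f(\bar{\mathbf{x}}_\nu,\cdot)$ and $\bar f(\mathbf{x}_0,t)=\bar\gamma_0^{-1}\mathbb E[\bar z(t)\phi(\bar h_0(t))]$. The target system, on $t\ge0$ and with $\bar h_0:=\bar h_0(\bar t)$, is $$h_0(t)=e^{-(\lambda+\delta)t}\bar h_0+\frac{\delta}{\lambda+\delta}\bigl(1-e^{-(\lambda+\delta)t}\bigr)\bar h_0+\gamma_0\int_0^te^{-(\lambda+\delta)(t-s)}\sum_{\nu\in\mathcal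 T_2}\Delta_\nu(s)g_\nu(s)\,C(\mathbf{x}_0,\mathbf{x}_\nu)\,ds,$$ $$z(t)=e^{-\lambda t}\psi+\gamma_0\int_0^te^{-\lambda(t-s)}\sum_{\nu\in\mathcal T_2}\Delta_\nu(s)\phi(h_\nu(s))\,ds,$$ with $g_0=\dot\phi(h_0)z$, $\Delta_\nu=y_\nu-f(\mathbf{x}_\nu,\cdot)$ and $$f(\mathbf{x}_0,t)=\gamma_0^{-1}\,\mathbb E\bigl[z(t)\phi(h_0(t))\bigr].$$ A solution consists of measurable processes with almost surely continuous paths that satisfy these equations almost surely, such that the products $z\,\phi(h_0)$ and $\bar z\,\phi(\bar h_0)$ are integrable at each time and the predictors $f,\bar f$ are continuous in time. **Theorem.** The two-stage single-site system has a solution, and for every solution the following holds as $N\to\infty$. 1. For every test point $\mathbf{x}_0$ and time $t\ge0$, $f_N(\mathbf{x}_0,t)\to f(\mathbf{x}_0,t)=\gamma_0^{-1}\mathbb E[z(t)\phi(h_0(t))]$ in probability. 2. The neurons of the target network follow the single-site processes: for all inputs $\mathbf{x}_1,\dots,\mathbf{x}_k$, times $t_1,\dots,t_k\ge0$ and bounded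 continuous $F:(\mathbb R^3)^k\to\mathbb R$, $$\frac1N\sum_{i=1}^NF\Bigl(\bigl(h_i(\mathbf{x}_a,t_a),w_i(t_a),g_i(\mathbf{x}_a,t_a)\bigr)_{a\le k}\Bigr)\longrightarrow\mathbb E\,F\Bigl(\bigl(h(\mathbf{x}_a,t_a),z(t_a),g(\mathbf{x}_a,t_a)\bigr)_{a\le k}\Bigr)$$ in probability, where $g_i=N\gamma_0\,\partial f/\partial h_i$ is the gradient of the network output with respect to the $i$-th preactivation. -/

import Mathlib

open MeasureTheory ProbabilityTheory Set Filter Topology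
open scoped NNReal ENNReal Gradient BoundedContinuousFunction

namespace TransferDMFT

noncomputable section

/-! ### Data and finite-width networks -/

/-- An input `x ∈ ℝ^D`. -/
abbrev Input (D : ℕ) := EuclideanSpace ℝ (Fin D)

/-- A regression task: finitely many input-output pairs `(x_μ, y_μ)`. -/
structure Task (D : ℕ) where
  /-- the number of patterns -/
  size : ℕ
  /-- the inputs -/
  x : Fin size → Input D
  /-- the labels -/
  y : Fin size → ℝ

/-- The data Gram function `C(x, x') = x · x' / D`. -/
def gram {D : ℕ} (x x' : Input D) : ℝ := (∑ j, x j * x' j) / D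

/-- Parameters `θ = Vec(W, w)` of a two-layer network of width `N` on `ℝ^D`:
`inl (i, j)` is the hidden weight `W i j` and `inr i` the readout weight `w i`. -/
abbrev Params (N D : ℕ) := EuclideanSpace ℝ ((Fin N × Fin D) ⊕ Fin N)

/-- The hidden weights `W`. -/
def hidden {N D : ℕ} (θ : Params N D) (i : Fin N) (j : Fin D) : ℝ := θ (Sum.inl (i, j))

/-- The readout weights `w`. -/
def readout {N D : ℕ} (θ : Params N D) (i : Fin N) : ℝ := θ (Sum.inr i)

/-- The preactivations `h = W x / √D`. -/
def preact {N D : ℕ} (θ : Params N D) (x : Input D) (i : Fin N) : ℝ :=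
  (∑ j, hidden θ i j * x j) / √(D : ℝ)

/-- The output `w · φ(h) / (γ N)` as a function of readout weights and preactivations. -/
def output {N : ℕ} (φ : ℝ → ℝ) (γ : ℝ) (w h : Fin N → ℝ) : ℝ :=
  (∑ i, w i * φ (h i)) / (γ * N)

/-- The network `f(x) = w · φ(W x / √D) / (γ N)`. -/
def network {N D : ℕ} (φ : ℝ → ℝ) (γ : ℝ) (θ : Params N D) (x : Input D) : ℝ :=
  output φ γ (readout θ) (preact θ x)

/-- The `i`-th entry of the gradient vector `g = N γ ∂f/∂h` at the input `x`. -/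
def networkGrad {N D : ℕ} (φ : ℝ → ℝ) (γ : ℝ) (θ : Params N D) (x : Input D) (i : Fin N) : ℝ :=
  N * γ * deriv (fun s => output φ γ (readout θ) (Function.update (preact θ x) i s))
    (preact θ x i)

/-- The square loss `½ ∑_μ (y_μ - f(x_μ))²`, for which `- ∂L/∂f_μ = y_μ - f_μ`. -/
def loss {N D : ℕ} (φ : ℝ → ℝ) (γ : ℝ) (T : Task D) (θ : Params N D) : ℝ :=
  (1 / 2) * ∑ μ, (T.y μ - network φ γ θ (T.x μ)) ^ 2

/-- Gradient flow with weight decay, `dθ/dt = - γ² N ∇L(θ) - λ θ`, on the time interval `[0, τ]`. -/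
def IsSourceFlow {N D : ℕ} (φ : ℝ → ℝ) (γ lam τ : ℝ) (T : Task D) (θ : ℝ → Params N D) : Prop :=
  ∀ t ∈ Icc 0 τ,
    HasDerivWithinAt θ (-(γ ^ 2 * N) • ∇ (loss φ γ T) (θ t) - lam • θ t) (Icc 0 τ) t

/-- The objective of the target stage: `γ² N L(θ) + (λ/2) |θ|² + (δ/2) |W - W̄|²`, with the elastic
penalty on the hidden weights only. -/
def targetObjective {N D : ℕ} (φ : ℝ → ℝ) (γ lam δ : ℝ) (T : Task D)
    (Wbar : Fin N → Fin D → ℝ) (θ : Params N D) : ℝ :=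
  γ ^ 2 * N * loss φ γ T θ + lam / 2 * ‖θ‖ ^ 2
    + δ / 2 * ∑ i, ∑ j, (hidden θ i j - Wbar i j) ^ 2

/-- Gradient flow of the target objective on `[0, ∞)`. -/
def IsTargetFlow {N D : ℕ} (φ : ℝ → ℝ) (γ lam δ : ℝ) (T : Task D)
    (Wbar : Fin N → Fin D → ℝ) (θ : ℝ → Params N D) : Prop :=
  ∀ t ∈ Ici (0 : ℝ),
    HasDerivWithinAt θ (-∇ (targetObjective φ γ lam δ T Wbar) (θ t)) (Ici 0) t

/-- All randomly initialized weights of the two-stage procedure: the source weights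
`W̄(0), w̄(0)` and the fresh target readout weights `w(0)`. -/
def initialWeights {N D : ℕ} {Ω : Type*} (θbar θ : Ω → ℝ → Params N D)
    (k : ((Fin N × Fin D) ⊕ Fin N) ⊕ Fin N) (ω : Ω) : ℝ :=
  Sum.elim (fun a => θbar ω 0 a) (fun i => readout (θ ω 0) i) k

/-- The (random) parameter trajectories `θbar`, `θ` of the two-stage training of a network of
width `N`: a source network trained on `T₁` up to time `τ`, then a target network trained on `T₂`,
started from the source hidden weights at time `τ` and from fresh readout weights. -/
structure IsTwoStageTraining {N D : ℕ} (φ : ℝ → ℝ) (γbar γ lam δ τ : ℝ) (T₁ T₂ : Task D)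
    {Ω : Type*} [MeasurableSpace Ω] (P : Measure Ω) (θbar θ : Ω → ℝ → Params N D) : Prop where
  init_indep : iIndepFun (initialWeights θbar θ) P
  init_law : ∀ k, HasLaw (initialWeights θbar θ k) (gaussianReal 0 1) P
  source_flow : ∀ᵐ ω ∂P, IsSourceFlow φ γbar lam τ T₁ (θbar ω)
  init_hidden : ∀ᵐ ω ∂P, hidden (θ ω 0) = hidden (θbar ω τ)
  target_flow : ∀ᵐ ω ∂P, IsTargetFlow φ γ lam δ T₂ (hidden (θbar ω τ)) (θ ω)

/-! ### Single-site processes -/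

/-- The random initial data of a single site: a centred Gaussian field `ξ` over the inputs with
covariance `C(x, x')`, and standard Gaussian readouts `ψbar` (source) and `ψ` (target), all
independent. -/
structure IsSiteNoise {D : ℕ} {Ω : Type*} [MeasurableSpace Ω] (P : Measure Ω)
    (ξ : Input D → Ω → ℝ) (ψbar ψ : Ω → ℝ) : Prop where
  gaussian : IsGaussianProcess ξ P
  mean : ∀ x, ∫ ω, ξ x ω ∂P = 0
  cov : ∀ x x', ∫ ω, ξ x ω * ξ x' ω ∂P = gram x x'
  law_psibar : HasLaw ψbar (gaussianReal 0 1) P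
  law_psi : HasLaw ψ (gaussianReal 0 1) P
  indep_field : IndepFun (fun ω x => ξ x ω) (fun ω => (ψbar ω, ψ ω)) P
  indep_readouts : IndepFun ψbar ψ P

/-- The pre-gradient field `g(x, t) = φ'(h(x, t)) z(t)`. -/
def siteGrad {D : ℕ} {Ω : Type*} (φ : ℝ → ℝ) (h : Input D → ℝ → Ω → ℝ) (z : ℝ → Ω → ℝ)
    (x : Input D) (t : ℝ) (ω : Ω) : ℝ :=
  deriv φ (h x t ω) * z t ω

/-- The mean-field predictor `f(x, t) = γ⁻¹ E[z(t) φ(h(x, t))]`. -/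
def sitePredictor {D : ℕ} {Ω : Type*} [MeasurableSpace Ω] (φ : ℝ → ℝ) (γ : ℝ) (P : Measure Ω)
    (h : Input D → ℝ → Ω → ℝ) (z : ℝ → Ω → ℝ) (x : Input D) (t : ℝ) : ℝ :=
  γ⁻¹ * ∫ ω, z t ω * φ (h x t ω) ∂P

/-- The error signal `Δ_μ(t) = y_μ - f(x_μ, t)` of the mean-field predictor. -/
def siteError {D : ℕ} {Ω : Type*} [MeasurableSpace Ω] (φ : ℝ → ℝ) (γ : ℝ) (P : Measure Ω)
    (h : Input D → ℝ → Ω → ℝ) (z : ℝ → Ω → ℝ) (T : Task D) (μ : Fin T.size) (t : ℝ) : ℝ :=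
  T.y μ - sitePredictor φ γ P h z (T.x μ) t

/-- The self-consistent single-site equations for the task `T` on the time set `S`, with weight
decay `lam`, elastic strength `δ`, initial preactivations `h₀` (also the elastic anchor) and initial
readout `ψ`. With `δ = 0` there is no anchor. -/
structure IsDMFT {D : ℕ} (φ : ℝ → ℝ) (γ lam δ : ℝ) (T : Task D) (S : Set ℝ)
    {Ω : Type*} [MeasurableSpace Ω] (P : Measure Ω) (h₀ : Input D → Ω → ℝ) (ψ : Ω → ℝ)
    (h : Input D → ℝ → Ω → ℝ) (z : ℝ → Ω → ℝ) : Prop where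
  aemeasurable_h : ∀ x, ∀ t ∈ S, AEMeasurable (h x t) P
  aemeasurable_z : ∀ t ∈ S, AEMeasurable (z t) P
  continuous_h : ∀ᵐ ω ∂P, ∀ x, ContinuousOn (fun t => h x t ω) S
  continuous_z : ∀ᵐ ω ∂P, ContinuousOn (fun t => z t ω) S
  integrable : ∀ x, ∀ t ∈ S, Integrable (fun ω => z t ω * φ (h x t ω)) P
  continuous_predictor : ∀ x, ContinuousOn (sitePredictor φ γ P h z x) S
  eq_h : ∀ᵐ ω ∂P, ∀ x, ∀ t ∈ S,
    h x t ω = Real.exp (-(lam + δ) * t) * h₀ x ω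
      + δ / (lam + δ) * (1 - Real.exp (-(lam + δ) * t)) * h₀ x ω
      + γ * ∫ s in (0)..t, Real.exp (-(lam + δ) * (t - s)) *
          ∑ ν, siteError φ γ P h z T ν s * siteGrad φ h z (T.x ν) s ω * gram x (T.x ν)
  eq_z : ∀ᵐ ω ∂P, ∀ t ∈ S,
    z t ω = Real.exp (-lam * t) * ψ ω
      + γ * ∫ s in (0)..t, Real.exp (-lam * (t - s)) *
          ∑ ν, siteError φ γ P h z T ν s * φ (h (T.x ν) s ω)

/-- The two-stage single-site system: the source processes `hbar`, `zbar` on `[0, τ]` started from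
`ξ`, `ψbar`, and the target processes `h`, `z` on `[0, ∞)` started from `hbar(τ)`, `ψ`. -/
structure IsTwoStageDMFT {D : ℕ} (φ : ℝ → ℝ) (γbar γ lam δ τ : ℝ) (T₁ T₂ : Task D)
    {Ω : Type*} [MeasurableSpace Ω] (P : Measure Ω) (ξ : Input D → Ω → ℝ) (ψbar ψ : Ω → ℝ)
    (hbar : Input D → ℝ → Ω → ℝ) (zbar : ℝ → Ω → ℝ)
    (h : Input D → ℝ → Ω → ℝ) (z : ℝ → Ω → ℝ) : Prop where
  source : IsDMFT φ γbar lam 0 T₁ (Icc 0 τ) P ξ ψbar hbar zbar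
  target : IsDMFT φ γ lam δ T₂ (Ici 0) P (fun x => hbar x τ) ψ h z

end

end TransferDMFT

open TransferDMFT

/-! Once the error signals Δ are regarded as given functions of time, a network decouples. Gradient
flow moves every neuron, that is, its hidden weights and its readout, by one and the same
differential equation (`NeuronModel`). The neurons interact only through Δ = y − κ · (average
contribution), with κ = γ⁻². The single-site system is this equation with the average replaced by an
expectation over the random initial state. The theorem is therefore a propagation-of-chaos
statement, and it is proved by synchronous coupling: each neuron of the network is compared with the
neuron that has the same initial data but is driven by the deterministic limiting Δ. The law of
large numbers for these independent copies, together with Grönwall's inequality for the time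
integral of the difference of the signals, closes the loop (`NeuronModel.exists_norm_sub_flow_le`,
`NeuronModel.tracks`).

The difficulty is that the response φ'(h) z is only locally Lipschitz, so that stability constants
grow exponentially in the size of the initial state and depend on the time integral of ‖Δ‖. Two
facts overcome this. Gaussian data have all exponential moments. Moreover, the response that moves
the readout is also the one that produces the output, so the mean squared readout is an energy:
since it stays nonnegative, Δ is bounded in L² on every finite horizon
(`NeuronModel.integral_sum_sq_le`). The bound holds for any law of the initial states with
exponential moments, hence also for the empirical law of a finite network
(`NeuronModel.IsNetwork.integral_norm_le`).

Self-consistent signals exist because the problem with truncated signals is a contraction in an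
exponentially weighted norm, and the energy bound makes the truncation inactive
(`NeuronModel.exists_isSelfConsistent`). Conversely, every solution of the single-site system
consists of neuron trajectories driven by self-consistent signals (`IsDMFT.exists_flow`). This
reduction to finite dimension rests on the linearity of the kernel C: the field ξ is almost surely a
linear function of D Gaussian weights (`IsSiteNoise.field_eq`).

The coupling tolerates an error in the initial states, so it can be applied twice, the tracking
error of the source at its final time being the initial error of the target. Test functions of
quadratic growth then pass to the limit (`Tracks.holdsInProb_abs_avg_sub_lt`), which covers both the
predictor and bounded observables. -/

/-! ### Grönwall's inequality with a time-dependent rate -/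

section Gronwall

variable {E : Type*} [NormedAddCommGroup E] [NormedSpace ℝ E]

/-- The norm need not be differentiable, so ‖u‖ is compared with an explicit barrier. Adding ε to b
makes the barrier a strict supersolution wherever it is touched; then ε tends to zero. -/
theorem norm_le_of_norm_deriv_le_mul_add {τ : ℝ} {u u' : ℝ → E} {a b : ℝ → ℝ}
    (ha : Continuous a) (hb : Continuous b) (ha0 : ∀ t, 0 ≤ a t) (hb0 : ∀ t, 0 ≤ b t)
    (hu : ∀ t ∈ Icc 0 τ, HasDerivWithinAt u (u' t) (Icc 0 τ) t)
    (hu' : ∀ t ∈ Icc 0 τ, ‖u' t‖ ≤ a t * ‖u t‖ + b t) {t : ℝ} (ht : t ∈ Icc 0 τ) :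
    ‖u t‖ ≤ (‖u 0‖ + ∫ s in (0)..t, b s) * Real.exp (∫ s in (0)..t, a s) := by
  have key : ∀ ε > 0, ‖u t‖ ≤
      (‖u 0‖ + ∫ s in (0)..t, (b s + ε)) * Real.exp (∫ s in (0)..t, a s) := by
    intro ε hε
    have hbe : Continuous fun s => b s + ε := hb.add continuous_const
    have hA : ∀ x, HasDerivAt (fun t => ∫ s in (0)..t, a s) (a x) x := fun x =>
      intervalIntegral.integral_hasDerivAt_right (ha.intervalIntegrable _ _)
        (ha.stronglyMeasurableAtFilter _ _) ha.continuousAt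
    have hB : ∀ x, HasDerivAt (fun t => ∫ s in (0)..t, (b s + ε)) (b x + ε) x := fun x =>
      intervalIntegral.integral_hasDerivAt_right (hbe.intervalIntegrable _ _)
        (hbe.stronglyMeasurableAtFilter _ _) hbe.continuousAt
    have hBB : ∀ x, HasDerivAt (fun t => (‖u 0‖ + ∫ s in (0)..t, (b s + ε)) *
        Real.exp (∫ s in (0)..t, a s)) ((b x + ε) * Real.exp (∫ s in (0)..x, a s) +
          (‖u 0‖ + ∫ s in (0)..x, (b s + ε)) * (Real.exp (∫ s in (0)..x, a s) * a x)) x :=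
      fun x => ((hB x).const_add _).mul (hA x).exp
    refine image_norm_le_of_norm_deriv_right_lt_deriv_boundary' (f := u) (f' := u') (a := 0)
      (b := τ) (fun x hx => (hu x hx).continuousWithinAt) ?_ (by simp)
      (fun x _ => (hBB x).continuousAt.continuousWithinAt)
      (fun x _ => (hBB x).hasDerivWithinAt) ?_ ht
    · intro x hx
      exact (hu x ⟨hx.1, hx.2.le⟩).mono_of_mem_nhdsWithin (Icc_mem_nhdsGE_of_mem hx)
    · intro x hx hxe
      have h1 : 1 ≤ Real.exp (∫ s in (0)..x, a s) :=
        Real.one_le_exp (intervalIntegral.integral_nonneg hx.1 fun s _ => ha0 s)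
      have h2 := hu' x ⟨hx.1, hx.2.le⟩
      rw [hxe] at h2
      have h3 : b x + ε ≤ (b x + ε) * Real.exp (∫ s in (0)..x, a s) :=
        le_mul_of_one_le_right (by have := hb0 x; linarith) h1
      nlinarith
  have hlim : Tendsto (fun ε : ℝ => (‖u 0‖ + ∫ s in (0)..t, (b s + ε)) *
      Real.exp (∫ s in (0)..t, a s)) (𝓝[>] 0)
      (𝓝 ((‖u 0‖ + ∫ s in (0)..t, b s) * Real.exp (∫ s in (0)..t, a s))) := by
    have he : ∀ ε : ℝ, (∫ s in (0)..t, (b s + ε)) = (∫ s in (0)..t, b s) + t * ε := by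
      intro ε
      rw [intervalIntegral.integral_add (hb.intervalIntegrable _ _)
        (continuous_const.intervalIntegrable _ _)]
      simp
    simp_rw [he]
    have : Continuous fun ε : ℝ => (‖u 0‖ + ((∫ s in (0)..t, b s) + t * ε)) *
      Real.exp (∫ s in (0)..t, a s) := by fun_prop
    have h := this.tendsto 0
    simp only [mul_zero, add_zero] at h
    exact h.mono_left nhdsWithin_le_nhds
  exact ge_of_tendsto hlim (eventually_mem_nhdsWithin.mono fun ε hε => key ε hε)

end Gronwall

/-! ### The radial retraction -/

section Retraction

variable {E : Type*} [NormedAddCommGroup E] [NormedSpace ℝ E]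

/-- The radial retraction onto the closed ball of radius `K`. -/
noncomputable def radialRetraction (K : ℝ) (u : E) : E := (K / max K ‖u‖) • u

theorem norm_radialRetraction_le {K : ℝ} (hK : 0 < K) (u : E) : ‖radialRetraction K u‖ ≤ K := by
  have hm : 0 < max K ‖u‖ := lt_max_of_lt_left hK
  rw [radialRetraction, norm_smul, Real.norm_of_nonneg (by positivity), div_mul_eq_mul_div,
    div_le_iff₀ hm]
  gcongr
  exact le_max_right _ _

theorem norm_radialRetraction_le_norm {K : ℝ} (hK : 0 < K) (u : E) :
    ‖radialRetraction K u‖ ≤ ‖u‖ := by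
  have hm : 0 < max K ‖u‖ := lt_max_of_lt_left hK
  rw [radialRetraction, norm_smul, Real.norm_of_nonneg (by positivity)]
  exact mul_le_of_le_one_left (norm_nonneg _) ((div_le_one hm).2 (le_max_left _ _))

theorem radialRetraction_of_norm_le {K : ℝ} (hK : 0 < K) {u : E} (hu : ‖u‖ ≤ K) :
    radialRetraction K u = u := by
  rw [radialRetraction, max_eq_left hu, div_self hK.ne', one_smul]

/-- In a general normed space the retraction need not be a contraction. The difference splits into a
shrunken u − v and a change of scale acting on the retraction of v, and each part costs at most ‖u −
v‖. -/
theorem norm_radialRetraction_sub_le {K : ℝ} (hK : 0 < K) (u v : E) :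
    ‖radialRetraction K u - radialRetraction K v‖ ≤ 2 * ‖u - v‖ := by
  have hu : 0 < max K ‖u‖ := lt_max_of_lt_left hK
  have hv : 0 < max K ‖v‖ := lt_max_of_lt_left hK
  have h1 : radialRetraction K u - radialRetraction K v =
      (K / max K ‖u‖) • (u - v) + ((max K ‖v‖ - max K ‖u‖) / max K ‖u‖) • radialRetraction K v := by
    simp only [radialRetraction, smul_sub, smul_smul]
    have h2 : (max K ‖v‖ - max K ‖u‖) / max K ‖u‖ * (K / max K ‖v‖) =
      K / max K ‖u‖ - K / max K ‖v‖ := by field_simp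
    rw [h2, sub_smul]
    abel
  rw [h1]
  refine (norm_add_le _ _).trans ?_
  rw [norm_smul, norm_smul, Real.norm_of_nonneg (by positivity), norm_div, Real.norm_eq_abs,
    Real.norm_of_nonneg hu.le, two_mul]
  refine add_le_add (mul_le_of_le_one_left (norm_nonneg _)
    ((div_le_one hu).2 (le_max_left _ _))) ?_
  have h3 : |max K ‖v‖ - max K ‖u‖| ≤ ‖u - v‖ := by
    rw [max_comm K, max_comm K, norm_sub_rev]
    exact (abs_max_sub_max_le_abs _ _ _).trans (abs_norm_sub_norm_le v u)
  rw [div_mul_eq_mul_div, div_le_iff₀ hu]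
  have h4 := (norm_radialRetraction_le hK v).trans (le_max_left K ‖u‖)
  exact mul_le_mul h3 h4 (norm_nonneg _) (norm_nonneg _)

end Retraction

/-! ### Neuron dynamics driven by error signals -/

theorem intervalIntegral_const_add_mul {g : ℝ → ℝ} (hg : Continuous g) (k m t : ℝ) :
    ∫ s in (0)..t, (k + m * g s) = t * k + m * ∫ s in (0)..t, g s := by
  rw [intervalIntegral.integral_add (f := fun _ => k) (g := fun s => m * g s)
    (continuous_const.intervalIntegrable _ _) ((continuous_const.mul hg).intervalIntegrable _ _)]
  simp

/-- The dynamics `u' = A u + B u(0) + ∑ ν, Δ_ν(t) q_ν(u)` of a neuron driven by error signals `Δ`,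
with readout `ℓ`. -/
structure NeuronModel (E ι : Type*) [NormedAddCommGroup E] [NormedSpace ℝ E] where
  /-- the linear decay -/
  A : E →L[ℝ] E
  /-- the pull towards the initial state -/
  B : E →L[ℝ] E
  /-- the response to the error signals -/
  q : ι → E → E
  /-- the readout -/
  ℓ : E →L[ℝ] ℝ
  /-- a constant in the bounds on the response -/
  c : ℝ
  c_nonneg : 0 ≤ c
  norm_q_le : ∀ ν u, ‖q ν u‖ ≤ c * (1 + ‖u‖)
  -- Only one of the two norms enters the local Lipschitz constant. With v on the reference path,
  -- the Grönwall exponent depends on the reference neuron alone.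
  norm_q_sub_le : ∀ ν u v, ‖q ν u - q ν v‖ ≤ c * (1 + ‖v‖) * ‖u - v‖
  abs_ℓ_le : ∀ u, |ℓ u| ≤ ‖u‖
  -- This and the next condition serve the energy estimate: decay cannot increase the squared
  -- readout, and the anchor does not act on it.
  ℓ_mul_A_nonpos : ∀ u, ℓ u * ℓ (A u) ≤ 0
  ℓ_B : ∀ u, ℓ (B u) = 0

namespace NeuronModel

variable {E ι : Type*} [NormedAddCommGroup E] [NormedSpace ℝ E] (M : NeuronModel E ι)

/-- The contribution of a neuron to the output on the pattern `ν`. -/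
noncomputable def contrib (ν : ι) (u : E) : ℝ := M.ℓ u * M.ℓ (M.q ν u)

theorem continuous_q (ν : ι) : Continuous (M.q ν) := by
  rw [continuous_iff_continuousAt]
  intro v
  rw [ContinuousAt, tendsto_iff_norm_sub_tendsto_zero]
  refine squeeze_zero (fun _ => norm_nonneg _) (fun u => M.norm_q_sub_le ν u v) ?_
  have : Tendsto (fun u => c M * (1 + ‖v‖) * ‖u - v‖) (𝓝 v) (𝓝 (c M * (1 + ‖v‖) * ‖v - v‖)) :=
    Continuous.tendsto (by fun_prop) v
  simpa using this

theorem continuous_contrib (ν : ι) : Continuous (M.contrib ν) :=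
  (M.ℓ.continuous).mul (M.ℓ.continuous.comp (M.continuous_q ν))

theorem abs_contrib_le (ν : ι) (u : E) : |M.contrib ν u| ≤ M.c * (1 + ‖u‖) ^ 2 := by
  rw [contrib, abs_mul]
  have h1 := M.abs_ℓ_le u
  have h2 := (M.abs_ℓ_le (M.q ν u)).trans (M.norm_q_le ν u)
  have := M.c_nonneg
  calc |M.ℓ u| * |M.ℓ (M.q ν u)| ≤ ‖u‖ * (M.c * (1 + ‖u‖)) := by gcongr
    _ ≤ (1 + ‖u‖) * (M.c * (1 + ‖u‖)) := by gcongr; linarith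
    _ = _ := by ring

theorem abs_contrib_sub_le (ν : ι) (u v : E) :
    |M.contrib ν u - M.contrib ν v| ≤ M.c * (1 + ‖u‖ + ‖v‖) ^ 2 * ‖u - v‖ := by
  have e : M.contrib ν u - M.contrib ν v =
      M.ℓ (u - v) * M.ℓ (M.q ν u) + M.ℓ v * M.ℓ (M.q ν u - M.q ν v) := by
    simp only [contrib, map_sub]; ring
  rw [e]
  have h1 := M.abs_ℓ_le (u - v)
  have h2 := (M.abs_ℓ_le (M.q ν u)).trans (M.norm_q_le ν u)
  have h3 := M.abs_ℓ_le v
  have h4 := (M.abs_ℓ_le (M.q ν u - M.q ν v)).trans (M.norm_q_sub_le ν u v)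
  have := M.c_nonneg
  refine (abs_add_le _ _).trans ?_
  rw [abs_mul, abs_mul]
  have hu := norm_nonneg u
  have hv := norm_nonneg v
  have hw := norm_nonneg (u - v)
  calc |M.ℓ (u - v)| * |M.ℓ (M.q ν u)| + |M.ℓ v| * |M.ℓ (M.q ν u - M.q ν v)|
      ≤ ‖u - v‖ * (M.c * (1 + ‖u‖)) + ‖v‖ * (M.c * (1 + ‖v‖) * ‖u - v‖) := by gcongr
    _ = M.c * (1 + ‖u‖ + ‖v‖ + ‖v‖ ^ 2) * ‖u - v‖ := by ring
    _ ≤ _ := by gcongr; nlinarith [mul_nonneg hu hv]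

variable [Fintype ι]

/-- The velocity of a neuron. -/
noncomputable def drift (Δ : ι → ℝ) (u₀ u : E) : E := M.A u + M.B u₀ + ∑ ν, Δ ν • M.q ν u

/-- A trajectory of the neuron dynamics on `[0, τ]`. -/
def IsPath (Δ : ℝ → ι → ℝ) (τ : ℝ) (u : ℝ → E) : Prop :=
  ∀ t ∈ Icc 0 τ, HasDerivWithinAt u (M.drift (Δ t) (u 0) (u t)) (Icc 0 τ) t

variable {M}

theorem IsPath.continuousOn {Δ : ℝ → ι → ℝ} {τ : ℝ} {u : ℝ → E} (hu : M.IsPath Δ τ u) :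
    ContinuousOn u (Icc 0 τ) := fun t ht => (hu t ht).continuousWithinAt

theorem IsPath.mono {Δ : ℝ → ι → ℝ} {τ σ : ℝ} {u : ℝ → E} (hu : M.IsPath Δ τ u) (h : σ ≤ τ) :
    M.IsPath Δ σ u := fun t ht =>
  (hu t ⟨ht.1, ht.2.trans h⟩).mono (Icc_subset_Icc_right h)

theorem IsPath.congr {Δ Δ' : ℝ → ι → ℝ} {τ : ℝ} {u v : ℝ → E} (hu : M.IsPath Δ τ u)
    (hΔ : ∀ t ∈ Icc 0 τ, Δ' t = Δ t) (huv : ∀ t ∈ Icc 0 τ, v t = u t) : M.IsPath Δ' τ v := by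
  intro t ht
  have h0 : v 0 = u 0 := huv 0 ⟨le_rfl, ht.1.trans ht.2⟩
  rw [hΔ t ht, huv t ht, h0]
  exact (hu t ht).congr huv (huv t ht)

variable (M)

theorem norm_sum_smul_q_le (Δ : ι → ℝ) (u : E) :
    ‖∑ ν, Δ ν • M.q ν u‖ ≤ Fintype.card ι * M.c * ‖Δ‖ * (1 + ‖u‖) := by
  refine (norm_sum_le _ _).trans ?_
  calc ∑ ν, ‖Δ ν • M.q ν u‖ ≤ ∑ _ν : ι, ‖Δ‖ * (M.c * (1 + ‖u‖)) := by
        refine Finset.sum_le_sum fun ν _ => ?_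
        rw [norm_smul]
        exact mul_le_mul (norm_le_pi_norm Δ ν) (M.norm_q_le ν u) (norm_nonneg _) (norm_nonneg _)
    _ = _ := by simp; ring

theorem norm_sum_smul_q_sub_le (Δ : ι → ℝ) (u v : E) :
    ‖∑ ν, Δ ν • (M.q ν u - M.q ν v)‖ ≤
      Fintype.card ι * M.c * ‖Δ‖ * (1 + ‖v‖) * ‖u - v‖ := by
  refine (norm_sum_le _ _).trans ?_
  calc ∑ ν, ‖Δ ν • (M.q ν u - M.q ν v)‖ ≤ ∑ _ν : ι, ‖Δ‖ * (M.c * (1 + ‖v‖) * ‖u - v‖) := by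
        refine Finset.sum_le_sum fun ν _ => ?_
        rw [norm_smul]
        exact mul_le_mul (norm_le_pi_norm Δ ν) (M.norm_q_sub_le ν u v) (norm_nonneg _)
          (norm_nonneg _)
    _ = _ := by simp; ring

theorem norm_drift_le (Δ : ι → ℝ) (u₀ u : E) : ‖M.drift Δ u₀ u‖ ≤
    ‖M.A‖ * ‖u‖ + ‖M.B‖ * ‖u₀‖ + Fintype.card ι * M.c * ‖Δ‖ * (1 + ‖u‖) := by
  refine (norm_add₃_le).trans ?_
  gcongr
  · exact M.A.le_opNorm u
  · exact M.B.le_opNorm u₀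
  · exact M.norm_sum_smul_q_le Δ u

theorem norm_drift_sub_le (Δ Δ' : ι → ℝ) (u₀ v₀ u v : E) :
    ‖M.drift Δ u₀ u - M.drift Δ' v₀ v‖ ≤
      (‖M.A‖ + Fintype.card ι * M.c * ‖Δ‖ * (1 + ‖v‖)) * ‖u - v‖ + (‖M.B‖ * ‖u₀ - v₀‖
        + Fintype.card ι * M.c * ‖Δ - Δ'‖ * (1 + ‖v‖)) := by
  have e : M.drift Δ u₀ u - M.drift Δ' v₀ v = (M.A (u - v) + ∑ ν, Δ ν • (M.q ν u - M.q ν v)) +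
      (M.B (u₀ - v₀) + ∑ ν, (Δ - Δ') ν • M.q ν v) := by
    simp only [drift, map_sub, smul_sub, Finset.sum_sub_distrib, Pi.sub_apply, sub_smul]
    abel
  rw [e]
  refine (norm_add_le _ _).trans ?_
  rw [add_mul]
  gcongr
  · exact (norm_add_le _ _).trans (add_le_add (M.A.le_opNorm _) (M.norm_sum_smul_q_sub_le _ _ _))
  · exact (norm_add_le _ _).trans (add_le_add (M.B.le_opNorm _) (M.norm_sum_smul_q_le _ _))

/-- The rate of growth of the neuron dynamics. -/
noncomputable def growth (τ R : ℝ) : ℝ :=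
  (1 + ‖M.B‖ * τ + Fintype.card ι * M.c * R) * Real.exp (‖M.A‖ * τ + Fintype.card ι * M.c * R)

theorem one_le_growth {τ R : ℝ} (hτ : 0 ≤ τ) (hR : 0 ≤ R) : 1 ≤ M.growth τ R := by
  have := M.c_nonneg
  refine one_le_mul_of_one_le_of_one_le ?_ (Real.one_le_exp (by positivity))
  have : 0 ≤ ‖M.B‖ * τ + Fintype.card ι * M.c * R := by positivity
  linarith

/-- Grönwall's inequality with rate ‖A‖ + n‖Δ‖; the signals enter only through the integral of their
norm. Only a bound on the derivative is assumed, so that the estimate also covers the truncated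
equation used to construct paths. -/
theorem norm_le_growth {τ R : ℝ} {Δ : ℝ → ι → ℝ} (hΔ : Continuous Δ)
    (hR : ∫ s in (0)..τ, ‖Δ s‖ ≤ R) {u u' : ℝ → E}
    (hu : ∀ t ∈ Icc 0 τ, HasDerivWithinAt u (u' t) (Icc 0 τ) t)
    (hu' : ∀ t ∈ Icc 0 τ, ‖u' t‖ ≤
      ‖M.A‖ * ‖u t‖ + ‖M.B‖ * ‖u 0‖ + Fintype.card ι * M.c * ‖Δ t‖ * (1 + ‖u t‖))
    {t : ℝ} (ht : t ∈ Icc 0 τ) : ‖u t‖ ≤ M.growth τ R * (1 + ‖u 0‖) := by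
  set n : ℝ := Fintype.card ι * M.c with hn
  have hn0 : 0 ≤ n := mul_nonneg (Nat.cast_nonneg _) M.c_nonneg
  have hτ : 0 ≤ τ := ht.1.trans ht.2
  have hint : ∫ s in (0)..t, ‖Δ s‖ ≤ R := by
    refine le_trans ?_ hR
    refine intervalIntegral.integral_mono_interval le_rfl ht.1 ht.2 ?_
      (hΔ.norm.intervalIntegrable _ _)
    exact Eventually.of_forall fun _ => norm_nonneg _
  have hint0 : 0 ≤ ∫ s in (0)..t, ‖Δ s‖ :=
    intervalIntegral.integral_nonneg ht.1 fun _ _ => norm_nonneg _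
  have hR0 : 0 ≤ R := hint0.trans hint
  have h := norm_le_of_norm_deriv_le_mul_add (a := fun t => ‖M.A‖ + n * ‖Δ t‖)
    (b := fun t => ‖M.B‖ * ‖u 0‖ + n * ‖Δ t‖) (by fun_prop) (by fun_prop)
    (fun _ => by positivity) (fun _ => by positivity) hu
    (fun t ht => (hu' t ht).trans (by linarith)) ht
  rw [intervalIntegral_const_add_mul hΔ.norm, intervalIntegral_const_add_mul hΔ.norm] at h
  refine h.trans ?_
  rw [growth, ← hn, mul_right_comm _ (Real.exp _)]
  have h1 : ‖u 0‖ + (t * (‖M.B‖ * ‖u 0‖) + n * ∫ s in (0)..t, ‖Δ s‖) ≤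
      (1 + ‖M.B‖ * τ + n * R) * (1 + ‖u 0‖) := by
    have h2 : t * (‖M.B‖ * ‖u 0‖) ≤ τ * (‖M.B‖ * ‖u 0‖) := by gcongr; exact ht.2
    have h3 : n * ∫ s in (0)..t, ‖Δ s‖ ≤ n * R := by gcongr
    have h4 : 0 ≤ n * R * ‖u 0‖ := by positivity
    have h5 : 0 ≤ ‖M.B‖ * τ := by positivity
    linarith
  have h2 : t * ‖M.A‖ + n * ∫ s in (0)..t, ‖Δ s‖ ≤ ‖M.A‖ * τ + n * R := by
    rw [mul_comm]
    gcongr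
    exact ht.2
  exact mul_le_mul h1 (Real.exp_le_exp.2 h2) (Real.exp_nonneg _) (by positivity)

variable {M}

theorem IsPath.norm_le {τ R : ℝ} {Δ : ℝ → ι → ℝ} (hΔ : Continuous Δ)
    (hR : ∫ s in (0)..τ, ‖Δ s‖ ≤ R) {u : ℝ → E} (hu : M.IsPath Δ τ u)
    {t : ℝ} (ht : t ∈ Icc 0 τ) : ‖u t‖ ≤ M.growth τ R * (1 + ‖u 0‖) :=
  M.norm_le_growth hΔ hR hu (fun _ _ => M.norm_drift_le _ _ _) ht

variable (M)

/-- Two trajectories stay close if their initial states and error signals are close. -/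
theorem exists_norm_sub_le {τ R : ℝ} (hτ : 0 ≤ τ) (hR : 0 ≤ R) : ∃ a b : ℝ, 0 ≤ a ∧ 0 ≤ b ∧
    ∀ (Δ Δ' : ℝ → ι → ℝ), Continuous Δ → Continuous Δ' → ∫ s in (0)..τ, ‖Δ s‖ ≤ R →
      ∫ s in (0)..τ, ‖Δ' s‖ ≤ R → ∀ u v : ℝ → E, M.IsPath Δ τ u → M.IsPath Δ' τ v →
      ∀ t ∈ Icc 0 τ, ‖u t - v t‖ ≤
        a * Real.exp (b * ‖v 0‖) * (‖u 0 - v 0‖ + ∫ s in (0)..t, ‖Δ s - Δ' s‖) := by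
  set n : ℝ := Fintype.card ι * M.c with hn
  have hn0 : 0 ≤ n := mul_nonneg (Nat.cast_nonneg _) M.c_nonneg
  set G := M.growth τ R with hG
  have hG1 : 1 ≤ G := M.one_le_growth hτ hR
  -- With V = G (1 + ‖v 0‖) bounding the reference path, Grönwall yields the exponent V + ‖A‖τ + n(1
  -- + V)R, where the first V absorbs the factor 1 + V. The two constants are its part free of ‖v 0‖
  -- and its coefficient of ‖v 0‖.
  refine ⟨(1 + ‖M.B‖ * τ + n) * Real.exp (G + ‖M.A‖ * τ + n * R * (1 + G)), G * (1 + n * R),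
    by positivity, by positivity, ?_⟩
  intro Δ Δ' hΔ hΔ' hΔR hΔR' u v hu hv t ht
  set V := G * (1 + ‖v 0‖) with hV
  have hV0 : 0 ≤ V := by positivity
  have hvV : ∀ t ∈ Icc 0 τ, ‖v t‖ ≤ V := fun t ht => hv.norm_le hΔ' hΔR' ht
  have hint : ∫ s in (0)..t, ‖Δ s‖ ≤ R := by
    refine le_trans ?_ hΔR
    refine intervalIntegral.integral_mono_interval le_rfl ht.1 ht.2 ?_
      (hΔ.norm.intervalIntegrable _ _)
    exact Eventually.of_forall fun _ => norm_nonneg _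
  have h := norm_le_of_norm_deriv_le_mul_add (u := fun t => u t - v t)
    (a := fun t => ‖M.A‖ + n * (1 + V) * ‖Δ t‖)
    (b := fun t => ‖M.B‖ * ‖u 0 - v 0‖ + n * (1 + V) * ‖Δ t - Δ' t‖) (by fun_prop) (by fun_prop)
    (fun _ => by positivity) (fun _ => by positivity) (fun t ht => (hu t ht).sub (hv t ht))
    (fun t ht => (M.norm_drift_sub_le _ _ _ _ _ _).trans (by
      have h1 : ‖v t‖ ≤ V := hvV t ht
      have h2 : n * ‖Δ t‖ * (1 + ‖v t‖) ≤ n * (1 + V) * ‖Δ t‖ := by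
        rw [mul_right_comm]; gcongr
      have h3 : n * ‖Δ t - Δ' t‖ * (1 + ‖v t‖) ≤ n * (1 + V) * ‖Δ t - Δ' t‖ := by
        rw [mul_right_comm]; gcongr
      gcongr)) ht
  rw [intervalIntegral_const_add_mul hΔ.norm,
    intervalIntegral_const_add_mul (g := fun s => ‖Δ s - Δ' s‖) (hΔ.sub hΔ').norm] at h
  refine h.trans ?_
  set I := ∫ s in (0)..t, ‖Δ s - Δ' s‖ with hI
  have hI0 : 0 ≤ I := intervalIntegral.integral_nonneg ht.1 fun _ _ => norm_nonneg _
  have hVe : 1 + V ≤ Real.exp V := by rw [add_comm]; exact Real.add_one_le_exp V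
  have h1 : ‖u 0 - v 0‖ + (t * (‖M.B‖ * ‖u 0 - v 0‖) + n * (1 + V) * I) ≤
      (1 + ‖M.B‖ * τ + n) * Real.exp V * (‖u 0 - v 0‖ + I) := by
    have e1 : 1 ≤ Real.exp V := Real.one_le_exp hV0
    calc ‖u 0 - v 0‖ + (t * (‖M.B‖ * ‖u 0 - v 0‖) + n * (1 + V) * I)
        ≤ ‖u 0 - v 0‖ + (τ * (‖M.B‖ * ‖u 0 - v 0‖) + n * Real.exp V * I) := by
          gcongr; exact ht.2
      _ = (1 + ‖M.B‖ * τ) * 1 * ‖u 0 - v 0‖ + n * Real.exp V * I := by ring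
      _ ≤ (1 + ‖M.B‖ * τ + n) * Real.exp V * ‖u 0 - v 0‖ +
          (1 + ‖M.B‖ * τ + n) * Real.exp V * I := by
          have h3 : 0 ≤ ‖M.B‖ * τ := by positivity
          have h4 : (1 + ‖M.B‖ * τ) * 1 ≤ (1 + ‖M.B‖ * τ + n) * Real.exp V :=
            mul_le_mul (by linarith) e1 zero_le_one (by positivity)
          have h5 : n * Real.exp V ≤ (1 + ‖M.B‖ * τ + n) * Real.exp V :=
            mul_le_mul_of_nonneg_right (by linarith) (by positivity)
          exact add_le_add (mul_le_mul_of_nonneg_right h4 (norm_nonneg _))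
            (mul_le_mul_of_nonneg_right h5 hI0)
      _ = _ := by ring
  have h2 : t * ‖M.A‖ + n * (1 + V) * ∫ s in (0)..t, ‖Δ s‖ ≤ ‖M.A‖ * τ + n * (1 + V) * R := by
    rw [mul_comm t]
    gcongr
    exact ht.2
  calc _ ≤ (1 + ‖M.B‖ * τ + n) * Real.exp V * (‖u 0 - v 0‖ + I) *
        Real.exp (‖M.A‖ * τ + n * (1 + V) * R) := by gcongr
    _ = (1 + ‖M.B‖ * τ + n) * (Real.exp V * Real.exp (‖M.A‖ * τ + n * (1 + V) * R)) *
        (‖u 0 - v 0‖ + I) := by ring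
    _ = (1 + ‖M.B‖ * τ + n) * (Real.exp (G + ‖M.A‖ * τ + n * R * (1 + G)) *
        Real.exp (G * (1 + n * R) * ‖v 0‖)) * (‖u 0 - v 0‖ + I) := by
        rw [← Real.exp_add, ← Real.exp_add, hV]; ring_nf
    _ = _ := by ring

theorem IsPath.eqOn {M : NeuronModel E ι} {τ : ℝ} {Δ : ℝ → ι → ℝ} (hΔ : Continuous Δ)
    {u v : ℝ → E} (hu : M.IsPath Δ τ u) (hv : M.IsPath Δ τ v) (h0 : u 0 = v 0) :
    EqOn u v (Icc 0 τ) := by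
  intro t ht
  have hτ : 0 ≤ τ := ht.1.trans ht.2
  obtain ⟨a, b, -, -, h⟩ := M.exists_norm_sub_le hτ
    (intervalIntegral.integral_nonneg hτ fun s _ => norm_nonneg (Δ s))
  have := h Δ Δ hΔ hΔ le_rfl le_rfl u v hu hv t ht
  simpa [h0, sub_eq_zero] using this

/-- Composed with the retraction onto the ball of radius K, the drift is bounded and globally
Lipschitz in the state. Linear growth keeps the resulting solution in that ball, where the
retraction is the identity. -/
theorem exists_isPath [CompleteSpace E] {Δ : ℝ → ι → ℝ} (hΔ : Continuous Δ) {τ : ℝ} (hτ : 0 ≤ τ)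
    (u₀ : E) : ∃ u, u 0 = u₀ ∧ M.IsPath Δ τ u := by
  set R := ∫ s in (0)..τ, ‖Δ s‖ with hR
  have hR0 : 0 ≤ R := intervalIntegral.integral_nonneg hτ fun _ _ => norm_nonneg _
  set n : ℝ := Fintype.card ι * M.c with hn
  have hn0 : 0 ≤ n := mul_nonneg (Nat.cast_nonneg _) M.c_nonneg
  set K := M.growth τ R * (1 + ‖u₀‖) with hK
  have hK0 : 0 < K := by
    have := M.one_le_growth hτ hR0
    positivity
  obtain ⟨d, hd⟩ := (isCompact_Icc (a := (0 : ℝ)) (b := τ)).exists_bound_of_continuousOn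
    hΔ.continuousOn
  have hd0 : 0 ≤ d := (norm_nonneg _).trans (hd 0 ⟨le_rfl, hτ⟩)
  set L : ℝ := ‖M.A‖ * K + ‖M.B‖ * ‖u₀‖ + n * d * (1 + K) with hL
  have hL0 : 0 ≤ L := by positivity
  set C : ℝ := (‖M.A‖ + n * d * (1 + K)) * 2 with hC
  have hC0 : 0 ≤ C := by positivity
  -- The modified field is bounded by L everywhere, so a ball of radius Lτ gives existence on all of
  -- [0, τ] at once.
  have hpl : IsPicardLindelof (fun t u => M.drift (Δ t) u₀ (radialRetraction K u))
      (⟨0, le_rfl, hτ⟩ : Icc 0 τ) u₀ ⟨L * τ, by positivity⟩ 0 ⟨L, hL0⟩ ⟨C, hC0⟩ := by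
    refine ⟨fun t ht => ?_, fun x _ => ?_, fun t ht x _ => ?_, ?_⟩
    · refine LipschitzWith.lipschitzOnWith (LipschitzWith.of_dist_le_mul fun x y => ?_)
      rw [dist_eq_norm, dist_eq_norm]
      refine (M.norm_drift_sub_le _ _ _ _ _ _).trans ?_
      simp only [sub_self, norm_zero, mul_zero, zero_mul, add_zero]
      change _ ≤ (‖M.A‖ + n * d * (1 + K)) * 2 * ‖x - y‖
      rw [mul_assoc _ (2 : ℝ)]
      have h1 := hd t ht
      have h2 := norm_radialRetraction_le hK0 y
      have h3 := norm_radialRetraction_sub_le hK0 x y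
      gcongr
    · unfold drift
      fun_prop
    · refine (M.norm_drift_le _ _ _).trans ?_
      change _ ≤ L
      have h1 := hd t ht
      have h2 := norm_radialRetraction_le hK0 x
      rw [hL]
      gcongr
    · change L * max (τ - 0) (0 - 0) ≤ L * τ - 0
      rw [sub_zero, sub_zero, sub_zero, max_eq_left hτ]
  obtain ⟨u, hu0, hu⟩ := hpl.exists_eq_forall_mem_Icc_hasDerivWithinAt₀
  change u 0 = u₀ at hu0
  have hb : ∀ t ∈ Icc 0 τ, ‖u t‖ ≤ K := by
    intro t ht
    rw [hK, ← hu0]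
    refine M.norm_le_growth hΔ le_rfl hu (fun t ht => ?_) ht
    refine (M.norm_drift_le _ _ _).trans ?_
    have h1 := norm_radialRetraction_le_norm hK0 (u t)
    rw [hu0]
    gcongr
  refine ⟨u, hu0, fun t ht => ?_⟩
  have := hu t ht
  simp only [radialRetraction_of_norm_le hK0 (hb t ht)] at this
  rwa [hu0]

/-! ### The solution map of the neuron equation -/

section Flow

variable [CompleteSpace E]

/-- The state at time `t` of the neuron started from `u₀` and driven by `Δ`. -/
noncomputable def flow (Δ : C(ℝ, ι → ℝ)) (u₀ : E) (t : ℝ) : E :=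
  if ht : 0 ≤ t then (M.exists_isPath Δ.continuous ht u₀).choose t else u₀

/-- The definition of `flow` chooses a separate path for each final time; uniqueness makes all these
choices agree. -/
theorem flow_eq (Δ : C(ℝ, ι → ℝ)) {τ : ℝ} {u : ℝ → E} (hu : M.IsPath Δ τ u) {t : ℝ}
    (ht : t ∈ Icc 0 τ) : u t = M.flow Δ (u 0) t := by
  have h := (M.exists_isPath Δ.continuous ht.1 (u 0)).choose_spec
  rw [flow, dif_pos ht.1]
  exact (hu.mono ht.2).eqOn Δ.continuous h.2 h.1.symm ⟨ht.1, le_rfl⟩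

@[simp] theorem flow_zero (Δ : C(ℝ, ι → ℝ)) (u₀ : E) : M.flow Δ u₀ 0 = u₀ := by
  rw [flow, dif_pos le_rfl]
  exact (M.exists_isPath Δ.continuous le_rfl u₀).choose_spec.1

theorem isPath_flow (Δ : C(ℝ, ι → ℝ)) (u₀ : E) (τ : ℝ) : M.IsPath Δ τ (M.flow Δ u₀) := by
  intro t ht
  have hτ := ht.1.trans ht.2
  obtain ⟨u, hu0, hu⟩ := M.exists_isPath Δ.continuous hτ u₀
  refine (hu.congr (fun _ _ => rfl) fun s hs => ?_) t ht
  rw [M.flow_eq Δ hu hs, hu0]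

theorem flow_congr {Δ Δ' : C(ℝ, ι → ℝ)} {τ : ℝ} (h : ∀ t ∈ Icc 0 τ, Δ t = Δ' t) (u₀ : E) {t : ℝ}
    (ht : t ∈ Icc 0 τ) : M.flow Δ u₀ t = M.flow Δ' u₀ t := by
  have := M.flow_eq Δ' ((M.isPath_flow Δ u₀ τ).congr (fun t ht => (h t ht).symm) fun _ _ => rfl) ht
  rwa [flow_zero] at this

/-- The constant value at negative times makes the flow continuous on the whole line, so that no
interval has to be carried along later. -/
theorem flow_max_zero (Δ : C(ℝ, ι → ℝ)) (u₀ : E) (t : ℝ) :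
    M.flow Δ u₀ (max t 0) = M.flow Δ u₀ t := by
  rcases le_total 0 t with ht | ht
  · rw [max_eq_left ht]
  · rcases ht.eq_or_lt with rfl | ht'
    · simp
    · rw [max_eq_right ht, flow_zero, flow, dif_neg (not_le.2 ht')]

theorem continuous_flow (Δ : C(ℝ, ι → ℝ)) (u₀ : E) : Continuous (M.flow Δ u₀) := by
  have h : ContinuousOn (M.flow Δ u₀) (Ici 0) := by
    intro t (ht : 0 ≤ t)
    refine ((M.isPath_flow Δ u₀ (t + 1)).continuousOn t
      ⟨ht, by linarith⟩).mono_of_mem_nhdsWithin ?_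
    exact mem_nhdsWithin.2 ⟨Iio (t + 1), isOpen_Iio, by simp, fun s hs =>
      ⟨hs.2, (hs.1 : s < _).le⟩⟩
  have h' := h.comp_continuous (f := fun t => max t 0) (by fun_prop)
    fun t => mem_Ici.2 (le_max_right t 0)
  exact h'.congr (M.flow_max_zero Δ u₀)

theorem continuous_flow_left (Δ : C(ℝ, ι → ℝ)) (t : ℝ) : Continuous fun u₀ => M.flow Δ u₀ t := by
  rcases lt_or_ge t 0 with ht | ht
  · simp only [flow, dif_neg (not_le.2 ht)]
    exact continuous_id
  obtain ⟨a, b, -, -, h⟩ := M.exists_norm_sub_le ht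
    (intervalIntegral.integral_nonneg ht fun s _ => norm_nonneg (Δ s))
  rw [continuous_iff_continuousAt]
  intro v
  rw [ContinuousAt, tendsto_iff_norm_sub_tendsto_zero]
  refine squeeze_zero (fun _ => norm_nonneg _) (fun u => h Δ Δ Δ.continuous Δ.continuous le_rfl
    le_rfl _ _ (M.isPath_flow Δ u t) (M.isPath_flow Δ v t) t ⟨ht, le_rfl⟩) ?_
  simp only [flow_zero, sub_self, norm_zero, intervalIntegral.integral_zero, add_zero]
  have : Tendsto (fun u => a * Real.exp (b * ‖v‖) * ‖u - v‖) (𝓝 v)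
      (𝓝 (a * Real.exp (b * ‖v‖) * ‖v - v‖)) := Continuous.tendsto (by fun_prop) v
  simpa using this

end Flow

end NeuronModel

/-! ### Mean-field predictors -/

/-- All exponential moments of the norm are finite. -/
def HasExpMoments {E : Type*} [NormedAddCommGroup E] [MeasurableSpace E] (μ : Measure E) : Prop :=
  ∀ c : ℝ, Integrable (fun u => Real.exp (c * ‖u‖)) μ

namespace NeuronModel

variable {E ι : Type*} [NormedAddCommGroup E] [NormedSpace ℝ E] [Fintype ι]
  (M : NeuronModel E ι)

theorem sq_one_add_le_exp {x y : ℝ} (hx : 0 ≤ x) (h : x ≤ y) : (1 + x) ^ 2 ≤ Real.exp (2 * y) := by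
  have h1 : 1 + x ≤ Real.exp y := by linarith [Real.add_one_le_exp y]
  calc (1 + x) ^ 2 ≤ Real.exp y ^ 2 := by gcongr
    _ = Real.exp (2 * y) := by rw [← Real.exp_nat_mul]; norm_num

/-- Linear growth turns a quadratic test function into an exponential of the initial norm. The
constants depend on the signals only through R, and the dominating function is integrable under
`HasExpMoments`. -/
theorem exists_abs_le_exp {τ R : ℝ} (hτ : 0 ≤ τ) (hR : 0 ≤ R) : ∃ a b : ℝ, 0 ≤ a ∧ 0 ≤ b ∧
    ∀ (Δ : ℝ → ι → ℝ), Continuous Δ → ∫ s in (0)..τ, ‖Δ s‖ ≤ R → ∀ u : ℝ → E, M.IsPath Δ τ u →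
      ∀ (p : E → ℝ) (C : ℝ), (∀ u, |p u| ≤ C * (1 + ‖u‖) ^ 2) → ∀ t ∈ Icc 0 τ,
        |p (u t)| ≤ C * a * Real.exp (b * ‖u 0‖) := by
  have hG1 := M.one_le_growth hτ hR
  set G := M.growth τ R
  refine ⟨Real.exp (2 * G), 2 * G, by positivity, by positivity, ?_⟩
  intro Δ hΔ hΔR u hu p C hp t ht
  have h1 := sq_one_add_le_exp (norm_nonneg _) (hu.norm_le hΔ hΔR ht)
  have hC : 0 ≤ C := by simpa using (abs_nonneg _).trans (hp 0)
  calc |p (u t)| ≤ C * (1 + ‖u t‖) ^ 2 := hp _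
    _ ≤ C * Real.exp (2 * (G * (1 + ‖u 0‖))) := by gcongr
    _ = _ := by rw [mul_assoc, ← Real.exp_add]; ring_nf

theorem exists_abs_sub_le_exp {τ R : ℝ} (hτ : 0 ≤ τ) (hR : 0 ≤ R) : ∃ a b : ℝ, 0 ≤ a ∧ 0 ≤ b ∧
    ∀ (Δ Δ' : ℝ → ι → ℝ), Continuous Δ → Continuous Δ' → ∫ s in (0)..τ, ‖Δ s‖ ≤ R →
      ∫ s in (0)..τ, ‖Δ' s‖ ≤ R → ∀ u v : ℝ → E, M.IsPath Δ τ u → M.IsPath Δ' τ v →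
      ∀ ν, ∀ t ∈ Icc 0 τ, |M.contrib ν (u t) - M.contrib ν (v t)| ≤
        a * Real.exp (b * ‖v 0‖) * (1 + ‖u 0 - v 0‖) ^ 2 *
          (‖u 0 - v 0‖ + ∫ s in (0)..t, ‖Δ s - Δ' s‖) := by
  obtain ⟨a, b, ha, hb, h⟩ := M.exists_norm_sub_le hτ hR
  have hG1 := M.one_le_growth hτ hR
  set G := M.growth τ R
  have hc := M.c_nonneg
  refine ⟨M.c * Real.exp (4 * G) * a, 4 * G + b, by positivity, by positivity, ?_⟩
  intro Δ Δ' hΔ hΔ' hΔR hΔR' u v hu hv ν t ht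
  have h1 := h Δ Δ' hΔ hΔ' hΔR hΔR' u v hu hv t ht
  set w := ‖u 0 - v 0‖ with hw
  have hw0 : 0 ≤ w := norm_nonneg _
  have h2 : 1 + ‖u t‖ + ‖v t‖ ≤ (1 + 2 * G * (1 + ‖v 0‖)) * (1 + w) := by
    have h3 := hu.norm_le hΔ hΔR ht
    have h4 := hv.norm_le hΔ' hΔR' ht
    have h5 : ‖u 0‖ ≤ ‖v 0‖ + w := norm_le_norm_add_norm_sub' _ _
    have h6 : G * (1 + ‖u 0‖) ≤ G * (1 + (‖v 0‖ + w)) := by gcongr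
    have h7 : 0 ≤ G * ‖v 0‖ * w := by positivity
    have h8 : 0 ≤ G * w := by positivity
    change ‖u t‖ ≤ G * (1 + ‖u 0‖) at h3
    change ‖v t‖ ≤ G * (1 + ‖v 0‖) at h4
    linarith
  have h2' : (1 + 2 * G * (1 + ‖v 0‖)) ^ 2 ≤ Real.exp (2 * (2 * G * (1 + ‖v 0‖))) :=
    sq_one_add_le_exp (by positivity) le_rfl
  set I := ∫ s in (0)..t, ‖Δ s - Δ' s‖ with hI
  have hI0 : 0 ≤ I := intervalIntegral.integral_nonneg ht.1 fun _ _ => norm_nonneg _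
  calc |M.contrib ν (u t) - M.contrib ν (v t)|
      ≤ M.c * (1 + ‖u t‖ + ‖v t‖) ^ 2 * ‖u t - v t‖ := M.abs_contrib_sub_le ν _ _
    _ ≤ M.c * ((1 + 2 * G * (1 + ‖v 0‖)) * (1 + w)) ^ 2 *
        (a * Real.exp (b * ‖v 0‖) * (w + I)) := by gcongr
    _ = M.c * ((1 + 2 * G * (1 + ‖v 0‖)) ^ 2 * (1 + w) ^ 2) *
        (a * Real.exp (b * ‖v 0‖) * (w + I)) := by rw [mul_pow]
    _ ≤ M.c * (Real.exp (2 * (2 * G * (1 + ‖v 0‖))) * (1 + w) ^ 2) *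
        (a * Real.exp (b * ‖v 0‖) * (w + I)) := by gcongr
    _ = M.c * a * (Real.exp (2 * (2 * G * (1 + ‖v 0‖))) *
        Real.exp (b * ‖v 0‖)) * (1 + w) ^ 2 * (w + I) := by ring
    _ = M.c * a * (Real.exp (4 * G) * Real.exp ((4 * G + b) * ‖v 0‖)) * (1 + w) ^ 2 *
        (w + I) := by rw [← Real.exp_add, ← Real.exp_add]; ring_nf
    _ = _ := by ring

/-- The derivative of the squared readout is at most twice the sum of Δ against the contributions,
because decay has the right sign and the anchor is invisible to `ℓ`. The right-hand side dominates
the final squared readout, which is nonnegative. -/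
theorem sq_ℓ_path_le {Δ : ℝ → ι → ℝ} (hΔ : Continuous Δ) {τ : ℝ} (hτ : 0 ≤ τ) {u : ℝ → E}
    (hu : M.IsPath Δ τ u) : 0 ≤ M.ℓ (u 0) ^ 2 +
      2 * ∫ t in (0)..τ, ∑ ν, Δ t ν * M.contrib ν (u t) := by
  have hφ : ContinuousOn (fun t => 2 * ∑ ν, Δ t ν * M.contrib ν (u t)) (Icc 0 τ) := by
    refine continuousOn_const.mul (continuousOn_finsetSum _ fun ν _ => ?_)
    exact ((continuous_apply ν).comp hΔ).continuousOn.mul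
      ((M.continuous_contrib ν).comp_continuousOn hu.continuousOn)
  have hd : ∀ t ∈ Icc 0 τ, HasDerivWithinAt (fun t => M.ℓ (u t) ^ 2)
      (2 * M.ℓ (u t) * M.ℓ (M.drift (Δ t) (u 0) (u t))) (Icc 0 τ) t := by
    intro t ht
    have := ((M.ℓ.hasFDerivAt).comp_hasDerivWithinAt t (hu t ht)).pow 2
    exact this.congr_deriv (by simp)
  have h := intervalIntegral.sub_le_integral_of_hasDeriv_right_of_le hτ
    (fun t ht => (hd t ht).continuousWithinAt)
    (fun t ht => ((hd t ⟨ht.1.le, ht.2.le⟩).hasDerivAt (Icc_mem_nhds ht.1 ht.2)).hasDerivWithinAt)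
    hφ.integrableOn_Icc (fun t ht => by
      have h1 := M.ℓ_mul_A_nonpos (u t)
      have h2 : M.ℓ (u t) * M.ℓ (M.drift (Δ t) (u 0) (u t)) = M.ℓ (u t) * M.ℓ (M.A (u t)) +
          ∑ ν, Δ t ν * M.contrib ν (u t) := by
        simp only [drift, map_add, M.ℓ_B, map_sum, map_smul, smul_eq_mul, contrib, mul_add,
          Finset.mul_sum, add_zero]
        congr 1
        exact Finset.sum_congr rfl fun ν _ => by ring
      rw [mul_assoc, h2]
      linarith)
  rw [intervalIntegral.integral_const_mul] at h
  nlinarith [sq_nonneg (M.ℓ (u τ))]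

/-- Pointwise, |d| ≤ 1 + d². -/
theorem integral_norm_le_of_integral_sum_sq_le {Δ : ℝ → ι → ℝ} (hΔ : Continuous Δ) {τ R : ℝ}
    (hτ : 0 ≤ τ) (h : ∫ t in (0)..τ, ∑ ν, Δ t ν ^ 2 ≤ R) : ∫ t in (0)..τ, ‖Δ t‖ ≤ τ + R := by
  have c1 : ∀ ν, Continuous fun t => Δ t ν := fun ν => (continuous_apply ν).comp hΔ
  have c3 : Continuous fun t => ∑ ν, Δ t ν ^ 2 :=
    continuous_finsetSum _ fun ν _ => (c1 ν).pow 2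
  have h1 : ∫ t in (0)..τ, ‖Δ t‖ ≤ ∫ t in (0)..τ, (1 + ∑ ν, Δ t ν ^ 2) := by
    refine intervalIntegral.integral_mono_on hτ (hΔ.norm.intervalIntegrable _ _)
      ((continuous_const.add c3).intervalIntegrable _ _) fun t _ => ?_
    have hs : 0 ≤ ∑ ν, Δ t ν ^ 2 := Finset.sum_nonneg fun ν _ => sq_nonneg _
    refine (pi_norm_le_iff_of_nonneg (by linarith)).2 fun ν => ?_
    have h2 := Finset.single_le_sum (f := fun ν => Δ t ν ^ 2) (fun ν _ => sq_nonneg _)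
      (Finset.mem_univ ν)
    rw [Real.norm_eq_abs]
    nlinarith [sq_abs (Δ t ν), sq_nonneg (|Δ t ν| - 1), abs_nonneg (Δ t ν)]
  rw [intervalIntegral.integral_add (continuous_const.intervalIntegrable _ _)
    (c3.intervalIntegrable _ _)] at h1
  rw [intervalIntegral.integral_const, smul_eq_mul, sub_zero, mul_one] at h1
  linarith

variable [CompleteSpace E] [MeasurableSpace E] [BorelSpace E] {μ : Measure E}

/-- The mean contribution to the output on the pattern `ν` at time `t` of neurons whose initial
states have the law `μ`. -/
noncomputable def meanContrib (μ : Measure E) (Δ : C(ℝ, ι → ℝ)) (ν : ι) (t : ℝ) : ℝ :=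
  ∫ u, M.contrib ν (M.flow Δ u t) ∂μ

theorem integrable_comp_flow (hμ : HasExpMoments μ) (Δ : C(ℝ, ι → ℝ)) {p : E → ℝ} {C : ℝ}
    (hp : Continuous p) (hpC : ∀ u, |p u| ≤ C * (1 + ‖u‖) ^ 2) (t : ℝ) :
    Integrable (fun u => p (M.flow Δ u t)) μ := by
  rw [← funext fun u => congrArg p (M.flow_max_zero Δ u t)]
  obtain ⟨a, b, -, -, h⟩ := M.exists_abs_le_exp (le_max_right t 0)
    (intervalIntegral.integral_nonneg (le_max_right t 0) fun s _ => norm_nonneg (Δ s))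
  refine Integrable.mono' ((hμ b).const_mul (C * a))
    (hp.comp (M.continuous_flow_left Δ _)).aestronglyMeasurable (Eventually.of_forall fun u => ?_)
  have := h Δ Δ.continuous le_rfl _ (M.isPath_flow Δ u _) p C hpC _ ⟨le_max_right t 0, le_rfl⟩
  rwa [flow_zero] at this

theorem continuous_integral_comp_flow (hμ : HasExpMoments μ) (Δ : C(ℝ, ι → ℝ)) {p : E → ℝ} {C : ℝ}
    (hp : Continuous p) (hpC : ∀ u, |p u| ≤ C * (1 + ‖u‖) ^ 2) :
    Continuous fun t => ∫ u, p (M.flow Δ u t) ∂μ := by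
  rw [continuous_iff_continuousAt]
  intro t
  have hT : 0 ≤ max (t + 1) 0 := le_max_right _ _
  obtain ⟨a, b, -, -, h⟩ := M.exists_abs_le_exp hT
    (intervalIntegral.integral_nonneg hT fun s _ => norm_nonneg (Δ s))
  refine continuousAt_of_dominated (bound := fun u => C * a * Real.exp (b * ‖u‖))
    (Eventually.of_forall fun t =>
      (hp.comp (M.continuous_flow_left Δ t)).aestronglyMeasurable) ?_
    ((hμ b).const_mul _) (Eventually.of_forall fun u =>
      (hp.comp (M.continuous_flow Δ u)).continuousAt)
  filter_upwards [Iio_mem_nhds (show t < t + 1 by linarith)] with s hs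
  refine Eventually.of_forall fun u => ?_
  have := h Δ Δ.continuous le_rfl _ (M.isPath_flow Δ u _) p C hpC (max s 0)
    ⟨le_max_right s 0, max_le_max (le_of_lt hs) le_rfl⟩
  rwa [flow_zero, flow_max_zero] at this

theorem integrable_contrib (hμ : HasExpMoments μ) (Δ : C(ℝ, ι → ℝ)) (ν : ι) (t : ℝ) :
    Integrable (fun u => M.contrib ν (M.flow Δ u t)) μ :=
  M.integrable_comp_flow hμ Δ (M.continuous_contrib ν) (M.abs_contrib_le ν) t

theorem continuous_meanContrib (hμ : HasExpMoments μ) (Δ : C(ℝ, ι → ℝ)) (ν : ι) :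
    Continuous (M.meanContrib μ Δ ν) :=
  M.continuous_integral_comp_flow hμ Δ (M.continuous_contrib ν) (M.abs_contrib_le ν)

theorem exists_abs_meanContrib_le (hμ : HasExpMoments μ) {τ R : ℝ} (hτ : 0 ≤ τ) (hR : 0 ≤ R) :
    ∃ C : ℝ, 0 ≤ C ∧ ∀ Δ : C(ℝ, ι → ℝ), ∫ s in (0)..τ, ‖Δ s‖ ≤ R → ∀ ν, ∀ t ∈ Icc 0 τ,
      |M.meanContrib μ Δ ν t| ≤ C := by
  obtain ⟨a, b, ha, -, h⟩ := M.exists_abs_le_exp hτ hR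
  have hc := M.c_nonneg
  refine ⟨∫ u, M.c * a * Real.exp (b * ‖u‖) ∂μ, integral_nonneg fun u => by positivity, ?_⟩
  intro Δ hΔ ν t ht
  rw [meanContrib, ← Real.norm_eq_abs]
  refine norm_integral_le_of_norm_le ((hμ b).const_mul _) (Eventually.of_forall fun u => ?_)
  have := h Δ Δ.continuous hΔ _ (M.isPath_flow Δ u _) _ _ (M.abs_contrib_le ν) t ht
  rwa [flow_zero] at this

/-- The dependence on the signals is causal: the bound at time t sees only the past of t. Both the
contraction argument and uniqueness by Grönwall rely on this. -/
theorem exists_abs_meanContrib_sub_le (hμ : HasExpMoments μ) {τ R : ℝ} (hτ : 0 ≤ τ) (hR : 0 ≤ R) :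
    ∃ L : ℝ, 0 ≤ L ∧ ∀ Δ Δ' : C(ℝ, ι → ℝ), ∫ s in (0)..τ, ‖Δ s‖ ≤ R →
      ∫ s in (0)..τ, ‖Δ' s‖ ≤ R → ∀ ν, ∀ t ∈ Icc 0 τ,
        |M.meanContrib μ Δ ν t - M.meanContrib μ Δ' ν t| ≤ L * ∫ s in (0)..t, ‖Δ s - Δ' s‖ := by
  obtain ⟨a, b, ha, -, h⟩ := M.exists_abs_sub_le_exp hτ hR
  refine ⟨∫ u, a * Real.exp (b * ‖u‖) ∂μ, integral_nonneg fun u => by positivity, ?_⟩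
  intro Δ Δ' hΔ hΔ' ν t ht
  rw [meanContrib, meanContrib, ← integral_sub (M.integrable_contrib hμ Δ ν t)
    (M.integrable_contrib hμ Δ' ν t), ← integral_mul_const,
    ← Real.norm_eq_abs]
  refine norm_integral_le_of_norm_le (((hμ b).const_mul a).mul_const _)
    (Eventually.of_forall fun u => ?_)
  have := h Δ Δ' Δ.continuous Δ'.continuous hΔ hΔ' _ _ (M.isPath_flow Δ u _)
    (M.isPath_flow Δ' u _) ν t ht
  rw [flow_zero, flow_zero, sub_self, norm_zero, zero_add, add_zero, one_pow, mul_one] at this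
  exact this

theorem sq_ℓ_integrable (hμ : HasExpMoments μ) : Integrable (fun u => M.ℓ u ^ 2) μ := by
  refine Integrable.mono' (hμ 2) (by fun_prop) (Eventually.of_forall fun u => ?_)
  rw [Real.norm_of_nonneg (sq_nonneg _), ← sq_abs]
  refine le_trans ?_ (sq_one_add_le_exp (norm_nonneg _) le_rfl)
  have := M.abs_ℓ_le u
  gcongr
  linarith

/-- The a priori estimate. The averaged energy inequality bounds the work of Δ from below by minus
half the initial energy, while self-consistency bounds it from above by Δ(y − Δ). The hypothesis is
only an inequality, so that truncated signals satisfy it as well. -/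
theorem integral_sum_sq_le [IsProbabilityMeasure μ] (hμ : HasExpMoments μ) (Δ : C(ℝ, ι → ℝ))
    {τ κ : ℝ} (hτ : 0 ≤ τ) (hκ : 0 ≤ κ) (y : ι → ℝ)
    (hΔ : ∀ t ∈ Icc 0 τ, ∀ ν, Δ t ν ^ 2 ≤ Δ t ν * (y ν - κ * M.meanContrib μ Δ ν t)) :
    ∫ t in (0)..τ, ∑ ν, Δ t ν ^ 2 ≤ κ * ∫ u, M.ℓ u ^ 2 ∂μ + τ * ∑ ν, y ν ^ 2 := by
  set g : ℝ → E → ℝ := fun t u => ∑ ν, Δ t ν * M.contrib ν (M.flow Δ u t) with hg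
  have hgm : StronglyMeasurable (Function.uncurry g) := by
    refine stronglyMeasurable_uncurry_of_continuous_of_stronglyMeasurable (fun u => ?_)
      fun t => Continuous.stronglyMeasurable ?_
    · refine continuous_finsetSum _ fun ν _ => ?_
      exact ((continuous_apply ν).comp Δ.continuous).mul
        ((M.continuous_contrib ν).comp (M.continuous_flow Δ u))
    · refine continuous_finsetSum _ fun ν _ => ?_
      exact continuous_const.mul ((M.continuous_contrib ν).comp (M.continuous_flow_left Δ t))
  obtain ⟨a, b, ha, -, h⟩ := M.exists_abs_le_exp hτ
    (intervalIntegral.integral_nonneg hτ fun s _ => norm_nonneg (Δ s))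
  obtain ⟨d, hd⟩ := (isCompact_Icc (a := (0 : ℝ)) (b := τ)).exists_bound_of_continuousOn
    Δ.continuous.continuousOn
  have hd0 : 0 ≤ d := (norm_nonneg _).trans (hd 0 ⟨le_rfl, hτ⟩)
  have hgb : ∀ t ∈ Icc 0 τ, ∀ u, ‖g t u‖ ≤
      (∑ _ν : ι, d * (M.c * a)) * Real.exp (b * ‖u‖) := by
    intro t ht u
    rw [Finset.sum_mul]
    refine (norm_sum_le _ _).trans (Finset.sum_le_sum fun ν _ => ?_)
    have h1 := h Δ Δ.continuous le_rfl _ (M.isPath_flow Δ u _) _ _ (M.abs_contrib_le ν) t ht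
    rw [flow_zero] at h1
    rw [norm_mul, mul_assoc]
    exact mul_le_mul ((norm_le_pi_norm _ ν).trans (hd t ht)) h1 (norm_nonneg _) hd0
  have : IsFiniteMeasure ((volume : Measure ℝ).restrict (uIoc 0 τ)) := by
    rw [uIoc_of_le hτ]; infer_instance
  have hgi : Integrable (Function.uncurry g) ((volume.restrict (uIoc 0 τ)).prod μ) := by
    refine Integrable.mono' (((hμ b).const_mul (∑ _ν : ι, d * (M.c * a))).comp_snd
      (volume.restrict (uIoc 0 τ))) hgm.aestronglyMeasurable ?_
    have : ∀ᵐ z ∂((volume.restrict (uIoc 0 τ)).prod μ), z.1 ∈ uIoc 0 τ :=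
      Measure.quasiMeasurePreserving_fst.ae (ae_restrict_mem measurableSet_uIoc)
    filter_upwards [this] with z hz
    rw [uIoc_of_le hτ] at hz
    exact hgb z.1 ⟨hz.1.le, hz.2⟩ z.2
  have hswap := intervalIntegral_integral_swap hgi
  have hgi2 : Integrable (fun u => ∫ t in (0)..τ, g t u) μ := by
    have := hgi.integral_prod_right
    simp only [Function.uncurry] at this
    simpa only [intervalIntegral.integral_of_le hτ, uIoc_of_le hτ] using this
  have h1 : 0 ≤ ∫ u, (M.ℓ u ^ 2 + 2 * ∫ t in (0)..τ, g t u) ∂μ := by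
    refine integral_nonneg fun u => ?_
    have := M.sq_ℓ_path_le Δ.continuous hτ (M.isPath_flow Δ u τ)
    rwa [flow_zero] at this
  rw [integral_add (M.sq_ℓ_integrable hμ) (hgi2.const_mul 2), integral_const_mul, ← hswap] at h1
  have h2 : ∀ t, ∫ u, g t u ∂μ = ∑ ν, Δ t ν * M.meanContrib μ Δ ν t := by
    intro t
    rw [hg, integral_finsetSum _ fun ν _ => (M.integrable_contrib hμ Δ ν t).const_mul _]
    simp only [integral_const_mul, meanContrib]
  simp only [h2] at h1
  have c1 : ∀ ν, Continuous fun t => Δ t ν := fun ν => (continuous_apply ν).comp Δ.continuous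
  have c2 : Continuous fun t => ∑ ν, Δ t ν * M.meanContrib μ Δ ν t :=
    continuous_finsetSum _ fun ν _ => (c1 ν).mul (M.continuous_meanContrib hμ Δ ν)
  have c3 : Continuous fun t => ∑ ν, Δ t ν ^ 2 :=
    continuous_finsetSum _ fun ν _ => (c1 ν).pow 2
  -- Doubling the hypothesis and using 2Δy ≤ Δ² + y² leaves one Δ² on the left.
  have h3 : ∫ t in (0)..τ, (∑ ν, Δ t ν ^ 2 + 2 * κ * ∑ ν, Δ t ν * M.meanContrib μ Δ ν t) ≤
      ∫ _t in (0)..τ, ∑ ν, y ν ^ 2 := by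
    refine intervalIntegral.integral_mono_on hτ ((c3.add (c2.const_mul _)).intervalIntegrable _ _)
      (continuous_const.intervalIntegrable _ _) fun t ht => ?_
    rw [Finset.mul_sum, ← Finset.sum_add_distrib]
    refine Finset.sum_le_sum fun ν _ => ?_
    nlinarith [hΔ t ht ν, sq_nonneg (Δ t ν - y ν)]
  rw [intervalIntegral.integral_add (c3.intervalIntegrable _ _)
    ((c2.const_mul _).intervalIntegrable _ _), intervalIntegral.integral_const_mul,
    intervalIntegral.integral_const, smul_eq_mul, sub_zero] at h3
  nlinarith

end NeuronModel

/-! ### Self-consistent error signals -/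

/-- Truncation of a real number at absolute value `R`. -/
def truncAt (R x : ℝ) : ℝ := max (-R) (min R x)

theorem abs_truncAt_le {R : ℝ} (hR : 0 ≤ R) (x : ℝ) : |truncAt R x| ≤ R :=
  abs_le.2 ⟨le_max_left _ _, max_le (by linarith) (min_le_left _ _)⟩

theorem truncAt_of_abs_le {R x : ℝ} (h : |x| ≤ R) : truncAt R x = x := by
  rw [truncAt, min_eq_right (abs_le.1 h).2, max_eq_right (abs_le.1 h).1]

theorem abs_truncAt_sub_le (R x y : ℝ) : |truncAt R x - truncAt R y| ≤ |x - y| := by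
  rw [truncAt, truncAt, max_comm, max_comm (-R)]
  refine (abs_max_sub_max_le_abs _ _ _).trans ?_
  rw [min_comm, min_comm R]
  exact abs_min_sub_min_le_max x R y R |>.trans (by simp)

/-- Truncation keeps the sign and does not increase the absolute value. This is what lets truncated
signals enter the energy estimate. -/
theorem truncAt_sq_le {R : ℝ} (hR : 0 ≤ R) (x : ℝ) : truncAt R x ^ 2 ≤ truncAt R x * x := by
  unfold truncAt
  rcases le_total R x with h | h
  · rw [min_eq_left h, max_eq_right (by linarith)]
    nlinarith
  · rw [min_eq_right h]
    rcases le_total (-R) x with h' | h'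
    · rw [max_eq_right h', sq]
    · rw [max_eq_left h']
      nlinarith

theorem continuous_truncAt (R : ℝ) : Continuous (truncAt R) := by
  unfold truncAt
  fun_prop

section TruncSignal

variable {ι : Type*} [Fintype ι]

/-- Truncated error signals, as a function of exponentially discounted ones. -/
noncomputable def truncSignal (m R : ℝ) (a : ℝ →ᵇ (ι → ℝ)) : C(ℝ, ι → ℝ) where
  toFun t ν := truncAt R (Real.exp (m * t) * a t ν)
  continuous_toFun := by
    refine continuous_pi fun ν => (continuous_truncAt R).comp ?_
    exact (by fun_prop : Continuous fun t : ℝ => Real.exp (m * t)).mul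
      ((continuous_apply ν).comp a.continuous)

theorem integral_norm_truncSignal_le {m R τ : ℝ} (hR : 0 ≤ R) (hτ : 0 ≤ τ) (a : ℝ →ᵇ (ι → ℝ)) :
    ∫ s in (0)..τ, ‖truncSignal m R a s‖ ≤ τ * R := by
  have h := intervalIntegral.integral_mono_on (g := fun _ => R) hτ
    ((truncSignal m R a).continuous.norm.intervalIntegrable (μ := volume) _ _)
    (continuous_const.intervalIntegrable _ _)
    fun t _ => (pi_norm_le_iff_of_nonneg hR).2 fun ν => abs_truncAt_le hR _
  simpa using h

end TruncSignal

namespace NeuronModel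

variable {E ι : Type*} [NormedAddCommGroup E] [NormedSpace ℝ E] [Fintype ι]
  (M : NeuronModel E ι) [CompleteSpace E] [MeasurableSpace E] [BorelSpace E] {μ : Measure E}

/-- The error signals `Δ` on `[0, τ]` are those of the predictor that they generate. -/
def IsSelfConsistent (μ : Measure E) (κ : ℝ) (y : ι → ℝ) (Δ : C(ℝ, ι → ℝ)) (τ : ℝ) : Prop :=
  ∀ t ∈ Icc 0 τ, ∀ ν, Δ t ν = y ν - κ * M.meanContrib μ Δ ν t

/-- The integrated difference of the signals vanishes at time zero and has a derivative bounded by a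
multiple of itself. -/
theorem IsSelfConsistent.eqOn {M : NeuronModel E ι} (hμ : HasExpMoments μ) {κ : ℝ} (hκ : 0 ≤ κ)
    {y : ι → ℝ} {Δ Δ' : C(ℝ, ι → ℝ)} {τ : ℝ} (h : M.IsSelfConsistent μ κ y Δ τ)
    (h' : M.IsSelfConsistent μ κ y Δ' τ) : EqOn Δ Δ' (Icc 0 τ) := by
  intro t ht
  have hτ : 0 ≤ τ := ht.1.trans ht.2
  have hR := intervalIntegral.integral_nonneg (μ := volume) hτ fun s _ => norm_nonneg (Δ s)
  obtain ⟨L, hL, hl⟩ := M.exists_abs_meanContrib_sub_le hμ hτ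
    (hR.trans (le_max_left _ (∫ s in (0)..τ, ‖Δ' s‖)))
  have hc : Continuous fun s => ‖Δ s - Δ' s‖ := by fun_prop
  have hb : ∀ t ∈ Icc 0 τ, ‖Δ t - Δ' t‖ ≤ κ * L * ∫ s in (0)..t, ‖Δ s - Δ' s‖ := by
    intro t ht
    have hI : 0 ≤ ∫ s in (0)..t, ‖Δ s - Δ' s‖ :=
      intervalIntegral.integral_nonneg ht.1 fun _ _ => norm_nonneg _
    refine (pi_norm_le_iff_of_nonneg (by positivity)).2 fun ν => ?_
    rw [Pi.sub_apply, h t ht ν, h' t ht ν, sub_sub_sub_cancel_left, ← mul_sub, norm_mul,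
      Real.norm_of_nonneg hκ, mul_assoc, norm_sub_rev]
    exact mul_le_mul_of_nonneg_left (hl Δ Δ' (le_max_left _ _) (le_max_right _ _) ν t ht) hκ
  have hD : ∀ t ∈ Icc 0 τ, HasDerivWithinAt (fun t => ∫ s in (0)..t, ‖Δ s - Δ' s‖)
      ‖Δ t - Δ' t‖ (Icc 0 τ) t := fun t _ =>
    (intervalIntegral.integral_hasDerivAt_right (hc.intervalIntegrable _ _)
      (hc.stronglyMeasurableAtFilter _ _) hc.continuousAt).hasDerivWithinAt
  have hz := norm_le_of_norm_deriv_le_mul_add (a := fun _ => κ * L) (b := fun _ => 0)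
    continuous_const continuous_const (fun _ => by positivity) (fun _ => le_rfl) hD
    (fun t ht => by
      rw [norm_norm, add_zero, Real.norm_of_nonneg
        (intervalIntegral.integral_nonneg ht.1 fun _ _ => norm_nonneg _)]
      exact hb t ht) ht
  simp only [intervalIntegral.integral_same, norm_zero, intervalIntegral.integral_zero, add_zero,
    zero_mul, norm_le_zero_iff] at hz
  have := hb t ht
  rw [hz, mul_zero] at this
  exact sub_eq_zero.1 (norm_le_zero_iff.1 this)

/-- Truncation makes the predictor a globally Lipschitz causal function of the signals. In terms of
signals discounted by exp(−mt), the self-consistency map is then a contraction for the supremum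
norm. -/
theorem exists_truncated_fixedPoint (hμ : HasExpMoments μ) {κ R τ : ℝ} (hκ : 0 ≤ κ) (hR : 0 ≤ R)
    (hτ : 0 ≤ τ) (y : ι → ℝ) : ∃ Δ : C(ℝ, ι → ℝ), ∀ t ∈ Icc 0 τ, ∀ ν,
      Δ t ν = truncAt R (y ν - κ * M.meanContrib μ Δ ν t) := by
  obtain ⟨L, hL, hl⟩ := M.exists_abs_meanContrib_sub_le hμ hτ (mul_nonneg hτ hR)
  obtain ⟨C, hC, hc⟩ := M.exists_abs_meanContrib_le hμ hτ (mul_nonneg hτ hR)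
  -- Integrating the weight gains a factor 1/m, so the Lipschitz constant becomes κL/m ≤ 1/2.
  set m : ℝ := 2 * (κ * L) + 1 with hm
  have hm0 : 0 < m := by positivity
  -- Clamping time to [0, τ] places the map in the complete space of bounded continuous functions on
  -- the line.
  set r : ℝ → ℝ := fun t => max 0 (min τ t) with hr
  have hrc : Continuous r := by fun_prop
  have hrm : ∀ t, r t ∈ Icc 0 τ := fun t => ⟨le_max_left _ _, max_le hτ (min_le_left _ _)⟩
  have hre : ∀ t ∈ Icc 0 τ, r t = t := fun t ht => by
    rw [hr]; simp [ht.1, ht.2]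
  let F : (ℝ →ᵇ (ι → ℝ)) → ℝ → ι → ℝ := fun a t ν =>
    Real.exp (-(m * r t)) * (y ν - κ * M.meanContrib μ (truncSignal m R a) ν (r t))
  have hFc : ∀ a, Continuous (F a) := fun a => continuous_pi fun ν => by
    have := (M.continuous_meanContrib hμ (truncSignal m R a) ν).comp hrc
    exact (by fun_prop : Continuous fun t => Real.exp (-(m * r t))).mul
      (continuous_const.sub (continuous_const.mul this))
  have hFb : ∀ a t, ‖F a t‖ ≤ ‖y‖ + κ * C := by
    intro a t
    refine (pi_norm_le_iff_of_nonneg (by positivity)).2 fun ν => ?_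
    rw [norm_mul, Real.norm_of_nonneg (Real.exp_nonneg _)]
    have h1 : Real.exp (-(m * r t)) ≤ 1 :=
      Real.exp_le_one_iff.2 (by have := mul_nonneg hm0.le (hrm t).1; linarith)
    refine (mul_le_of_le_one_left (norm_nonneg _) h1).trans ((norm_sub_le _ _).trans ?_)
    refine add_le_add (norm_le_pi_norm y ν) ?_
    rw [norm_mul, Real.norm_of_nonneg hκ]
    exact mul_le_mul_of_nonneg_left
      (hc _ (integral_norm_truncSignal_le hR hτ a) ν _ (hrm t)) hκ
  let Φ : (ℝ →ᵇ (ι → ℝ)) → (ℝ →ᵇ (ι → ℝ)) := fun a =>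
    BoundedContinuousFunction.ofNormedAddCommGroup (F a) (hFc a) _ (hFb a)
  have hΦ : ContractingWith (1 / 2) Φ := by
    refine ⟨by rw [← NNReal.coe_lt_coe]; norm_num, LipschitzWith.of_dist_le_mul fun a b => ?_⟩
    refine (BoundedContinuousFunction.dist_le (by positivity)).2 fun t => ?_
    rw [dist_eq_norm]
    refine (pi_norm_le_iff_of_nonneg (by positivity)).2 fun ν => ?_
    change ‖F a t ν - F b t ν‖ ≤ _
    have e : F a t ν - F b t ν = Real.exp (-(m * r t)) *
        (κ * (M.meanContrib μ (truncSignal m R b) ν (r t) -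
          M.meanContrib μ (truncSignal m R a) ν (r t))) := by
      simp only [F]; ring
    have h1 := hl _ _ (integral_norm_truncSignal_le (m := m) hR hτ b)
      (integral_norm_truncSignal_le (m := m) hR hτ a) ν _ (hrm t)
    have h2 : ∫ s in (0)..r t, ‖truncSignal m R b s - truncSignal m R a s‖ ≤
        ∫ s in (0)..r t, dist a b * Real.exp (m * s) := by
      refine intervalIntegral.integral_mono_on (hrm t).1
        (((truncSignal m R b).continuous.sub
          (truncSignal m R a).continuous).norm.intervalIntegrable _ _)
        ((by fun_prop : Continuous fun s => dist a b * Real.exp (m * s)).intervalIntegrable _ _)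
        fun s _ => (pi_norm_le_iff_of_nonneg (by positivity)).2 fun ν => ?_
      refine (abs_truncAt_sub_le _ _ _).trans ?_
      rw [← mul_sub, abs_mul, abs_of_pos (Real.exp_pos _), mul_comm]
      refine mul_le_mul_of_nonneg_right ?_ (Real.exp_nonneg _)
      rw [abs_sub_comm]
      calc |a s ν - b s ν| ≤ ‖a s - b s‖ := norm_le_pi_norm (a s - b s) ν
        _ = dist (a s) (b s) := (dist_eq_norm _ _).symm
        _ ≤ dist a b := BoundedContinuousFunction.dist_coe_le_dist s
    have h3 : ∫ s in (0)..r t, dist a b * Real.exp (m * s) ≤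
        dist a b * (Real.exp (m * r t) / m) := by
      rw [intervalIntegral.integral_const_mul,
        intervalIntegral.integral_comp_mul_left (fun s => Real.exp s) hm0.ne', integral_exp,
        smul_eq_mul, mul_zero, Real.exp_zero, inv_mul_eq_div]
      gcongr
      linarith
    rw [e, norm_mul, norm_mul, Real.norm_of_nonneg hκ, Real.norm_of_nonneg (Real.exp_nonneg _)]
    calc _ ≤ Real.exp (-(m * r t)) * (κ * (L * (dist a b * (Real.exp (m * r t) / m)))) := by
          gcongr
          exact h1.trans (by gcongr; exact h2.trans h3)
      _ = (Real.exp (-(m * r t)) * Real.exp (m * r t)) * (κ * L / m) * dist a b := by ring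
      _ = κ * L / m * dist a b := by rw [← Real.exp_add]; simp
      _ ≤ 1 / 2 * dist a b := by
          refine mul_le_mul_of_nonneg_right ?_ dist_nonneg
          rw [div_le_iff₀ hm0, hm]
          linarith
      _ = _ := by simp
  set a := ContractingWith.fixedPoint Φ hΦ
  have ha : Φ a = a := hΦ.fixedPoint_isFixedPt
  refine ⟨truncSignal m R a, fun t ht ν => ?_⟩
  have h1 : a t ν = Real.exp (-(m * t)) * (y ν - κ * M.meanContrib μ (truncSignal m R a) ν t) := by
    conv_lhs => rw [← ha]
    change F a t ν = _
    simp only [F, hre t ht]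
  change truncAt R (Real.exp (m * t) * a t ν) = _
  rw [h1, ← mul_assoc, ← Real.exp_add, add_neg_cancel, Real.exp_zero, one_mul]

theorem exists_isSelfConsistent_Icc [IsProbabilityMeasure μ] (hμ : HasExpMoments μ) {κ τ : ℝ}
    (hκ : 0 ≤ κ) (hτ : 0 ≤ τ) (y : ι → ℝ) : ∃ Δ, M.IsSelfConsistent μ κ y Δ τ := by
  have hM : 0 ≤ ∫ u, M.ℓ u ^ 2 ∂μ := integral_nonneg fun u => sq_nonneg _
  set R₁ := κ * ∫ u, M.ℓ u ^ 2 ∂μ + τ * ∑ ν, y ν ^ 2 with hR₁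
  have hR₁0 : 0 ≤ R₁ := by positivity
  obtain ⟨C, hC, hc⟩ := M.exists_abs_meanContrib_le hμ hτ (add_nonneg hτ hR₁0)
  -- The constant C comes from the a priori bound, which does not involve the truncation level. The
  -- level can therefore be taken so large that truncation never acts.
  have hR : 0 ≤ ‖y‖ + κ * C := by positivity
  obtain ⟨Δ, hΔ⟩ := M.exists_truncated_fixedPoint hμ hκ hR hτ y
  have h1 : ∫ t in (0)..τ, ‖Δ t‖ ≤ τ + R₁ := by
    refine integral_norm_le_of_integral_sum_sq_le Δ.continuous hτ
      (M.integral_sum_sq_le hμ Δ hτ hκ y fun t ht ν => ?_)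
    rw [hΔ t ht ν]
    exact truncAt_sq_le hR _
  refine ⟨Δ, fun t ht ν => ?_⟩
  rw [hΔ t ht ν]
  refine truncAt_of_abs_le ((norm_sub_le _ _).trans (add_le_add (norm_le_pi_norm y ν) ?_))
  rw [norm_mul, Real.norm_of_nonneg hκ]
  exact mul_le_mul_of_nonneg_left (hc Δ h1 ν t ht) hκ

theorem IsSelfConsistent.mono {M : NeuronModel E ι} {κ : ℝ} {y : ι → ℝ} {Δ : C(ℝ, ι → ℝ)}
    {σ τ : ℝ} (h : M.IsSelfConsistent μ κ y Δ τ) (hσ : σ ≤ τ) : M.IsSelfConsistent μ κ y Δ σ :=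
  fun t ht => h t ⟨ht.1, ht.2.trans hσ⟩

/-- The solutions on finite horizons agree on common intervals by uniqueness, so their values at
their own final times form one global continuous signal. -/
theorem exists_isSelfConsistent [IsProbabilityMeasure μ] (hμ : HasExpMoments μ) {κ : ℝ}
    (hκ : 0 ≤ κ) (y : ι → ℝ) : ∃ Δ, ∀ τ, M.IsSelfConsistent μ κ y Δ τ := by
  choose S hS using fun τ : ℝ =>
    M.exists_isSelfConsistent_Icc hμ hκ (le_max_right τ 0) y
  have hSS : ∀ {σ τ : ℝ}, 0 ≤ σ → σ ≤ τ → S σ σ = S τ σ := by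
    intro σ τ h0 h
    refine ((hS σ).mono (le_max_left _ _)).eqOn hμ hκ
      ((hS τ).mono (h.trans (le_max_left _ _))) ⟨h0, le_rfl⟩
  have hc : ContinuousOn (fun t => S t t) (Ici 0) := by
    intro t (ht : 0 ≤ t)
    refine (((S (t + 1)).continuous.continuousWithinAt (s := Ici 0) (x := t)).congr_of_eventuallyEq
      ?_ (hSS ht (by linarith)))
    refine mem_nhdsWithin.2 ⟨Iio (t + 1), isOpen_Iio, by simp, fun s hs => ?_⟩
    exact hSS hs.2 (le_of_lt hs.1)
  let Δ : C(ℝ, ι → ℝ) := ⟨fun t => S (max t 0) (max t 0),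
    hc.comp_continuous (f := fun t => max t 0) (by fun_prop) fun t => mem_Ici.2 (le_max_right t 0)⟩
  have hΔ : ∀ t, 0 ≤ t → ∀ s ∈ Icc 0 t, Δ s = S t s := by
    intro t _ s hs
    change S (max s 0) (max s 0) = _
    rw [max_eq_left hs.1, hSS hs.1 hs.2]
  refine ⟨Δ, fun τ t ht ν => ?_⟩
  have h1 := hS t t ⟨ht.1, le_max_left _ _⟩ ν
  rw [hΔ t ht.1 t ⟨ht.1, le_rfl⟩, h1, meanContrib, meanContrib]
  simp_rw [M.flow_congr (hΔ t ht.1) _ ⟨ht.1, le_rfl⟩]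

end NeuronModel

/-! ### Asymptotically almost sure events -/

section HoldsInProb

variable {Ω : ℕ → Type*} [∀ N, MeasurableSpace (Ω N)]

/-- The events `p N` hold with (outer) probability tending to one. -/
def HoldsInProb (P : ∀ N, Measure (Ω N)) (p : ∀ N, Ω N → Prop) : Prop :=
  Tendsto (fun N => P N {ω | ¬ p N ω}) atTop (𝓝 0)

variable {P : ∀ N, Measure (Ω N)} {p q : ∀ N, Ω N → Prop}

theorem HoldsInProb.mono (hp : HoldsInProb P p)
    (h : ∀ᶠ N in atTop, ∀ᵐ ω ∂P N, p N ω → q N ω) : HoldsInProb P q := by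
  refine tendsto_of_tendsto_of_tendsto_of_le_of_le' tendsto_const_nhds hp
    (Eventually.of_forall fun _ => zero_le) ?_
  filter_upwards [h] with N hN
  refine measure_mono_ae ?_
  filter_upwards [hN] with ω hω
  exact fun hq hp => hq (hω hp)

theorem HoldsInProb.and (hp : HoldsInProb P p) (hq : HoldsInProb P q) :
    HoldsInProb P fun N ω => p N ω ∧ q N ω := by
  have h := hp.add hq
  rw [add_zero] at h
  refine tendsto_of_tendsto_of_tendsto_of_le_of_le tendsto_const_nhds h
    (fun _ => zero_le) fun N => ?_
  refine (measure_mono ?_).trans (measure_union_le _ _)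
  intro ω hω
  by_cases h1 : p N ω
  · exact Or.inr fun h2 => hω ⟨h1, h2⟩
  · exact Or.inl h1

theorem HoldsInProb.of_ae (h : ∀ N, ∀ᵐ ω ∂P N, p N ω) : HoldsInProb P p := by
  have : (fun N => P N {ω | ¬ p N ω}) = fun _ => 0 := funext fun N => ae_iff.1 (h N)
  rw [HoldsInProb, this]
  exact tendsto_const_nhds

theorem HoldsInProb.forall {κ : Type*} [Fintype κ] {p : κ → ∀ N, Ω N → Prop}
    (h : ∀ k, HoldsInProb P (p k)) : HoldsInProb P fun N ω => ∀ k, p k N ω := by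
  have h1 := tendsto_finsetSum Finset.univ fun k _ => h k
  rw [Finset.sum_const_zero] at h1
  refine tendsto_of_tendsto_of_tendsto_of_le_of_le tendsto_const_nhds h1
    (fun _ => zero_le) fun N => ?_
  refine (measure_mono ?_).trans (measure_biUnion_finset_le Finset.univ _)
  intro ω hω
  simp only [mem_ofPred_eq, not_forall] at hω
  simpa using hω

end HoldsInProb

/-! ### Laws of large numbers for triangular arrays -/

section LLN

variable {𝕏 : Type*} [MeasurableSpace 𝕏] {ν : Measure 𝕏} [IsProbabilityMeasure ν]

theorem lintegral_sq_avg_sub_le {N : ℕ} (hN : N ≠ 0) {G : 𝕏 → ℝ} (hG : MemLp G 2 ν) :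
    ∫⁻ x, ENNReal.ofReal (((∑ i, G (x i)) / N - ∫ x, G x ∂ν) ^ 2)
      ∂(Measure.pi fun _ : Fin N => ν) ≤ ENNReal.ofReal ((∫ x, G x ^ 2 ∂ν) / N) := by
  set Q := Measure.pi fun _ : Fin N => ν
  have hN' : (N : ℝ) ≠ 0 := Nat.cast_ne_zero.2 hN
  have hmp : ∀ i : Fin N, MeasurePreserving (Function.eval i) Q ν := fun i =>
    measurePreserving_eval _ i
  have hL : ∀ i : Fin N, MemLp (fun x : Fin N → 𝕏 => G (x i)) 2 Q := fun i =>
    hG.comp_measurePreserving (hmp i)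
  have hmean : ∀ i : Fin N, ∫ x, G (x i) ∂Q = ∫ x, G x ∂ν := fun i => by
    have := integral_map (hmp i).aemeasurable (f := G)
      (by rw [(hmp i).map_eq]; exact hG.aestronglyMeasurable)
    rw [(hmp i).map_eq] at this
    exact this.symm
  have hvar : ∀ i : Fin N, Var[fun x : Fin N → 𝕏 => G (x i); Q] = Var[G; ν] := fun i => by
    have := variance_map (μ := Q) (X := G) (Y := Function.eval i)
      (by rw [(hmp i).map_eq]; exact hG.aestronglyMeasurable.aemeasurable) (hmp i).aemeasurable
    rw [(hmp i).map_eq] at this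
    exact this.symm
  have hind : iIndepFun (fun i (x : Fin N → 𝕏) => G (x i)) Q :=
    iIndepFun_pi (X := fun _ : Fin N => G) fun _ => hG.aestronglyMeasurable.aemeasurable
  have hsum : MemLp (fun x : Fin N → 𝕏 => ∑ i, G (x i)) 2 Q := memLp_finsetSum _ fun i _ => hL i
  have hE : ∫ x, (∑ i, G (x i)) / N ∂Q = ∫ x, G x ∂ν := by
    rw [integral_div, integral_finsetSum _ fun i _ => (hL i).integrable one_le_two]
    simp only [hmean, Finset.sum_const, Finset.card_univ, Fintype.card_fin, nsmul_eq_mul]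
    field_simp
  have hV : ∫ x, ((∑ i, G (x i)) / N - ∫ x, G x ∂ν) ^ 2 ∂Q = Var[G; ν] / N := by
    rw [← hE, ← variance_eq_integral (hsum.aestronglyMeasurable.aemeasurable.div_const _)]
    simp only [div_eq_inv_mul]
    rw [variance_const_mul]
    have := IndepFun.variance_sum (s := Finset.univ) (fun i _ => hL i)
      (fun i _ j _ hij => hind.indepFun hij)
    rw [Finset.sum_fn] at this
    rw [this]
    simp only [hvar, Finset.sum_const, Finset.card_univ, Fintype.card_fin, nsmul_eq_mul]
    field_simp
  have hI : Integrable (fun x : Fin N → 𝕏 => ((∑ i, G (x i)) / N - ∫ x, G x ∂ν) ^ 2) Q := by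
    have h1 : MemLp (fun x : Fin N → 𝕏 => (∑ i, G (x i)) / N - ∫ x, G x ∂ν) 2 Q := by
      have := (hsum.const_mul (N : ℝ)⁻¹).sub (memLp_const (∫ x, G x ∂ν))
      simp only [div_eq_inv_mul]
      exact this
    exact h1.integrable_sq
  rw [← ofReal_integral_eq_lintegral_ofReal hI (Eventually.of_forall fun _ => sq_nonneg _), hV]
  refine ENNReal.ofReal_le_ofReal ?_
  gcongr
  exact variance_le_expectation_sq hG.aestronglyMeasurable

variable {Ω : ℕ → Type*} [∀ N, MeasurableSpace (Ω N)] {P : ∀ N, Measure (Ω N)}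
  {X : ∀ N, Ω N → Fin N → 𝕏}

/-- Markov's inequality, applied under the product law. Measurability of `H` allows the probability
to be computed there. -/
theorem holdsInProb_of_lintegral_le (hX : ∀ N, HasLaw (X N) (Measure.pi fun _ => ν) (P N))
    {H : ∀ N, (Fin N → 𝕏) → ℝ≥0∞} (hH : ∀ N, Measurable (H N)) {C : ℝ}
    (hC : ∀ N ≠ 0, ∫⁻ x, H N x ∂(Measure.pi fun _ => ν) ≤ ENNReal.ofReal (C / N)) {ε : ℝ}
    (hε : 0 < ε) : HoldsInProb P fun N ω => H N (X N ω) < ENNReal.ofReal ε := by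
  have hε' : ENNReal.ofReal ε ≠ 0 := by simpa using hε
  have hlim : Tendsto (fun N : ℕ => ENNReal.ofReal (C / N) / ENNReal.ofReal ε) atTop (𝓝 0) := by
    have h1 : Tendsto (fun N : ℕ => ENNReal.ofReal (C / N)) atTop (𝓝 0) := by
      have := ENNReal.tendsto_ofReal (tendsto_const_div_atTop_nhds_zero_nat C)
      rwa [ENNReal.ofReal_zero] at this
    have := ENNReal.Tendsto.div_const h1 (b := ENNReal.ofReal ε) (Or.inr hε')
    rwa [ENNReal.zero_div] at this
  refine tendsto_of_tendsto_of_tendsto_of_le_of_le' tendsto_const_nhds hlim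
    (Eventually.of_forall fun _ => zero_le) ?_
  filter_upwards [eventually_ne_atTop 0] with N hN
  have hm : MeasurableSet {x | ¬ H N x < ENNReal.ofReal ε} :=
    (measurableSet_lt (hH N) measurable_const).compl
  rw [(hX N).measure_eq hm]
  simp only [not_lt]
  exact (meas_ge_le_lintegral_div (hH N).aemeasurable hε' ENNReal.ofReal_ne_top).trans
    (ENNReal.div_le_div_right (hC N hN) _)

theorem holdsInProb_abs_avg_sub_lt (hX : ∀ N, HasLaw (X N) (Measure.pi fun _ => ν) (P N))
    {G : 𝕏 → ℝ} (hGm : Measurable G) (hG : MemLp G 2 ν) {ε : ℝ} (hε : 0 < ε) :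
    HoldsInProb P fun N ω => |(∑ i, G (X N ω i)) / N - ∫ x, G x ∂ν| < ε := by
  have h := holdsInProb_of_lintegral_le hX
    (H := fun N x => ENNReal.ofReal (((∑ i, G (x i)) / N - ∫ x, G x ∂ν) ^ 2))
    (fun N => by fun_prop) (fun N hN => lintegral_sq_avg_sub_le hN hG) (pow_pos hε 2)
  refine h.mono (Eventually.of_forall fun N => Eventually.of_forall fun ω hω => ?_)
  rw [ENNReal.ofReal_lt_ofReal_iff (by positivity)] at hω
  exact abs_lt_of_sq_lt_sq hω hε.le

/-- A law of large numbers integrated over time suffices, because consistency errors enter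
Grönwall's inequality only through their time integral. The variance bound is integrated over time
by Tonelli's theorem, with no supremum over times. -/
theorem holdsInProb_integral_abs_avg_sub_le
    (hX : ∀ N, HasLaw (X N) (Measure.pi fun _ => ν) (P N)) {g : ℝ → 𝕏 → ℝ} {τ : ℝ} (hτ : 0 ≤ τ)
    (hgc : ∀ x, Continuous fun t => g t x) (hgm : ∀ t, StronglyMeasurable (g t))
    (hgi : Continuous fun t => ∫ x, g t x ∂ν)
    {b : 𝕏 → ℝ} (hb : MemLp b 2 ν) (hgb : ∀ t ∈ Icc 0 τ, ∀ x, |g t x| ≤ b x)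
    {η : ℝ} (hη : 0 < η) :
    HoldsInProb P fun N ω =>
      ∫ t in (0)..τ, |(∑ i, g t (X N ω i)) / N - ∫ x, g t x ∂ν| ≤ η := by
  set C := ∫ x, b x ^ 2 ∂ν with hC
  have hgu : StronglyMeasurable (Function.uncurry g) :=
    stronglyMeasurable_uncurry_of_continuous_of_stronglyMeasurable hgc hgm
  have hgL : ∀ t ∈ Icc 0 τ, MemLp (g t) 2 ν := fun t ht =>
    hb.mono' (hgm t).aestronglyMeasurable (Eventually.of_forall (hgb t ht))
  set f : ∀ N, (Fin N → 𝕏) → ℝ → ℝ := fun N x t => (∑ i, g t (x i)) / N - ∫ x, g t x ∂ν with hf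
  have hfc : ∀ N x, Continuous (f N x) := fun N x =>
    ((continuous_finsetSum _ fun i _ => hgc (x i)).div_const _).sub hgi
  have hfm : ∀ N, Measurable (Function.uncurry (f N)) := by
    intro N
    refine Measurable.sub (Measurable.div_const (Finset.measurable_sum _ fun i _ => ?_) _)
      (hgi.measurable.comp measurable_snd)
    exact hgu.measurable.comp (f := fun z : (Fin N → 𝕏) × ℝ => (z.2, z.1 i)) (by fun_prop)
  -- The split |F| ≤ α/2 + F²/(2α) is used below. This α keeps τα/2 below η/2, and the threshold αη
  -- for the integral of F² gives the other half.
  set α := η / (τ + 1) with hα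
  have hα0 : 0 < α := by positivity
  have h := holdsInProb_of_lintegral_le hX (C := τ * C)
    (H := fun N x => ∫⁻ t in Ioc 0 τ, ENNReal.ofReal (f N x t ^ 2))
    (fun N => Measurable.lintegral_prod_right' (f := fun z => ENNReal.ofReal
      (Function.uncurry (f N) z ^ 2)) (by have := hfm N; fun_prop)) (fun N hN => by
      rw [lintegral_lintegral_swap (by
        have := hfm N
        exact (by fun_prop : Measurable fun z => ENNReal.ofReal
          (Function.uncurry (f N) z ^ 2)).aemeasurable)]
      calc _ ≤ ∫⁻ t in Ioc 0 τ, ENNReal.ofReal (C / N) := by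
            refine setLIntegral_mono' measurableSet_Ioc fun t ht => ?_
            have ht' : t ∈ Icc 0 τ := ⟨ht.1.le, ht.2⟩
            refine (lintegral_sq_avg_sub_le hN (hgL t ht')).trans (ENNReal.ofReal_le_ofReal ?_)
            gcongr ?_ / _
            refine integral_mono (hgL t ht').integrable_sq hb.integrable_sq fun x => ?_
            exact sq_le_sq' (by linarith [abs_le.1 (hgb t ht' x)]) (abs_le.1 (hgb t ht' x)).2
        _ = _ := by
            rw [setLIntegral_const, Real.volume_Ioc, sub_zero, mul_comm,
              ← ENNReal.ofReal_mul hτ, mul_div_assoc]) (mul_pos hα0 hη)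
  refine h.mono (Eventually.of_forall fun N => Eventually.of_forall fun ω hω => ?_)
  have hc := hfc N (X N ω)
  set F := f N (X N ω)
  have hi : IntegrableOn (fun t => F t ^ 2) (Ioc 0 τ) :=
    (hc.pow 2).integrableOn_Icc.mono_set Ioc_subset_Icc_self
  rw [← ofReal_integral_eq_lintegral_ofReal hi
    (Eventually.of_forall fun _ => sq_nonneg _), ENNReal.ofReal_lt_ofReal_iff (by positivity),
    ← intervalIntegral.integral_of_le hτ] at hω
  have h1 : ∫ t in (0)..τ, |F t| ≤ ∫ t in (0)..τ, (α / 2 + (2 * α)⁻¹ * F t ^ 2) := by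
    refine intervalIntegral.integral_mono_on hτ (hc.abs.intervalIntegrable _ _)
      ((by fun_prop : Continuous fun t => α / 2 + (2 * α)⁻¹ * F t ^ 2).intervalIntegrable _ _)
      fun t _ => ?_
    have e : α / 2 + (2 * α)⁻¹ * F t ^ 2 - |F t| = (2 * α)⁻¹ * (|F t| - α) ^ 2 := by
      rw [← sq_abs (F t)]; field_simp; ring
    have : 0 ≤ (2 * α)⁻¹ * (|F t| - α) ^ 2 := by positivity
    linarith
  rw [intervalIntegral_const_add_mul (g := fun t => F t ^ 2) (hc.pow 2)] at h1
  refine h1.trans ?_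
  have h2 : (2 * α)⁻¹ * ∫ t in (0)..τ, F t ^ 2 ≤ (2 * α)⁻¹ * (α * η) := by gcongr
  have h3 : (2 * α)⁻¹ * (α * η) = η / 2 := by field_simp
  have h4 : τ * (α / 2) ≤ η / 2 := by
    rw [hα]
    have : τ * (η / (τ + 1) / 2) = (τ / (τ + 1)) * (η / 2) := by ring
    rw [this]
    exact mul_le_of_le_one_left (by positivity) ((div_le_one (by positivity)).2 (by linarith))
  linarith

end LLN

/-! ### Empirical measures -/

section Empirical

variable {E : Type*} [MeasurableSpace E] {N : ℕ}

/-- The empirical measure of finitely many points. -/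
noncomputable def empiricalMeasure (u : Fin N → E) : Measure E :=
  (N : ℝ≥0∞)⁻¹ • ∑ i, Measure.dirac (u i)

theorem isProbabilityMeasure_empiricalMeasure (hN : N ≠ 0) (u : Fin N → E) :
    IsProbabilityMeasure (empiricalMeasure u) := by
  refine ⟨?_⟩
  simp only [empiricalMeasure, Measure.smul_apply, Measure.coe_finsetSum, Finset.sum_apply,
    measure_univ, Finset.sum_const, Finset.card_univ, Fintype.card_fin, nsmul_eq_mul, mul_one,
    smul_eq_mul]
  exact ENNReal.inv_mul_cancel (by simpa using hN) (by simp)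

theorem integrable_empiricalMeasure [MeasurableSingletonClass E] (hN : N ≠ 0) (u : Fin N → E)
    {f : E → ℝ} (hf : StronglyMeasurable f) : Integrable f (empiricalMeasure u) := by
  refine Integrable.smul_measure ?_ (by simpa using hN)
  rw [integrable_finsetSum_measure]
  intro i _
  exact integrable_dirac' hf (by simp)

theorem integral_empiricalMeasure [MeasurableSingletonClass E] (u : Fin N → E) {f : E → ℝ}
    (hf : StronglyMeasurable f) : ∫ x, f x ∂(empiricalMeasure u) = (∑ i, f (u i)) / N := by
  rw [empiricalMeasure, integral_smul_measure, integral_finsetSum_measure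
    fun i _ => integrable_dirac' hf (by simp)]
  simp [integral_dirac' _ _ hf, div_eq_inv_mul]

end Empirical

/-! ### Finite networks and deterministic stability -/

namespace NeuronModel

variable {E ι : Type*} [NormedAddCommGroup E] [NormedSpace ℝ E] [Fintype ι]
  (M : NeuronModel E ι)

/-- The neurons `u` of a network of width `N` and its error signals `Δ` on `[0, τ]`. -/
structure IsNetwork (κ : ℝ) (y : ι → ℝ) (τ : ℝ) {N : ℕ} (Δ : C(ℝ, ι → ℝ)) (u : Fin N → ℝ → E) :
    Prop where
  isPath : ∀ i, M.IsPath Δ τ (u i)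
  error_eq : ∀ t ∈ Icc 0 τ, ∀ ν, Δ t ν = y ν - κ * ((∑ i, M.contrib ν (u i t)) / N)

variable {M}

variable [CompleteSpace E]

/-- A finite network is exactly self-consistent for the empirical law of its initial states, which
has all exponential moments. The mean-field energy estimate thus applies verbatim. -/
theorem IsNetwork.integral_norm_le [MeasurableSpace E] [BorelSpace E] {κ : ℝ} {y : ι → ℝ} {τ : ℝ} {N : ℕ} {Δ : C(ℝ, ι → ℝ)}
    {u : Fin N → ℝ → E} (h : M.IsNetwork κ y τ Δ u) (hN : N ≠ 0) (hκ : 0 ≤ κ) (hτ : 0 ≤ τ) :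
    ∫ t in (0)..τ, ‖Δ t‖ ≤ τ + (κ * ((∑ i, M.ℓ (u i 0) ^ 2) / N) + τ * ∑ ν, y ν ^ 2) := by
  set μ := empiricalMeasure fun i => u i 0
  have : IsProbabilityMeasure μ := isProbabilityMeasure_empiricalMeasure hN _
  have hμ : HasExpMoments μ := fun c =>
    integrable_empiricalMeasure hN _ (by fun_prop : Continuous _).stronglyMeasurable
  refine integral_norm_le_of_integral_sum_sq_le Δ.continuous hτ ?_
  rw [← integral_empiricalMeasure (fun i => u i 0)
    (by fun_prop : Continuous fun v => M.ℓ v ^ 2).stronglyMeasurable]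
  refine M.integral_sum_sq_le hμ Δ hτ hκ y fun t ht ν => ?_
  have e : Δ t ν = y ν - κ * M.meanContrib μ Δ ν t := by
    rw [h.error_eq t ht ν, meanContrib, integral_empiricalMeasure (fun i => u i 0)
      (f := fun v => M.contrib ν (M.flow Δ v t)) ((M.continuous_contrib ν).comp (M.continuous_flow_left Δ t)).stronglyMeasurable]
    simp_rw [← M.flow_eq Δ (h.isPath _) ht]
  rw [← e, sq]

variable (M)

/-- A network stays close to independent neurons driven by mean-field error signals. -/
theorem exists_norm_sub_flow_le {κ τ R B C₀ : ℝ} (hκ : 0 ≤ κ) (hτ : 0 ≤ τ) (hR : 0 ≤ R)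
    (hB : 0 ≤ B) (hC₀ : 0 ≤ C₀) (y : ι → ℝ) (Δ : C(ℝ, ι → ℝ)) (hΔ : ∫ t in (0)..τ, ‖Δ t‖ ≤ R) :
    ∃ K : ℝ, ∀ m : ℝ, 0 ≤ m → ∃ A B' : ℝ, 0 ≤ A ∧ 0 ≤ B' ∧
    ∀ (N : ℕ) (u : Fin N → ℝ → E) (Δ' : C(ℝ, ι → ℝ)) (v : Fin N → E) (r : Fin N → ℝ) (η : ℝ),
      M.IsNetwork κ y τ Δ' u → ∫ t in (0)..τ, ‖Δ' t‖ ≤ R → (∀ i, 0 ≤ r i) → 0 ≤ η → η ≤ 1 →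
      (∀ i, ‖u i 0 - v i‖ ≤ η * Real.exp (B * r i)) → (∀ i, ‖v i‖ ≤ C₀ * (1 + r i)) →
      (∑ i, Real.exp (K * r i)) / N ≤ m →
      ∫ t in (0)..τ, ‖fun ν => y ν - Δ t ν - κ * ((∑ i, M.contrib ν (M.flow Δ (v i) t)) / N)‖ ≤ η →
      ∀ i, ∀ t ∈ Icc 0 τ, ‖u i t - M.flow Δ (v i) t‖ ≤ A * η * Real.exp (B' * r i) := by
  obtain ⟨a, b, ha, hb, h1⟩ := M.exists_norm_sub_le hτ hR
  obtain ⟨a', b', ha', hb', h2⟩ := M.exists_abs_sub_le_exp hτ hR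
  -- The exponent collects exp(b'‖v i‖), two factors exp(B r i) from the squared term, and one from
  -- the initial error. It is fixed before m, so that m can later be a bound on the average of
  -- exactly this exponential.
  refine ⟨b' * C₀ + 3 * B, fun m hm => ?_⟩
  set a'' := 4 * a' * Real.exp (b' * C₀) with ha''
  set L := κ * (a'' * m) with hL
  have hL0 : 0 ≤ L := by positivity
  refine ⟨a * Real.exp (b * C₀) * (1 + (1 + τ * L) * Real.exp (τ * L)), b * C₀ + B,
    by positivity, by positivity, ?_⟩
  intro N u Δ' v r η hnet hΔ' hr hη hη1 hu0 hv hm' hε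
  set D : ℝ → ℝ := fun t => ∫ s in (0)..t, ‖Δ' s - Δ s‖ with hD
  have hc : Continuous fun s => ‖Δ' s - Δ s‖ := by fun_prop
  have hD0 : ∀ t ∈ Icc 0 τ, 0 ≤ D t := fun t ht =>
    intervalIntegral.integral_nonneg ht.1 fun _ _ => norm_nonneg _
  -- The consistency error: the amount by which the decoupled neurons fail to reproduce the signals
  -- that drive them.
  set ε : ℝ → ι → ℝ := fun t ν =>
    y ν - Δ t ν - κ * ((∑ i, M.contrib ν (M.flow Δ (v i) t)) / N) with hεd
  have hεc : Continuous ε := continuous_pi fun ν =>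
    (continuous_const.sub ((continuous_apply ν).comp Δ.continuous)).sub
      (continuous_const.mul ((continuous_finsetSum _ fun i _ =>
        (M.continuous_contrib ν).comp (M.continuous_flow Δ (v i))).div_const _))
  have hvexp : ∀ β, 0 ≤ β → ∀ i, Real.exp (β * ‖v i‖) ≤
      Real.exp (β * C₀) * Real.exp (β * C₀ * r i) := by
    intro β hβ i
    rw [← Real.exp_add]
    refine Real.exp_le_exp.2 ?_
    have := mul_le_mul_of_nonneg_left (hv i) hβ
    linarith
  have hone : ∀ i, 1 ≤ Real.exp (B * r i) := fun i =>
    Real.one_le_exp (mul_nonneg hB (hr i))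
  have hw : ∀ i, ‖u i 0 - v i‖ ≤ Real.exp (B * r i) := fun i =>
    (hu0 i).trans (mul_le_of_le_one_left (Real.exp_nonneg _) hη1)
  have hdiff : ∀ i ν, ∀ t ∈ Icc 0 τ, |M.contrib ν (u i t) - M.contrib ν (M.flow Δ (v i) t)| ≤
      a'' * (η + D t) * Real.exp ((b' * C₀ + 3 * B) * r i) := by
    intro i ν t ht
    have h3 := h2 Δ' Δ Δ'.continuous Δ.continuous hΔ' hΔ _ _ (hnet.isPath i)
      (M.isPath_flow Δ (v i) τ) ν t ht
    rw [flow_zero] at h3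
    have hDt := hD0 t ht
    have h4 : 1 + ‖u i 0 - v i‖ ≤ 2 * Real.exp (B * r i) := by linarith [hone i, hw i]
    have h5 : ‖u i 0 - v i‖ + D t ≤ (η + D t) * Real.exp (B * r i) := by
      have := le_mul_of_one_le_right hDt (hone i)
      linarith [hu0 i]
    calc _ ≤ a' * Real.exp (b' * ‖v i‖) * (1 + ‖u i 0 - v i‖) ^ 2 * (‖u i 0 - v i‖ + D t) := h3
      _ ≤ a' * (Real.exp (b' * C₀) * Real.exp (b' * C₀ * r i)) * (2 * Real.exp (B * r i)) ^ 2 *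
          ((η + D t) * Real.exp (B * r i)) := by
          gcongr
          exact hvexp b' hb' i
      _ = a'' * (η + D t) * (Real.exp (b' * C₀ * r i) * Real.exp (B * r i) * Real.exp (B * r i) *
          Real.exp (B * r i)) := by rw [ha'']; ring
      _ = _ := by rw [← Real.exp_add, ← Real.exp_add, ← Real.exp_add]; ring_nf
  -- The signal difference is the consistency error plus the effect of the neurons' own deviations;
  -- the latter is controlled by the integrated signal difference D, which closes the Grönwall loop.
  have herr : ∀ t ∈ Icc 0 τ, ‖Δ' t - Δ t‖ ≤ L * D t + (‖ε t‖ + L * η) := by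
    intro t ht
    have hDt := hD0 t ht
    refine (pi_norm_le_iff_of_nonneg (by positivity)).2 fun ν => ?_
    have e : (Δ' t - Δ t) ν = ε t ν + κ * ((∑ i, (M.contrib ν (M.flow Δ (v i) t) -
        M.contrib ν (u i t))) / N) := by
      rw [Pi.sub_apply, hnet.error_eq t ht ν, Finset.sum_sub_distrib, hεd]
      ring
    rw [e]
    refine (norm_add_le _ _).trans ?_
    have h3 : ‖(∑ i, (M.contrib ν (M.flow Δ (v i) t) - M.contrib ν (u i t))) / (N : ℝ)‖ ≤
        a'' * (η + D t) * m := by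
      rw [norm_div, Real.norm_natCast]
      calc _ ≤ (∑ i, a'' * (η + D t) * Real.exp ((b' * C₀ + 3 * B) * r i)) / (N : ℝ) := by
            gcongr
            refine (norm_sum_le _ _).trans (Finset.sum_le_sum fun i _ => ?_)
            rw [norm_sub_rev]
            exact hdiff i ν t ht
        _ = a'' * (η + D t) * ((∑ i, Real.exp ((b' * C₀ + 3 * B) * r i)) / N) := by
            rw [← Finset.mul_sum, mul_div_assoc]
        _ ≤ _ := by gcongr
    rw [norm_mul, Real.norm_of_nonneg hκ]
    have h4 := norm_le_pi_norm (ε t) ν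
    have h5 := mul_le_mul_of_nonneg_left h3 hκ
    have h6 : κ * (a'' * (η + D t) * m) = L * D t + L * η := by rw [hL]; ring
    linarith
  have hDd : ∀ t ∈ Icc 0 τ, HasDerivWithinAt D ‖Δ' t - Δ t‖ (Icc 0 τ) t := fun t _ =>
    (intervalIntegral.integral_hasDerivAt_right (hc.intervalIntegrable _ _)
      (hc.stronglyMeasurableAtFilter _ _) hc.continuousAt).hasDerivWithinAt
  have hDle : ∀ t ∈ Icc 0 τ, D t ≤ η * (1 + τ * L) * Real.exp (τ * L) := by
    intro t ht
    have h3 := norm_le_of_norm_deriv_le_mul_add (a := fun _ => L) (b := fun t => L * η + 1 * ‖ε t‖)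
      continuous_const (by fun_prop) (fun _ => hL0) (fun _ => by positivity) hDd
      (fun t ht => by
        rw [norm_norm, Real.norm_of_nonneg (hD0 t ht)]
        linarith [herr t ht]) ht
    rw [intervalIntegral_const_add_mul hεc.norm, Real.norm_of_nonneg (hD0 t ht)] at h3
    have h4 : D 0 = 0 := intervalIntegral.integral_same
    rw [h4, norm_zero, zero_add, one_mul, intervalIntegral.integral_const, sub_zero,
      smul_eq_mul] at h3
    refine h3.trans ?_
    have h5 : ∫ s in (0)..t, ‖ε s‖ ≤ η := by
      refine le_trans ?_ hε
      refine intervalIntegral.integral_mono_interval le_rfl ht.1 ht.2 ?_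
        (hεc.norm.intervalIntegrable _ _)
      exact Eventually.of_forall fun _ => norm_nonneg _
    have h6 : t * (L * η) ≤ τ * (L * η) := by gcongr; exact ht.2
    refine mul_le_mul (by linarith) (Real.exp_le_exp.2 ?_) (Real.exp_nonneg _) (by positivity)
    exact mul_le_mul_of_nonneg_right ht.2 hL0
  intro i t ht
  have h3 := h1 Δ' Δ Δ'.continuous Δ.continuous hΔ' hΔ _ _ (hnet.isPath i)
    (M.isPath_flow Δ (v i) τ) t ht
  rw [flow_zero] at h3
  have hDt := hD0 t ht
  have h5 : ‖u i 0 - v i‖ + D t ≤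
      η * (1 + (1 + τ * L) * Real.exp (τ * L)) * Real.exp (B * r i) := by
    have h6 := le_mul_of_one_le_right hDt (hone i)
    have h7 := mul_le_mul_of_nonneg_right (hDle t ht) (Real.exp_nonneg (B * r i))
    linarith [hu0 i]
  calc _ ≤ a * Real.exp (b * ‖v i‖) * (‖u i 0 - v i‖ + D t) := h3
    _ ≤ a * (Real.exp (b * C₀) * Real.exp (b * C₀ * r i)) *
        (η * (1 + (1 + τ * L) * Real.exp (τ * L)) * Real.exp (B * r i)) := by
        gcongr
        exact hvexp b hb i
    _ = a * Real.exp (b * C₀) * (1 + (1 + τ * L) * Real.exp (τ * L)) * η *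
        (Real.exp (b * C₀ * r i) * Real.exp (B * r i)) := by ring
    _ = _ := by rw [← Real.exp_add]; ring_nf

end NeuronModel

/-! ### Propagation of chaos -/

section Tracks

variable {E 𝕏 : Type*} [NormedAddCommGroup E] [NormedAddCommGroup 𝕏] [MeasurableSpace 𝕏]
  {Ω : ℕ → Type*} [∀ N, MeasurableSpace (Ω N)]

/-- The states `u N ω i` are close to the states `V` of independent neurons with initial data
`X N ω i`, at all times in `S`, with probability tending to one. -/
def Tracks (P : ∀ N, Measure (Ω N)) (X : ∀ N, Ω N → Fin N → 𝕏)
    (u : ∀ N, Ω N → Fin N → ℝ → E) (V : 𝕏 → ℝ → E) (S : Set ℝ) : Prop :=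
  ∃ B : ℝ, 0 ≤ B ∧ ∀ η : ℝ, 0 < η → HoldsInProb P fun N ω =>
    ∀ i, ∀ t ∈ S, ‖u N ω i t - V (X N ω i) t‖ ≤ η * Real.exp (B * ‖X N ω i‖)

theorem HasExpMoments.memLp {ν : Measure 𝕏} (hν : HasExpMoments ν) (c : ℝ) :
    MemLp (fun x => Real.exp (c * ‖x‖)) 2 ν := by
  rw [memLp_two_iff_integrable_sq (hν c).aestronglyMeasurable]
  refine (hν (2 * c)).congr (Eventually.of_forall fun x => ?_)
  simp only
  rw [← Real.exp_nat_mul]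
  push_cast
  ring_nf

theorem HasExpMoments.map_of_linear_growth [MeasurableSpace E] [BorelSpace E] [BorelSpace 𝕏]
    {ν : Measure 𝕏} (hν : HasExpMoments ν) {f : 𝕏 → E} (hf : Measurable f) {C : ℝ}
    (hC : ∀ x, ‖f x‖ ≤ C * (1 + ‖x‖)) : HasExpMoments (ν.map f) := by
  intro c
  rw [integrable_map_measure (by
    exact (by fun_prop : Continuous fun u : E => Real.exp (c * ‖u‖)).measurable.aestronglyMeasurable)
    hf.aemeasurable]
  refine Integrable.mono' ((hν (|c| * C)).const_mul (Real.exp (|c| * C)))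
    (((by fun_prop : Continuous fun u : E => Real.exp (c * ‖u‖)).measurable.comp
      hf).aestronglyMeasurable) (Eventually.of_forall fun x => ?_)
  rw [← Real.exp_add, Function.comp_apply, Real.norm_of_nonneg (Real.exp_nonneg _)]
  refine Real.exp_le_exp.2 ?_
  calc c * ‖f x‖ ≤ |c| * (C * (1 + ‖x‖)) :=
        mul_le_mul (le_abs_self c) (hC x) (norm_nonneg _) (abs_nonneg _)
    _ = _ := by ring

variable [BorelSpace 𝕏] {ν : Measure 𝕏} [IsProbabilityMeasure ν]
  {P : ∀ N, Measure (Ω N)} {X : ∀ N, Ω N → Fin N → 𝕏}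

theorem holdsInProb_avg_exp_le (hν : HasExpMoments ν)
    (hX : ∀ N, HasLaw (X N) (Measure.pi fun _ => ν) (P N)) (c : ℝ) :
    HoldsInProb P fun N ω =>
      (∑ i, Real.exp (c * ‖X N ω i‖)) / N ≤ (∫ x, Real.exp (c * ‖x‖) ∂ν) + 1 :=
  (holdsInProb_abs_avg_sub_lt hX (by fun_prop : Continuous fun x : 𝕏 =>
    Real.exp (c * ‖x‖)).measurable (hν.memLp c) one_pos).mono
    (Eventually.of_forall fun _ => Eventually.of_forall fun _ h => by
      linarith [(abs_lt.1 h).2])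

/-- Averages of test functions over tracking neurons converge. -/
theorem Tracks.holdsInProb_abs_avg_sub_lt [NormedSpace ℝ E] [ProperSpace E]
    (hν : HasExpMoments ν) (hX : ∀ N, HasLaw (X N) (Measure.pi fun _ => ν) (P N))
    {u : ∀ N, Ω N → Fin N → ℝ → E} {V : 𝕏 → ℝ → E} {S : Set ℝ} (h : Tracks P X u V S) {C₀ : ℝ}
    (hVm : ∀ t ∈ S, Measurable[_, borel E] fun x => V x t)
    (hV : ∀ x, ∀ t ∈ S, ‖V x t‖ ≤ C₀ * (1 + ‖x‖))
    {k : ℕ} {t : Fin k → ℝ} (ht : ∀ a, t a ∈ S) {G : (Fin k → E) → ℝ} (hG : Continuous G) {C : ℝ}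
    (hGC : ∀ e, |G e| ≤ C * (1 + ‖e‖) ^ 2) {ε : ℝ} (hε : 0 < ε) :
    HoldsInProb P fun N ω =>
      |(∑ i, G fun a => u N ω i (t a)) / N - ∫ x, G (fun a => V x (t a)) ∂ν| < ε := by
  borelize E
  obtain ⟨B, hB, h⟩ := h
  have hC : 0 ≤ C := by simpa using (abs_nonneg _).trans (hGC 0)
  have hC₁ : 0 ≤ max C₀ 0 := le_max_right _ _
  set C₁ := max C₀ 0
  have hVv : ∀ x, ‖fun a => V x (t a)‖ ≤ C₁ * (1 + ‖x‖) := fun x =>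
    (pi_norm_le_iff_of_nonneg (by positivity)).2 fun a =>
      (hV x _ (ht a)).trans (by gcongr; exact le_max_left _ _)
  have hGVm : Measurable fun x => G fun a => V x (t a) :=
    hG.measurable.comp (measurable_pi_lambda _ fun a => hVm _ (ht a))
  have hGV : MemLp (fun x => G fun a => V x (t a)) 2 ν := by
    refine ((hν.memLp (2 * C₁)).const_mul (C * Real.exp (2 * C₁))).mono'
      hGVm.aestronglyMeasurable (Eventually.of_forall fun x => ?_)
    refine (hGC _).trans ?_
    rw [mul_assoc, ← Real.exp_add]
    gcongr
    refine (NeuronModel.sq_one_add_le_exp (norm_nonneg _) (hVv x)).trans (Real.exp_le_exp.2 ?_)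
    linarith
  -- K is an exponential growth rate for the test function on both the coupled and the actual
  -- neurons; the extra 1 in K + 1 below pays for the tail factor exp(−ρ).
  set K := 2 * (2 * C₁ + 1 + B) with hK
  set m := (∫ x, Real.exp ((K + 1) * ‖x‖) ∂ν) + 1 with hm
  have hm0 : 0 < m := by
    have : 0 ≤ ∫ x, Real.exp ((K + 1) * ‖x‖) ∂ν := integral_nonneg fun _ => Real.exp_nonneg _
    linarith
  -- Neurons are split by the size of their initial data. Those above ρ contribute little by the
  -- exponential moment; those below stay in a compact ball, where the test function is uniformly
  -- continuous.
  obtain ⟨ρ, hρ0, hρ⟩ : ∃ ρ : ℝ, 0 ≤ ρ ∧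
      2 * (C * Real.exp (4 * C₁ + 2)) * Real.exp (-ρ) * m ≤ ε / 4 := by
    have h1 : Tendsto (fun ρ : ℝ => 2 * (C * Real.exp (4 * C₁ + 2)) * Real.exp (-ρ) * m) atTop
        (𝓝 (2 * (C * Real.exp (4 * C₁ + 2)) * 0 * m)) :=
      ((Real.tendsto_exp_neg_atTop_nhds_zero).const_mul _).mul_const _
    rw [mul_zero, zero_mul] at h1
    obtain ⟨ρ, h2, h3⟩ := ((h1.eventually (ge_mem_nhds (show (0 : ℝ) < ε / 4 by linarith))).and
      (eventually_ge_atTop 0)).exists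
    exact ⟨ρ, h3, h2⟩
  set Z := C₁ * (1 + ρ) + Real.exp (B * ρ) with hZ
  have hZ0 : 0 ≤ Z := by positivity
  have huc := (isCompact_closedBall (0 : Fin k → E) Z).uniformContinuousOn_of_continuous
    hG.continuousOn
  obtain ⟨δ, hδ, hGδ⟩ := Metric.uniformContinuousOn_iff.1 huc (ε / 4) (by linarith)
  set η := min 1 (δ / 2 * Real.exp (-(B * ρ))) with hη
  have hη0 : 0 < η := lt_min one_pos (by positivity)
  refine (((h η hη0).and (holdsInProb_avg_exp_le hν hX (K + 1))).and
    (_root_.holdsInProb_abs_avg_sub_lt hX hGVm hGV (show 0 < ε / 2 by linarith))).mono ?_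
  filter_upwards [eventually_ne_atTop 0] with N hN
  refine Eventually.of_forall fun ω ⟨⟨hu, he⟩, hl⟩ => ?_
  have hN' : 0 < (N : ℝ) := by positivity
  have hdist : ∀ i, ‖(fun a => u N ω i (t a)) - fun a => V (X N ω i) (t a)‖ ≤
      η * Real.exp (B * ‖X N ω i‖) := fun i =>
    (pi_norm_le_iff_of_nonneg (by positivity)).2 fun a => hu i _ (ht a)
  have hun : ∀ i, ‖fun a => u N ω i (t a)‖ ≤
      C₁ * (1 + ‖X N ω i‖) + Real.exp (B * ‖X N ω i‖) := by
    intro i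
    have h1 := norm_le_norm_add_norm_sub' (fun a => u N ω i (t a)) fun a => V (X N ω i) (t a)
    have h2 : η * Real.exp (B * ‖X N ω i‖) ≤ Real.exp (B * ‖X N ω i‖) :=
      mul_le_of_le_one_left (Real.exp_nonneg _) (min_le_left _ _)
    linarith [hdist i, hVv (X N ω i)]
  have hterm : ∀ i, |G (fun a => u N ω i (t a)) - G fun a => V (X N ω i) (t a)| ≤ ε / 4 +
      2 * (C * Real.exp (4 * C₁ + 2)) * Real.exp (-ρ) * Real.exp ((K + 1) * ‖X N ω i‖) := by
    intro i
    set r := ‖X N ω i‖ with hr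
    have hr0 : 0 ≤ r := norm_nonneg _
    rcases le_total r ρ with hrρ | hrρ
    · have hB1 : Real.exp (B * r) ≤ Real.exp (B * ρ) := by gcongr
      have h1 : dist (fun a => u N ω i (t a)) (fun a => V (X N ω i) (t a)) < δ := by
        rw [dist_eq_norm]
        calc _ ≤ η * Real.exp (B * r) := hdist i
          _ ≤ δ / 2 * Real.exp (-(B * ρ)) * Real.exp (B * ρ) := by
              gcongr
              exact min_le_right _ _
          _ = δ / 2 := by rw [mul_assoc, ← Real.exp_add]; simp
          _ < δ := by linarith
      have h2 := hGδ (fun a => u N ω i (t a))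
        (mem_closedBall_zero_iff.2 ((hun i).trans (by rw [hZ]; gcongr)))
        (fun a => V (X N ω i) (t a)) (mem_closedBall_zero_iff.2 ((hVv _).trans (by
          have h3 : C₁ * (1 + r) ≤ C₁ * (1 + ρ) := by gcongr
          have h4 := Real.exp_nonneg (B * ρ)
          linarith))) h1
      rw [Real.dist_eq] at h2
      have : 0 ≤ 2 * (C * Real.exp (4 * C₁ + 2)) * Real.exp (-ρ) * Real.exp ((K + 1) * r) := by
        positivity
      linarith
    · have key : ∀ e : Fin k → E, ‖e‖ ≤ C₁ * (1 + r) + Real.exp (B * r) →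
          |G e| ≤ C * Real.exp (4 * C₁ + 2) * Real.exp (K * r) := by
        intro e hee
        refine (hGC e).trans ?_
        rw [mul_assoc, ← Real.exp_add]
        gcongr
        have h1 : 1 + ‖e‖ ≤ Real.exp (2 * C₁ + 1 + (2 * C₁ + 1 + B) * r) := by
          have hB1 : 1 ≤ Real.exp (B * r) := Real.one_le_exp (by positivity)
          have h2 : 1 + ‖e‖ ≤ (2 + C₁ * (1 + r)) * Real.exp (B * r) := by
            have : 0 ≤ C₁ * (1 + r) := by positivity
            nlinarith
          have h3 : 2 + C₁ * (1 + r) ≤ Real.exp (1 + C₁ * (1 + r)) := by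
            linarith [Real.add_one_le_exp (1 + C₁ * (1 + r))]
          calc _ ≤ Real.exp (1 + C₁ * (1 + r)) * Real.exp (B * r) := h2.trans (by gcongr)
            _ = Real.exp (1 + C₁ * (1 + r) + B * r) := (Real.exp_add _ _).symm
            _ ≤ _ := by
              refine Real.exp_le_exp.2 ?_
              have : 0 ≤ C₁ * r := by positivity
              linarith
        calc (1 + ‖e‖) ^ 2 ≤ Real.exp (2 * C₁ + 1 + (2 * C₁ + 1 + B) * r) ^ 2 := by gcongr
          _ = _ := by
            rw [← Real.exp_nat_mul, hK]; push_cast; ring_nf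
      have h1 := key _ (hun i)
      have h2 := key _ ((hVv (X N ω i)).trans
        (le_add_of_nonneg_right (Real.exp_nonneg (B * r))))
      have h3 : Real.exp (K * r) ≤ Real.exp (-ρ) * Real.exp ((K + 1) * r) := by
        rw [← Real.exp_add]
        refine Real.exp_le_exp.2 ?_
        linarith
      have h4 : C * Real.exp (4 * C₁ + 2) * Real.exp (K * r) ≤
          C * Real.exp (4 * C₁ + 2) * (Real.exp (-ρ) * Real.exp ((K + 1) * r)) := by gcongr
      have h5 := abs_sub (G fun a => u N ω i (t a)) (G fun a => V (X N ω i) (t a))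
      linarith
  have hsum : |(∑ i, G fun a => u N ω i (t a)) / (N : ℝ) -
      (∑ i, G fun a => V (X N ω i) (t a)) / N| ≤ ε / 2 := by
    rw [← sub_div, ← Finset.sum_sub_distrib, abs_div, abs_of_pos hN']
    calc _ ≤ (∑ i, (ε / 4 + 2 * (C * Real.exp (4 * C₁ + 2)) * Real.exp (-ρ) *
          Real.exp ((K + 1) * ‖X N ω i‖))) / (N : ℝ) := by
          gcongr
          exact (Finset.abs_sum_le_sum_abs _ _).trans (Finset.sum_le_sum fun i _ => hterm i)
      _ = ε / 4 + 2 * (C * Real.exp (4 * C₁ + 2)) * Real.exp (-ρ) *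
          ((∑ i, Real.exp ((K + 1) * ‖X N ω i‖)) / N) := by
          rw [Finset.sum_add_distrib, ← Finset.mul_sum]
          simp only [Finset.sum_const, Finset.card_univ, Fintype.card_fin, nsmul_eq_mul]
          field_simp
      _ ≤ ε / 4 + 2 * (C * Real.exp (4 * C₁ + 2)) * Real.exp (-ρ) * m := by gcongr
      _ ≤ _ := by linarith
  calc _ ≤ _ := abs_sub_le _ ((∑ i, G fun a => V (X N ω i) (t a)) / N) _
    _ < ε := by linarith

end Tracks

namespace NeuronModel

variable {E ι : Type*} [NormedAddCommGroup E] [NormedSpace ℝ E] [Fintype ι]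
  (M : NeuronModel E ι) [CompleteSpace E] [MeasurableSpace E] [BorelSpace E]
  {𝕏 : Type*} [NormedAddCommGroup 𝕏] [MeasurableSpace 𝕏] [BorelSpace 𝕏]
  {Ω : ℕ → Type*} [∀ N, MeasurableSpace (Ω N)] {ν : Measure 𝕏} [IsProbabilityMeasure ν]
  {P : ∀ N, Measure (Ω N)} {X : ∀ N, Ω N → Fin N → 𝕏}

/-- If the neurons of the networks initially track independent ones, they do so at all times. -/
theorem tracks (hν : HasExpMoments ν) (hX : ∀ N, HasLaw (X N) (Measure.pi fun _ => ν) (P N))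
    {κ τ C₀ : ℝ} (hκ : 0 ≤ κ) (hτ : 0 ≤ τ) {y : ι → ℝ} {v : 𝕏 → E} (hv : Measurable v)
    (hvC : ∀ x, ‖v x‖ ≤ C₀ * (1 + ‖x‖)) {Δ : C(ℝ, ι → ℝ)}
    (hΔ : M.IsSelfConsistent (ν.map v) κ y Δ τ)
    {u : ∀ N, Ω N → Fin N → ℝ → E} (hu : ∀ N, ∀ᵐ ω ∂P N, ∃ Δ', M.IsNetwork κ y τ Δ' (u N ω))
    (h0 : Tracks P X u (fun x _ => v x) {0}) :
    Tracks P X u (fun x => M.flow Δ (v x)) (Icc 0 τ) := by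
  obtain ⟨B, hB, h0⟩ := h0
  have hμ : HasExpMoments (ν.map v) := hν.map_of_linear_growth hv hvC
  have hC₀ : 0 ≤ C₀ := by simpa using (norm_nonneg _).trans (hvC 0)
  set m₁ := (∫ x, Real.exp (2 * (C₀ + B) * ‖x‖) ∂ν) + 1 with hm₁
  have hm₁0 : 0 ≤ m₁ := by
    have : 0 ≤ ∫ x, Real.exp (2 * (C₀ + B) * ‖x‖) ∂ν := integral_nonneg fun _ => Real.exp_nonneg _
    linarith
  -- The energy bound for the network signals, with the average squared initial readout replaced by
  -- a deterministic bound that holds with high probability.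
  set R₁ := τ + (κ * (Real.exp (2 * C₀) * m₁) + τ * ∑ k, y k ^ 2) with hR₁
  have hR₁0 : 0 ≤ R₁ := by positivity
  set R := max R₁ (∫ t in (0)..τ, ‖Δ t‖)
  obtain ⟨K, hK⟩ := M.exists_norm_sub_flow_le (R := R) hκ hτ (hR₁0.trans (le_max_left _ _)) hB hC₀ y
    Δ (le_max_right _ _)
  obtain ⟨A, B', hA, hB', h⟩ := hK ((∫ x, Real.exp (K * ‖x‖) ∂ν) + 1)
    (add_nonneg (integral_nonneg fun _ => Real.exp_nonneg _) zero_le_one)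
  refine ⟨B', hB', fun η hη => ?_⟩
  set η₀ := min 1 (η / (A + 1)) with hη₀
  have hη₀0 : 0 < η₀ := lt_min one_pos (by positivity)
  have hη₀1 : η₀ ≤ 1 := min_le_left _ _
  have hηA : A * η₀ ≤ η := by
    calc A * η₀ ≤ (A + 1) * (η / (A + 1)) := by
          gcongr
          · linarith
          · exact min_le_right _ _
      _ = η := by field_simp
  obtain ⟨a, b, ha, -, hab⟩ := M.exists_abs_le_exp hτ
    (intervalIntegral.integral_nonneg hτ fun s _ => norm_nonneg (Δ s))
  have hmean : ∀ k t, ∫ x, M.contrib k (M.flow Δ (v x) t) ∂ν = M.meanContrib (ν.map v) Δ k t := by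
    intro k t
    exact (integral_map (f := fun u => M.contrib k (M.flow Δ u t)) hv.aemeasurable
      ((M.continuous_contrib k).comp
        (M.continuous_flow_left Δ t)).aestronglyMeasurable).symm
  -- The tolerance per pattern: summed over the patterns and multiplied by κ it stays below η₀.
  -- Adding 1 avoids division by zero.
  set ζ := η₀ / ((κ + 1) * (Fintype.card ι + 1)) with hζ
  have hζ0 : 0 < ζ := by positivity
  have hLLN := HoldsInProb.forall (P := P) fun k : ι => holdsInProb_integral_abs_avg_sub_le hX
    (g := fun t x => M.contrib k (M.flow Δ (v x) t)) hτ
    (fun x => (M.continuous_contrib k).comp (M.continuous_flow Δ (v x)))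
    (fun t => (((M.continuous_contrib k).comp
      (M.continuous_flow_left Δ t)).measurable.comp hv).stronglyMeasurable)
    (by simp_rw [hmean]; exact M.continuous_meanContrib hμ Δ k)
    (b := fun x => M.c * a * Real.exp (|b| * C₀) * Real.exp (|b| * C₀ * ‖x‖))
    ((hν.memLp _).const_mul _)
    (fun t ht x => by
      have h1 := hab Δ Δ.continuous le_rfl _ (M.isPath_flow Δ (v x) τ) _ _ (M.abs_contrib_le k) t ht
      rw [flow_zero] at h1
      refine h1.trans ?_
      have hc := M.c_nonneg
      rw [mul_assoc _ (Real.exp _), ← Real.exp_add]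
      gcongr
      calc b * ‖v x‖ ≤ |b| * (C₀ * (1 + ‖x‖)) :=
            mul_le_mul (le_abs_self b) (hvC x) (norm_nonneg _) (abs_nonneg _)
        _ = _ := by ring)
    hζ0
  refine (((((h0 η₀ hη₀0).and (holdsInProb_avg_exp_le hν hX K)).and
    (holdsInProb_avg_exp_le hν hX (2 * (C₀ + B)))).and hLLN)).mono ?_
  filter_upwards [eventually_ne_atTop 0] with N hN
  filter_upwards [hu N] with ω ⟨Δ', hω⟩
  rintro ⟨⟨⟨hinit, hexpK⟩, hexp2⟩, hlln⟩ i t ht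
  have hinit' : ∀ i, ‖u N ω i 0 - v (X N ω i)‖ ≤ η₀ * Real.exp (B * ‖X N ω i‖) := fun i =>
    hinit i 0 rfl
  have hsq : (∑ i, M.ℓ (u N ω i 0) ^ 2) / (N : ℝ) ≤ Real.exp (2 * C₀) * m₁ := by
    calc _ ≤ (∑ i, Real.exp (2 * C₀) * Real.exp (2 * (C₀ + B) * ‖X N ω i‖)) / (N : ℝ) := by
          gcongr with i
          have h1 := M.abs_ℓ_le (u N ω i 0)
          have h2 := norm_le_norm_add_norm_sub' (u N ω i 0) (v (X N ω i))
          have hr := norm_nonneg (X N ω i)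
          have hB1 : 1 ≤ Real.exp (B * ‖X N ω i‖) := Real.one_le_exp (by positivity)
          have h3 : η₀ * Real.exp (B * ‖X N ω i‖) ≤ Real.exp (B * ‖X N ω i‖) :=
            mul_le_of_le_one_left (Real.exp_nonneg _) hη₀1
          have h4 : C₀ * (1 + ‖X N ω i‖) + 1 ≤ Real.exp (C₀ * (1 + ‖X N ω i‖)) :=
            Real.add_one_le_exp _
          have h5 : |M.ℓ (u N ω i 0)| ≤
              Real.exp (C₀ * (1 + ‖X N ω i‖)) * Real.exp (B * ‖X N ω i‖) := by
            have h6 : C₀ * (1 + ‖X N ω i‖) ≤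
                C₀ * (1 + ‖X N ω i‖) * Real.exp (B * ‖X N ω i‖) :=
              le_mul_of_one_le_right (by positivity) hB1
            have h7 := mul_le_mul_of_nonneg_right h4 (Real.exp_nonneg (B * ‖X N ω i‖))
            linarith [hinit' i, hvC (X N ω i)]
          rw [← sq_abs]
          calc _ ≤ (Real.exp (C₀ * (1 + ‖X N ω i‖)) * Real.exp (B * ‖X N ω i‖)) ^ 2 := by gcongr
            _ = _ := by
              rw [← Real.exp_add, ← Real.exp_add, ← Real.exp_nat_mul]; push_cast; ring_nf
      _ = Real.exp (2 * C₀) * ((∑ i, Real.exp (2 * (C₀ + B) * ‖X N ω i‖)) / N) := by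
          rw [← Finset.mul_sum, mul_div_assoc]
      _ ≤ _ := by gcongr
  have hR' : ∫ t in (0)..τ, ‖Δ' t‖ ≤ R := by
    refine (hω.integral_norm_le hN hκ hτ).trans (le_trans ?_ (le_max_left _ _))
    rw [hR₁]
    gcongr
  have hfin := h N (u N ω) Δ' (fun i => v (X N ω i)) (fun i => ‖X N ω i‖) η₀ hω hR'
    (fun i => norm_nonneg _) hη₀0.le hη₀1 hinit' (fun i => hvC _) hexpK ?_ i t ht
  · exact hfin.trans (by gcongr)
  have hc : ∀ k, Continuous fun t => |(∑ i, M.contrib k (M.flow Δ (v (X N ω i)) t)) / (N : ℝ) -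
      ∫ x, M.contrib k (M.flow Δ (v x) t) ∂ν| := fun k => by
    simp_rw [hmean]
    exact (((continuous_finsetSum _ fun i _ => (M.continuous_contrib k).comp
      (M.continuous_flow Δ _)).div_const _).sub (M.continuous_meanContrib hμ Δ k)).abs
  have hcs : Continuous fun t => κ * ∑ k, |(∑ i, M.contrib k (M.flow Δ (v (X N ω i)) t)) / (N : ℝ) -
      ∫ x, M.contrib k (M.flow Δ (v x) t) ∂ν| :=
    continuous_const.mul (continuous_finsetSum _ fun k _ => hc k)
  have hcε : Continuous fun t => ‖fun k => y k - Δ t k -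
      κ * ((∑ i, M.contrib k (M.flow Δ (v (X N ω i)) t)) / (N : ℝ))‖ := by
    refine Continuous.norm (continuous_pi fun k => ?_)
    exact (continuous_const.sub ((continuous_apply k).comp Δ.continuous)).sub
      (continuous_const.mul ((continuous_finsetSum _ fun i _ =>
        (M.continuous_contrib k).comp (M.continuous_flow Δ _)).div_const _))
  calc _ ≤ ∫ t in (0)..τ, κ * ∑ k, |(∑ i, M.contrib k (M.flow Δ (v (X N ω i)) t)) / (N : ℝ) -
          ∫ x, M.contrib k (M.flow Δ (v x) t) ∂ν| := by
        refine intervalIntegral.integral_mono_on hτ (hcε.intervalIntegrable _ _)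
          (hcs.intervalIntegrable _ _) fun t ht => ?_
        have hs : 0 ≤ ∑ k, |(∑ i, M.contrib k (M.flow Δ (v (X N ω i)) t)) / (N : ℝ) -
          ∫ x, M.contrib k (M.flow Δ (v x) t) ∂ν| := Finset.sum_nonneg fun _ _ => abs_nonneg _
        refine (pi_norm_le_iff_of_nonneg (by positivity)).2 fun k => ?_
        -- Self-consistency turns y − Δ into κ times a mean, so the consistency error is κ times a
        -- deviation in the law of large numbers.
        rw [hΔ t ht k, ← hmean, sub_sub_cancel, ← mul_sub, norm_mul, Real.norm_of_nonneg hκ,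
          Real.norm_eq_abs, abs_sub_comm]
        refine mul_le_mul_of_nonneg_left ?_ hκ
        exact Finset.single_le_sum (f := fun k =>
          |(∑ i, M.contrib k (M.flow Δ (v (X N ω i)) t)) / (N : ℝ) -
            ∫ x, M.contrib k (M.flow Δ (v x) t) ∂ν|) (fun _ _ => abs_nonneg _) (Finset.mem_univ k)
    _ = κ * ∑ k, ∫ t in (0)..τ, |(∑ i, M.contrib k (M.flow Δ (v (X N ω i)) t)) / (N : ℝ) -
          ∫ x, M.contrib k (M.flow Δ (v x) t) ∂ν| := by
        rw [intervalIntegral.integral_const_mul,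
          intervalIntegral.integral_finsetSum fun k _ => (hc k).intervalIntegrable _ _]
    _ ≤ κ * ∑ _k : ι, ζ := by
        gcongr with k
        exact hlln k
    _ ≤ (κ + 1) * ((Fintype.card ι + 1) * ζ) := by
        rw [Finset.sum_const, Finset.card_univ, nsmul_eq_mul]
        gcongr <;> linarith
    _ = η₀ := by rw [hζ]; field_simp

end NeuronModel

namespace TransferDMFT

/-! ### Neurons of two-layer networks -/

/-- The state of a neuron: its hidden weights and its readout weight. -/
abbrev Neuron (D : ℕ) := (Fin D → ℝ) × ℝ

/-- The preactivation at the input `x` as a function of the hidden weights of a neuron. -/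
noncomputable def preactL {D : ℕ} (x : Input D) : (Fin D → ℝ) →L[ℝ] ℝ :=
  ∑ j, (x j / √(D : ℝ)) • ContinuousLinearMap.proj j

theorem preactL_apply {D : ℕ} (x : Input D) (W : Fin D → ℝ) :
    preactL x W = (∑ j, W j * x j) / √(D : ℝ) := by
  simp only [preactL, _root_.sum_apply, _root_.smul_apply,
    ContinuousLinearMap.proj_apply, smul_eq_mul, Finset.sum_div]
  exact Finset.sum_congr rfl fun j _ => by ring

/-- The state of the `i`-th neuron of a network. -/
def neuron {N D : ℕ} (θ : Params N D) (i : Fin N) : Neuron D := (hidden θ i, readout θ i)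

theorem preact_eq {N D : ℕ} (θ : Params N D) (x : Input D) (i : Fin N) :
    preact θ x i = preactL x (neuron θ i).1 := (preactL_apply _ _).symm

/-- The input `x / √D`. -/
noncomputable def scaledInput {D : ℕ} (x : Input D) : Fin D → ℝ := fun j => x j / √(D : ℝ)

theorem preactL_scaledInput {D : ℕ} (x x' : Input D) :
    preactL x (scaledInput x') = gram x x' := by
  rw [preactL_apply, gram]
  simp only [scaledInput]
  rw [Finset.sum_div, Finset.sum_div]
  refine Finset.sum_congr rfl fun j _ => ?_
  rw [div_mul_eq_mul_div, div_div, Real.mul_self_sqrt (Nat.cast_nonneg D), mul_comm]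

section Model

variable {D : ℕ} {φ : ℝ → ℝ} {K₁ K₂ : ℝ≥0}

/-- The product difference is split so that the increment of φ' is multiplied by z only, which
yields the one-sided local Lipschitz bound required of a `NeuronModel`. -/
theorem abs_mul_sub_mul_le (h₁ : LipschitzWith K₁ φ) (h₂ : LipschitzWith K₂ (deriv φ))
    (s t w z : ℝ) : |deriv φ s * w - deriv φ t * z| ≤ K₁ * |w - z| + K₂ * |s - t| * |z| := by
  have e : deriv φ s * w - deriv φ t * z =
      deriv φ s * (w - z) + (deriv φ s - deriv φ t) * z := by ring
  rw [e]
  refine (abs_add_le _ _).trans ?_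
  rw [abs_mul, abs_mul]
  have h3 : |deriv φ s| ≤ K₁ := norm_deriv_le_of_lipschitz h₁
  have h4 : |deriv φ s - deriv φ t| ≤ K₂ * |s - t| := h₂.dist_le_mul s t
  gcongr

/-- The dynamics of the neurons of a network trained with weight decay `lam` and elastic strength
`δ`, the anchor being the initial hidden weights. -/
noncomputable def neuronModel (T : Task D) (h₁ : LipschitzWith K₁ φ)
    (h₂ : LipschitzWith K₂ (deriv φ)) {γ lam : ℝ} (hγ : 0 ≤ γ) (hlam : 0 ≤ lam) (δ : ℝ) :
    NeuronModel (Neuron D) (Fin T.size) where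
  A := ((-(lam + δ)) • ContinuousLinearMap.fst ℝ _ _).prod
    ((-lam) • ContinuousLinearMap.snd ℝ _ _)
  B := (δ • ContinuousLinearMap.fst ℝ _ _).prod 0
  q ν u := ((γ * (deriv φ (preactL (T.x ν) u.1) * u.2)) • scaledInput (T.x ν),
    γ * φ (preactL (T.x ν) u.1))
  ℓ := ContinuousLinearMap.snd ℝ _ _
  -- Sums over the patterns replace maxima, giving one constant for all patterns, both components,
  -- and both the growth and the Lipschitz bound.
  c := γ * ((∑ ν, ‖scaledInput (T.x ν)‖) * (K₁ + K₂ * ∑ ν, ‖preactL (T.x ν)‖) +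
    K₁ * (∑ ν, ‖preactL (T.x ν)‖) + |φ 0|)
  c_nonneg := by positivity
  norm_q_le ν u := by
    have hs := Finset.single_le_sum (f := fun ν => ‖scaledInput (T.x ν)‖)
      (fun _ _ => norm_nonneg _) (Finset.mem_univ ν)
    have hp := Finset.single_le_sum (f := fun ν => ‖preactL (T.x ν)‖)
      (fun _ _ => norm_nonneg _) (Finset.mem_univ ν)
    set S := ∑ ν, ‖scaledInput (T.x ν)‖
    set R := ∑ ν, ‖preactL (T.x ν)‖
    have hS : 0 ≤ S := (norm_nonneg _).trans hs
    have hR : 0 ≤ R := (norm_nonneg _).trans hp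
    have hu := norm_nonneg u
    have h3 : |deriv φ (preactL (T.x ν) u.1)| ≤ K₁ := norm_deriv_le_of_lipschitz h₁
    have h4 : |preactL (T.x ν) u.1| ≤ R * ‖u‖ :=
      ((preactL (T.x ν)).le_opNorm _).trans (mul_le_mul hp (norm_fst_le u) (norm_nonneg _) hR)
    have h5 : |φ (preactL (T.x ν) u.1)| ≤ |φ 0| + K₁ * (R * ‖u‖) := by
      have h6 : |φ (preactL (T.x ν) u.1) - φ 0| ≤ K₁ * |preactL (T.x ν) u.1 - 0| :=
        h₁.dist_le_mul _ _
      rw [sub_zero] at h6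
      have h7 : K₁ * |preactL (T.x ν) u.1| ≤ K₁ * (R * ‖u‖) := by gcongr
      linarith [abs_sub_abs_le_abs_sub (φ (preactL (T.x ν) u.1)) (φ 0)]
    have p1 : 0 ≤ S * (K₁ + K₂ * R) := by positivity
    have p2 : 0 ≤ K₁ * R := by positivity
    have p3 := abs_nonneg (φ 0)
    refine max_le ?_ ?_
    · change ‖(γ * (deriv φ (preactL (T.x ν) u.1) * u.2)) • scaledInput (T.x ν)‖ ≤ _
      rw [norm_smul, norm_mul, norm_mul, Real.norm_of_nonneg hγ]
      have h6 : ‖u.2‖ ≤ 1 + ‖u‖ := (norm_snd_le u).trans (by linarith)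
      calc _ ≤ γ * (K₁ * (1 + ‖u‖)) * S := by gcongr; exact h3
        _ = γ * (S * K₁) * (1 + ‖u‖) := by ring
        _ ≤ _ := by
          gcongr
          have : 0 ≤ S * (K₂ * R) := by positivity
          linarith
    · change ‖γ * φ (preactL (T.x ν) u.1)‖ ≤ _
      rw [norm_mul, Real.norm_of_nonneg hγ, mul_assoc]
      refine mul_le_mul_of_nonneg_left ?_ hγ
      rw [Real.norm_eq_abs]
      have : 0 ≤ (S * (K₁ + K₂ * R)) * ‖u‖ := by positivity
      have : 0 ≤ |φ 0| * ‖u‖ := by positivity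
      linarith
  norm_q_sub_le ν u v := by
    have hs := Finset.single_le_sum (f := fun ν => ‖scaledInput (T.x ν)‖)
      (fun _ _ => norm_nonneg _) (Finset.mem_univ ν)
    have hp := Finset.single_le_sum (f := fun ν => ‖preactL (T.x ν)‖)
      (fun _ _ => norm_nonneg _) (Finset.mem_univ ν)
    set S := ∑ ν, ‖scaledInput (T.x ν)‖
    set R := ∑ ν, ‖preactL (T.x ν)‖
    have hS : 0 ≤ S := (norm_nonneg _).trans hs
    have hR : 0 ≤ R := (norm_nonneg _).trans hp
    have hv := norm_nonneg v
    have huv := norm_nonneg (u - v)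
    have h4 : |preactL (T.x ν) u.1 - preactL (T.x ν) v.1| ≤ R * ‖u - v‖ := by
      rw [← map_sub]
      exact ((preactL (T.x ν)).le_opNorm _).trans
        (mul_le_mul hp (norm_fst_le (u - v)) (norm_nonneg _) hR)
    have p3 := abs_nonneg (φ 0)
    refine max_le ?_ ?_
    · change ‖(γ * (deriv φ (preactL (T.x ν) u.1) * u.2)) • scaledInput (T.x ν) -
        (γ * (deriv φ (preactL (T.x ν) v.1) * v.2)) • scaledInput (T.x ν)‖ ≤ _
      rw [← sub_smul, ← mul_sub, norm_smul, norm_mul, Real.norm_of_nonneg hγ, Real.norm_eq_abs]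
      have h5 := abs_mul_sub_mul_le h₁ h₂ (preactL (T.x ν) u.1) (preactL (T.x ν) v.1) u.2 v.2
      have h6 : |u.2 - v.2| ≤ ‖u - v‖ := norm_snd_le (u - v)
      have h7 : |v.2| ≤ ‖v‖ := norm_snd_le v
      calc _ ≤ γ * (K₁ * ‖u - v‖ + K₂ * (R * ‖u - v‖) * ‖v‖) * S := by
            gcongr
            exact h5.trans (by gcongr)
        _ = γ * (S * (K₁ + K₂ * R * ‖v‖)) * ‖u - v‖ := by ring
        _ ≤ _ := by
          refine mul_le_mul_of_nonneg_right ?_ huv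
          rw [mul_assoc γ]
          refine mul_le_mul_of_nonneg_left ?_ hγ
          have q1 : 0 ≤ S * K₁ * ‖v‖ := by positivity
          have q2 : 0 ≤ S * (K₂ * R) := by positivity
          have q3 : 0 ≤ K₁ * R * (1 + ‖v‖) := by positivity
          have q4 : 0 ≤ |φ 0| * (1 + ‖v‖) := by positivity
          linarith
    · change ‖γ * φ (preactL (T.x ν) u.1) - γ * φ (preactL (T.x ν) v.1)‖ ≤ _
      rw [← mul_sub, norm_mul, Real.norm_of_nonneg hγ]
      have h5 : ‖φ (preactL (T.x ν) u.1) - φ (preactL (T.x ν) v.1)‖ ≤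
          K₁ * |preactL (T.x ν) u.1 - preactL (T.x ν) v.1| := h₁.dist_le_mul _ _
      calc _ ≤ γ * (K₁ * (R * ‖u - v‖)) := by
            gcongr
            exact h5.trans (by gcongr)
        _ = γ * (K₁ * R) * ‖u - v‖ := by ring
        _ ≤ _ := by
          refine mul_le_mul_of_nonneg_right ?_ huv
          rw [mul_assoc γ]
          refine mul_le_mul_of_nonneg_left ?_ hγ
          have q1 : 0 ≤ K₁ * R * ‖v‖ := by positivity
          have q2 : 0 ≤ S * (K₁ + K₂ * R) * (1 + ‖v‖) := by positivity
          have q4 : 0 ≤ |φ 0| * (1 + ‖v‖) := by positivity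
          linarith
  abs_ℓ_le u := norm_snd_le u
  ℓ_mul_A_nonpos u := by
    change u.2 * (-lam * u.2) ≤ 0
    nlinarith [mul_nonneg hlam (mul_self_nonneg u.2)]
  ℓ_B u := rfl

variable (T : Task D) (h₁ : LipschitzWith K₁ φ) (h₂ : LipschitzWith K₂ (deriv φ)) {γ lam : ℝ}
  (hγ : 0 ≤ γ) (hlam : 0 ≤ lam) (δ : ℝ)

theorem drift_fst (Δ : Fin T.size → ℝ) (u₀ u : Neuron D) :
    ((neuronModel T h₁ h₂ hγ hlam δ).drift Δ u₀ u).1 = -(lam + δ) • u.1 + δ • u₀.1 +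
      ∑ ν, (Δ ν * (γ * (deriv φ (preactL (T.x ν) u.1) * u.2))) • scaledInput (T.x ν) := by
  simp [NeuronModel.drift, neuronModel, Prod.fst_sum, smul_smul]

theorem drift_snd (Δ : Fin T.size → ℝ) (u₀ u : Neuron D) :
    ((neuronModel T h₁ h₂ hγ hlam δ).drift Δ u₀ u).2 = -lam * u.2 +
      ∑ ν, Δ ν * (γ * φ (preactL (T.x ν) u.1)) := by
  simp [NeuronModel.drift, neuronModel, Prod.snd_sum]

theorem contrib_eq (ν : Fin T.size) (u : Neuron D) :
    (neuronModel T h₁ h₂ hγ hlam δ).contrib ν u = γ * (u.2 * φ (preactL (T.x ν) u.1)) := by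
  change u.2 * (γ * φ (preactL (T.x ν) u.1)) = _
  ring

end Model

/-! ### Gradients of the training objectives -/

section Gradient

variable {N D : ℕ} {φ : ℝ → ℝ}

theorem gradient_apply_eq {κ : Type*} [Fintype κ] [DecidableEq κ] {f : EuclideanSpace ℝ κ → ℝ}
    {f' : EuclideanSpace ℝ κ →L[ℝ] ℝ} {θ : EuclideanSpace ℝ κ} (hf : HasFDerivAt f f' θ) (k : κ) :
    (∇ f θ) k = f' (EuclideanSpace.single k 1) := by
  rw [← hf.fderiv, ← toDual_gradient, InnerProductSpace.toDual_apply_apply,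
    EuclideanSpace.inner_single_right]
  simp

/-- The preactivation of the `i`-th neuron as a function of the parameters. -/
noncomputable def paramPreactL (x : Input D) (i : Fin N) : Params N D →L[ℝ] ℝ :=
  ∑ j, (x j / √(D : ℝ)) • EuclideanSpace.proj (Sum.inl (i, j))

theorem paramPreactL_apply (x : Input D) (i : Fin N) (θ : Params N D) :
    paramPreactL x i θ = preact θ x i := by
  simp only [paramPreactL, _root_.sum_apply, _root_.smul_apply,
    EuclideanSpace.coe_proj, smul_eq_mul, preact, hidden, Finset.sum_div]
  exact Finset.sum_congr rfl fun j _ => by ring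

theorem paramPreactL_single_inl (x : Input D) (i i' : Fin N) (j : Fin D) :
    paramPreactL x i (EuclideanSpace.single (Sum.inl (i', j)) 1) =
      if i = i' then x j / √(D : ℝ) else 0 := by
  simp only [paramPreactL, _root_.sum_apply, _root_.smul_apply,
    EuclideanSpace.coe_proj, smul_eq_mul, PiLp.single_apply, Sum.inl.injEq,
    Prod.mk.injEq, mul_ite, mul_one, mul_zero]
  split_ifs with h
  · simp [h]
  · simp [h]

theorem paramPreactL_single_inr (x : Input D) (i i' : Fin N) :
    paramPreactL x i (EuclideanSpace.single (Sum.inr i') 1) = 0 := by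
  simp [paramPreactL]

theorem hasFDerivAt_network (hφ : Differentiable ℝ φ) (γ : ℝ) (x : Input D) (θ : Params N D) :
    HasFDerivAt (fun θ => network φ γ θ x) ((γ * N)⁻¹ • ∑ i,
      (readout θ i • deriv φ (preact θ x i) • paramPreactL x i +
        φ (preact θ x i) • (EuclideanSpace.proj (Sum.inr i) : Params N D →L[ℝ] ℝ))) θ := by
  have h1 : (fun θ : Params N D => network φ γ θ x) = fun θ =>
      (γ * N)⁻¹ • ∑ i, (EuclideanSpace.proj (Sum.inr i) : Params N D →L[ℝ] ℝ) θ *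
        φ (paramPreactL x i θ) := by
    funext θ
    simp only [network, output, div_eq_inv_mul, smul_eq_mul, paramPreactL_apply]
    rfl
  rw [h1]
  refine HasFDerivAt.fun_const_smul (HasFDerivAt.fun_sum fun i _ => ?_) ((γ * N)⁻¹ : ℝ)
  have h2 := (hφ (paramPreactL x i θ)).hasDerivAt.comp_hasFDerivAt θ
    (paramPreactL (N := N) x i).hasFDerivAt
  have h3 := ((EuclideanSpace.proj (Sum.inr i) : Params N D →L[ℝ] ℝ).hasFDerivAt (x := θ)).mul h2
  rw [paramPreactL_apply] at h3
  refine h3.congr_fderiv ?_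
  simp only [Function.comp_apply, paramPreactL_apply]
  rfl

theorem hasFDerivAt_loss (hφ : Differentiable ℝ φ) (γ : ℝ) (T : Task D) (θ : Params N D) :
    HasFDerivAt (loss φ γ T) (-∑ μ, (T.y μ - network φ γ θ (T.x μ)) • ((γ * N)⁻¹ • ∑ i,
      (readout θ i • deriv φ (preact θ (T.x μ) i) • paramPreactL (T.x μ) i +
        φ (preact θ (T.x μ) i) • (EuclideanSpace.proj (Sum.inr i) : Params N D →L[ℝ] ℝ)))) θ := by
  have h := (HasFDerivAt.fun_sum (u := Finset.univ) fun μ _ =>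
    (((hasFDerivAt_network (N := N) hφ γ (T.x μ) θ).const_sub (T.y μ)).pow 2)).const_mul (1 / 2 : ℝ)
  refine h.congr_fderiv ?_
  rw [Finset.smul_sum, ← Finset.sum_neg_distrib]
  refine Finset.sum_congr rfl fun μ _ => ?_
  ext v
  simp
  ring

theorem gradient_loss_inl (hφ : Differentiable ℝ φ) (γ : ℝ) (T : Task D) (θ : Params N D)
    (i : Fin N) (j : Fin D) : (∇ (loss φ γ T) θ) (Sum.inl (i, j)) =
      -∑ μ, (T.y μ - network φ γ θ (T.x μ)) * ((γ * N)⁻¹ *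
        (readout θ i * (deriv φ (preact θ (T.x μ) i) * (T.x μ j / √(D : ℝ))))) := by
  rw [gradient_apply_eq (hasFDerivAt_loss hφ γ T θ)]
  simp [paramPreactL_single_inl]

theorem gradient_loss_inr (hφ : Differentiable ℝ φ) (γ : ℝ) (T : Task D) (θ : Params N D)
    (i : Fin N) : (∇ (loss φ γ T) θ) (Sum.inr i) =
      -∑ μ, (T.y μ - network φ γ θ (T.x μ)) * ((γ * N)⁻¹ * φ (preact θ (T.x μ) i)) := by
  rw [gradient_apply_eq (hasFDerivAt_loss hφ γ T θ)]
  simp [paramPreactL_single_inr, PiLp.single_apply]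

theorem hasFDerivAt_targetObjective (hφ : Differentiable ℝ φ) (γ lam δ : ℝ) (T : Task D)
    (Wbar : Fin N → Fin D → ℝ) (θ : Params N D) :
    HasFDerivAt (targetObjective φ γ lam δ T Wbar)
      ((γ ^ 2 * N) • fderiv ℝ (loss φ γ T) θ + lam • innerSL ℝ θ + δ • ∑ i, ∑ j,
        (hidden θ i j - Wbar i j) • (EuclideanSpace.proj (Sum.inl (i, j)) : Params N D →L[ℝ] ℝ))
      θ := by
  have h1 := ((hasFDerivAt_loss (N := N) hφ γ T θ).differentiableAt.hasFDerivAt).const_mul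
    (γ ^ 2 * N)
  have h2 := ((hasStrictFDerivAt_norm_sq θ).hasFDerivAt).const_mul (lam / 2)
  have h3 := (HasFDerivAt.fun_sum (u := Finset.univ) fun i _ => HasFDerivAt.fun_sum
    (u := Finset.univ) fun j _ => (((EuclideanSpace.proj (Sum.inl (i, j)) :
      Params N D →L[ℝ] ℝ).hasFDerivAt (x := θ)).sub_const (Wbar i j)).pow 2).const_mul (δ / 2)
  refine ((h1.add h2).add h3).congr_fderiv ?_
  ext v
  simp [Finset.mul_sum, hidden]
  congr 1
  · ring
  · refine Finset.sum_congr rfl fun i _ => Finset.sum_congr rfl fun j _ => ?_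
    ring

theorem gradient_targetObjective_inl (hφ : Differentiable ℝ φ) (γ lam δ : ℝ) (T : Task D)
    (Wbar : Fin N → Fin D → ℝ) (θ : Params N D) (i : Fin N) (j : Fin D) :
    (∇ (targetObjective φ γ lam δ T Wbar) θ) (Sum.inl (i, j)) =
      γ ^ 2 * N * (∇ (loss φ γ T) θ) (Sum.inl (i, j)) + lam * hidden θ i j +
        δ * (hidden θ i j - Wbar i j) := by
  rw [gradient_apply_eq (hasFDerivAt_targetObjective hφ γ lam δ T Wbar θ),
    gradient_apply_eq (hasFDerivAt_loss hφ γ T θ).differentiableAt.hasFDerivAt]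
  simp [PiLp.single_apply, EuclideanSpace.inner_single_right, hidden, Prod.ext_iff,
    ite_and]

theorem gradient_targetObjective_inr (hφ : Differentiable ℝ φ) (γ lam δ : ℝ) (T : Task D)
    (Wbar : Fin N → Fin D → ℝ) (θ : Params N D) (i : Fin N) :
    (∇ (targetObjective φ γ lam δ T Wbar) θ) (Sum.inr i) =
      γ ^ 2 * N * (∇ (loss φ γ T) θ) (Sum.inr i) + lam * readout θ i := by
  rw [gradient_apply_eq (hasFDerivAt_targetObjective hφ γ lam δ T Wbar θ),
    gradient_apply_eq (hasFDerivAt_loss hφ γ T θ).differentiableAt.hasFDerivAt]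
  simp [EuclideanSpace.inner_single_right, readout]

theorem networkGrad_eq (hφ : Differentiable ℝ φ) {γ : ℝ} (hγ : γ ≠ 0) (θ : Params N D)
    (x : Input D) (i : Fin N) :
    networkGrad φ γ θ x i = deriv φ (preact θ x i) * readout θ i := by
  have hN : (N : ℝ) ≠ 0 := Nat.cast_ne_zero.2 (Fin.pos i).ne'
  have h : HasDerivAt (fun s => output φ γ (readout θ) (Function.update (preact θ x) i s))
      ((∑ k, readout θ k * (if k = i then deriv φ (preact θ x i) else 0)) / (γ * N))
      (preact θ x i) := by
    refine (HasDerivAt.fun_sum fun k _ => HasDerivAt.const_mul _ ?_).div_const _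
    by_cases hk : k = i
    · subst hk
      simpa using (hφ (preact θ x k)).hasDerivAt
    · simpa [hk] using hasDerivAt_const (preact θ x i) (φ (preact θ x k))
  rw [networkGrad, h.deriv]
  simp only [mul_ite, mul_zero, Finset.sum_ite_eq', Finset.mem_univ, if_true]
  field_simp

end Gradient

/-! ### Gradient flow moves the neurons -/

section Network

variable {N D : ℕ} {φ : ℝ → ℝ} {K₁ K₂ : ℝ≥0}

/-- The output is arranged as κ = γ⁻² times an average of contributions, the form in which
`IsNetwork` expresses the error signals. -/
theorem network_eq {γ : ℝ} (hγ : γ ≠ 0) (θ : Params N D) (x : Input D) :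
    network φ γ θ x = (γ ^ 2)⁻¹ *
      ((∑ i, γ * ((neuron θ i).2 * φ (preactL x (neuron θ i).1))) / N) := by
  simp only [network, output, preact_eq, neuron]
  rw [← Finset.mul_sum]
  field_simp

theorem continuous_preact (x : Input D) (i : Fin N) :
    Continuous fun θ : Params N D => preact θ x i := by
  simp only [← paramPreactL_apply]
  exact (paramPreactL x i).continuous

theorem continuous_network (hφ : Continuous φ) (γ : ℝ) (x : Input D) :
    Continuous fun θ : Params N D => network φ γ θ x := by
  unfold network output
  refine (continuous_finsetSum _ fun i _ => ?_).div_const _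
  exact (EuclideanSpace.proj (𝕜 := ℝ) (Sum.inr i)).continuous.mul
    (hφ.comp (continuous_preact x i))

theorem hasDerivWithinAt_neuron {θ : ℝ → Params N D} {V : Params N D} {s : Set ℝ} {t : ℝ}
    (h : HasDerivWithinAt θ V s t) (i : Fin N) :
    HasDerivWithinAt (fun t => neuron (θ t) i) (neuron V i) s t := by
  have hk : ∀ k, HasDerivWithinAt (fun t => θ t k) (V k) s t := fun k =>
    (EuclideanSpace.proj (𝕜 := ℝ) k).hasFDerivAt.comp_hasDerivWithinAt t h
  exact (hasDerivWithinAt_pi.2 fun j => hk (Sum.inl (i, j))).prodMk (hk (Sum.inr i))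

variable (T : Task D) (h₁ : LipschitzWith K₁ φ) (h₂ : LipschitzWith K₂ (deriv φ)) {γ lam : ℝ}
  (hγ : 0 < γ) (hlam : 0 ≤ lam) (δ : ℝ)

/-- One statement serves both stages: the elastic anchor is the initial hidden weights, and δ = 0
gives the source flow. -/
theorem exists_isNetwork (hφ : Differentiable ℝ φ) {τ : ℝ} (hτ : 0 ≤ τ) {θ V : ℝ → Params N D}
    (hθ : ∀ t ∈ Icc 0 τ, HasDerivWithinAt θ (V t) (Icc 0 τ) t)
    (hV₁ : ∀ t ∈ Icc 0 τ, ∀ i j, V t (Sum.inl (i, j)) =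
      -(γ ^ 2 * N * (∇ (loss φ γ T) (θ t)) (Sum.inl (i, j))) - lam * hidden (θ t) i j -
        δ * (hidden (θ t) i j - hidden (θ 0) i j))
    (hV₂ : ∀ t ∈ Icc 0 τ, ∀ i, V t (Sum.inr i) =
      -(γ ^ 2 * N * (∇ (loss φ γ T) (θ t)) (Sum.inr i)) - lam * readout (θ t) i) :
    ∃ Δ, (neuronModel T h₁ h₂ hγ.le hlam δ).IsNetwork (γ ^ 2)⁻¹ T.y τ Δ
      fun i t => neuron (θ t) i := by
  have hθc : ContinuousOn θ (Icc 0 τ) := fun t ht => (hθ t ht).continuousWithinAt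
  have hr : ∀ t, max 0 (min τ t) ∈ Icc 0 τ := fun t =>
    ⟨le_max_left _ _, max_le hτ (min_le_left _ _)⟩
  have hrt : ∀ t ∈ Icc 0 τ, max 0 (min τ t) = t := fun t ht => by
    rw [min_eq_right ht.2, max_eq_right ht.1]
  have hc : Continuous fun t => θ (max 0 (min τ t)) :=
    hθc.comp_continuous (by fun_prop) hr
  refine ⟨⟨fun t ν => T.y ν - network φ γ (θ (max 0 (min τ t))) (T.x ν),
    continuous_pi fun ν => continuous_const.sub ((continuous_network hφ.continuous γ _).comp hc)⟩,
    ?_, ?_⟩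
  · intro i t ht
    have hN : (N : ℝ) ≠ 0 := Nat.cast_ne_zero.2 (Fin.pos i).ne'
    -- The mean-field scaling: the learning rate γ²N cancels the output normalization, so the
    -- velocity of a neuron does not depend on the width.
    have hγN : γ ^ 2 * N * (γ * N)⁻¹ = γ := by
      field_simp
    refine (hasDerivWithinAt_neuron (hθ t ht) i).congr_deriv (Prod.ext ?_ ?_)
    · rw [drift_fst]
      funext j
      simp only [neuron, ContinuousMap.coe_mk, hrt t ht, hidden, Pi.add_apply, Pi.smul_apply,
        Finset.sum_apply, smul_eq_mul, scaledInput]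
      rw [hV₁ t ht, gradient_loss_inl hφ, mul_neg, neg_neg, Finset.mul_sum]
      have : ∀ μ, γ ^ 2 * N * ((T.y μ - network φ γ (θ t) (T.x μ)) * ((γ * N)⁻¹ *
          (readout (θ t) i * (deriv φ (preact (θ t) (T.x μ) i) * (T.x μ j / √(D : ℝ)))))) =
          (T.y μ - network φ γ (θ t) (T.x μ)) * (γ * (deriv φ (preactL (T.x μ)
            fun j => θ t (Sum.inl (i, j))) * readout (θ t) i)) * (T.x μ j / √(D : ℝ)) := by
        intro μ
        rw [preact_eq]
        calc _ = (γ ^ 2 * N * (γ * N)⁻¹) * ((T.y μ - network φ γ (θ t) (T.x μ)) *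
            (readout (θ t) i * (deriv φ (preactL (T.x μ) (neuron (θ t) i).1) *
              (T.x μ j / √(D : ℝ))))) := by ring
          _ = _ := by
            rw [hγN]
            simp only [neuron]
            change γ * (_ * (_ * (deriv φ (preactL (T.x μ) fun j => θ t (Sum.inl (i, j))) * _))) = _
            ring
      rw [Finset.sum_congr rfl fun μ _ => this μ]
      simp only [hidden]
      change _ = -(lam + δ) * θ t (Sum.inl (i, j)) + δ * θ 0 (Sum.inl (i, j)) + ∑ ν,
        (T.y ν - network φ γ (θ t) (T.x ν)) * (γ * (deriv φ (preactL (T.x ν)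
            fun j => θ t (Sum.inl (i, j))) * readout (θ t) i)) * (T.x ν j / √(D : ℝ))
      ring
    · rw [drift_snd]
      simp only [neuron, ContinuousMap.coe_mk, hrt t ht, readout]
      rw [hV₂ t ht, gradient_loss_inr hφ, mul_neg, neg_neg, Finset.mul_sum]
      have : ∀ μ, γ ^ 2 * N * ((T.y μ - network φ γ (θ t) (T.x μ)) * ((γ * N)⁻¹ *
          φ (preact (θ t) (T.x μ) i))) =
          (T.y μ - network φ γ (θ t) (T.x μ)) * (γ * φ (preactL (T.x μ) (hidden (θ t) i))) := by
        intro μ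
        rw [preact_eq]
        calc _ = (γ ^ 2 * N * (γ * N)⁻¹) * ((T.y μ - network φ γ (θ t) (T.x μ)) *
            φ (preactL (T.x μ) (hidden (θ t) i))) := by simp only [neuron]; ring
          _ = _ := by rw [hγN]; ring
      rw [Finset.sum_congr rfl fun μ _ => this μ]
      simp only [readout]
      ring
  · intro t ht ν
    simp only [ContinuousMap.coe_mk, hrt t ht, contrib_eq, network_eq hγ.ne']

variable {T}

theorem IsSourceFlow.exists_isNetwork (hφ : Differentiable ℝ φ) {τ : ℝ} (hτ : 0 ≤ τ)
    {θ : ℝ → Params N D} (hθ : IsSourceFlow φ γ lam τ T θ) :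
    ∃ Δ, (neuronModel T h₁ h₂ hγ.le hlam 0).IsNetwork (γ ^ 2)⁻¹ T.y τ Δ
      fun i t => neuron (θ t) i :=
  TransferDMFT.exists_isNetwork T h₁ h₂ hγ hlam 0 hφ hτ hθ
    (fun t _ i j => by simp [hidden]) (fun t _ i => by simp [readout])

theorem IsTargetFlow.exists_isNetwork (hφ : Differentiable ℝ φ) {τ : ℝ} (hτ : 0 ≤ τ)
    {θ : ℝ → Params N D} (hθ : IsTargetFlow φ γ lam δ T (hidden (θ 0)) θ) :
    ∃ Δ, (neuronModel T h₁ h₂ hγ.le hlam δ).IsNetwork (γ ^ 2)⁻¹ T.y τ Δ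
      fun i t => neuron (θ t) i := by
  refine TransferDMFT.exists_isNetwork T h₁ h₂ hγ hlam δ hφ hτ
    (fun t ht => (hθ t ht.1).mono Icc_subset_Ici_self) (fun t _ i j => ?_) (fun t _ i => ?_)
  · rw [PiLp.neg_apply, gradient_targetObjective_inl hφ]
    ring
  · rw [PiLp.neg_apply, gradient_targetObjective_inr hφ]
    ring

end Network

end TransferDMFT

/-! ### Duhamel's formula -/

section Duhamel

variable {E : Type*} [NormedAddCommGroup E] [NormedSpace ℝ E] [CompleteSpace E]

theorem hasDerivWithinAt_duhamel (a : ℝ) (c : E) {f : ℝ → E} {τ : ℝ}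
    (hf : ContinuousOn f (Icc 0 τ)) {t : ℝ} (ht : t ∈ Icc 0 τ) :
    HasDerivWithinAt (fun t => Real.exp (-a * t) • c +
        ∫ s in (0)..t, Real.exp (-a * (t - s)) • f s)
      (-a • (Real.exp (-a * t) • c + ∫ s in (0)..t, Real.exp (-a * (t - s)) • f s) + f t)
      (Icc 0 τ) t := by
  have key : ∀ t, ∫ s in (0)..t, Real.exp (-a * (t - s)) • f s =
      Real.exp (-a * t) • ∫ s in (0)..t, Real.exp (a * s) • f s := by
    intro t
    rw [← intervalIntegral.integral_smul]
    refine intervalIntegral.integral_congr fun s _ => ?_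
    rw [smul_smul, ← Real.exp_add]
    ring_nf
  simp only [key]
  have hg : ContinuousOn (fun s => Real.exp (a * s) • f s) (Icc 0 τ) :=
    (by fun_prop : Continuous fun s : ℝ => Real.exp (a * s)).continuousOn.smul hf
  have h0 : (0 : ℝ) ∈ Icc 0 τ := ⟨le_rfl, ht.1.trans ht.2⟩
  have hint : IntervalIntegrable (fun s => Real.exp (a * s) • f s) volume 0 t :=
    (hg.mono (by rw [uIcc_of_le ht.1]; exact Icc_subset_Icc_right ht.2)).intervalIntegrable
  have : Fact (t ∈ Icc 0 τ) := ⟨ht⟩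
  have h1 : HasDerivWithinAt (fun t => ∫ s in (0)..t, Real.exp (a * s) • f s)
      (Real.exp (a * t) • f t) (Icc 0 τ) t :=
    intervalIntegral.integral_hasDerivWithinAt_right hint
      (hg.stronglyMeasurableAtFilter_nhdsWithin measurableSet_Icc t) (hg t ht)
  have h2 : HasDerivWithinAt (fun t : ℝ => Real.exp (-a * t)) (Real.exp (-a * t) * -a)
      (Icc 0 τ) t := by
    have := ((hasDerivAt_id t).const_mul (-a)).exp
    simpa using this.hasDerivWithinAt
  refine ((h2.smul_const c).add (h2.smul h1)).congr_deriv ?_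
  rw [smul_smul, ← Real.exp_add]
  have : -a * t + a * t = 0 := by ring
  rw [this, Real.exp_zero, one_smul, smul_add, smul_smul, smul_smul, mul_comm _ (-a)]
  abel

/-- Multiplication by exp(−a(t − s)) removes the linear term, and the derivative in s is then
integrated from 0 to t. -/
theorem eq_duhamel {a : ℝ} {f w : ℝ → E} {τ : ℝ} (hf : ContinuousOn f (Icc 0 τ))
    (hw : ∀ t ∈ Icc 0 τ, HasDerivWithinAt w (-a • w t + f t) (Icc 0 τ) t) {t : ℝ}
    (ht : t ∈ Icc 0 τ) :
    w t = Real.exp (-a * t) • w 0 + ∫ s in (0)..t, Real.exp (-a * (t - s)) • f s := by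
  have hd : ∀ s ∈ Icc 0 τ, HasDerivWithinAt (fun s => Real.exp (-a * (t - s)) • w s)
      (Real.exp (-a * (t - s)) • f s) (Icc 0 τ) s := by
    intro s hs
    have h2 : HasDerivWithinAt (fun s : ℝ => Real.exp (-a * (t - s)))
        (Real.exp (-a * (t - s)) * a) (Icc 0 τ) s := by
      have := (((hasDerivAt_id s).const_sub t).const_mul (-a)).exp
      simpa using this.hasDerivWithinAt
    refine (h2.smul (hw s hs)).congr_deriv ?_
    rw [smul_add, mul_smul, neg_smul, smul_neg]
    abel
  have hsub : Icc 0 t ⊆ Icc 0 τ := Icc_subset_Icc_right ht.2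
  have h := intervalIntegral.integral_eq_sub_of_hasDerivAt_of_le ht.1
    (fun s hs => ((hd s (hsub hs)).continuousWithinAt).mono hsub)
    (fun s hs => (hd s (hsub (Ioo_subset_Icc_self hs))).hasDerivAt
      (Icc_mem_nhds hs.1 (hs.2.trans_le ht.2)))
    (((by fun_prop : Continuous fun s : ℝ => Real.exp (-a * (t - s))).continuousOn.smul
      (hf.mono hsub)).intervalIntegrable_of_Icc ht.1)
  rw [h]
  simp

/-- The source stage, with δ = 0, may have no weight decay, so λ + δ = 0 must be covered; then δ = 0
and both sides vanish. -/
theorem integral_exp_neg_mul_sub {lam δ : ℝ} (hlam : 0 ≤ lam) (hδ : 0 ≤ δ) (t : ℝ) :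
    ∫ s in (0)..t, Real.exp (-(lam + δ) * (t - s)) * δ =
      δ / (lam + δ) * (1 - Real.exp (-(lam + δ) * t)) := by
  rcases eq_or_ne (lam + δ) 0 with h | h
  · have : δ = 0 := by linarith
    simp [this]
  · rw [intervalIntegral.integral_mul_const]
    have : ∀ s ∈ uIcc 0 t, HasDerivAt (fun s => Real.exp (-(lam + δ) * (t - s)) / (lam + δ))
        (Real.exp (-(lam + δ) * (t - s))) s := by
      intro s _
      have := ((((hasDerivAt_id s).const_sub t).const_mul (-(lam + δ))).exp).div_const (lam + δ)
      refine this.congr_deriv ?_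
      simp only [id_eq]
      field_simp
    rw [intervalIntegral.integral_eq_sub_of_hasDerivAt this
      ((by fun_prop : Continuous fun s : ℝ =>
        Real.exp (-(lam + δ) * (t - s))).intervalIntegrable _ _)]
    simp
    ring

end Duhamel

namespace TransferDMFT

/-! ### The single-site equations along a path -/

section Path

variable {D : ℕ} {φ : ℝ → ℝ} {K₁ K₂ : ℝ≥0}

/-- The fraction of the initial hidden weights which weight decay and the elastic penalty leave at
time `t`. -/
noncomputable def retention (lam δ t : ℝ) : ℝ :=
  Real.exp (-(lam + δ) * t) + δ / (lam + δ) * (1 - Real.exp (-(lam + δ) * t))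

/-- The single-site equations with given error signals `Δ`, along one path. -/
structure SolvesSiteEquations (φ : ℝ → ℝ) (γ lam δ : ℝ) (T : Task D)
    (Δ : ℝ → Fin T.size → ℝ) (S : Set ℝ) (h₀ : Input D → ℝ) (ψ : ℝ) (h : Input D → ℝ → ℝ)
    (z : ℝ → ℝ) : Prop where
  eq_h : ∀ x, ∀ t ∈ S, h x t = retention lam δ t * h₀ x +
    γ * ∫ s in (0)..t, Real.exp (-(lam + δ) * (t - s)) *
      ∑ ν, Δ s ν * (deriv φ (h (T.x ν) s) * z s) * gram x (T.x ν)
  eq_z : ∀ t ∈ S, z t = Real.exp (-lam * t) * ψ +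
    γ * ∫ s in (0)..t, Real.exp (-lam * (t - s)) * ∑ ν, Δ s ν * φ (h (T.x ν) s)

/-- Projecting the weights on an input turns their Duhamel formula into the equation for h. The
constant forcing δW₀ produces the anchor part of `retention`. -/
theorem preactL_duhamel {lam δ : ℝ} (hlam : 0 ≤ lam) (hδ : 0 ≤ δ) (γ : ℝ) (T : Task D)
    (W₀ : Fin D → ℝ) {b : Fin T.size → ℝ → ℝ} {t : ℝ} (ht : 0 ≤ t)
    (hb : ∀ ν, ContinuousOn (b ν) (Icc 0 t)) (x : Input D) :
    preactL x (Real.exp (-(lam + δ) * t) • W₀ + ∫ s in (0)..t, Real.exp (-(lam + δ) * (t - s)) •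
      (δ • W₀ + ∑ ν, (γ * b ν s) • scaledInput (T.x ν))) =
    retention lam δ t * preactL x W₀ + γ * ∫ s in (0)..t, Real.exp (-(lam + δ) * (t - s)) *
      ∑ ν, b ν s * gram x (T.x ν) := by
  have he : Continuous fun s : ℝ => Real.exp (-(lam + δ) * (t - s)) := by fun_prop
  have hF : ContinuousOn (fun s => δ • W₀ + ∑ ν, (γ * b ν s) • scaledInput (T.x ν)) (Icc 0 t) :=
    continuousOn_const.add (continuousOn_finsetSum _ fun ν _ =>
      (continuousOn_const.mul (hb ν)).smul continuousOn_const)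
  have hi : IntervalIntegrable (fun s => Real.exp (-(lam + δ) * (t - s)) •
      (δ • W₀ + ∑ ν, (γ * b ν s) • scaledInput (T.x ν))) volume 0 t :=
    (he.continuousOn.smul hF).intervalIntegrable_of_Icc ht
  have hG : ContinuousOn (fun s => ∑ ν, b ν s * gram x (T.x ν)) (Icc 0 t) :=
    continuousOn_finsetSum _ fun ν _ => (hb ν).mul continuousOn_const
  have hi₁ : IntervalIntegrable (fun s => Real.exp (-(lam + δ) * (t - s)) * δ * preactL x W₀)
      volume 0 t := ((he.mul continuous_const).mul continuous_const).intervalIntegrable _ _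
  have hi₂ : IntervalIntegrable (fun s => γ * (Real.exp (-(lam + δ) * (t - s)) *
      ∑ ν, b ν s * gram x (T.x ν))) volume 0 t :=
    (continuousOn_const.mul (he.continuousOn.mul hG)).intervalIntegrable_of_Icc ht
  rw [map_add, map_smul, ← ContinuousLinearMap.intervalIntegral_comp_comm _ hi, retention,
    ← integral_exp_neg_mul_sub hlam hδ, add_mul, smul_eq_mul, add_assoc,
    ← intervalIntegral.integral_mul_const, ← intervalIntegral.integral_const_mul,
    ← intervalIntegral.integral_add hi₁ hi₂]
  congr 1
  refine intervalIntegral.integral_congr fun s _ => ?_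
  simp only [map_smul, map_add, map_sum, preactL_scaledInput, smul_eq_mul, mul_add, Finset.mul_sum]
  congr 1
  · ring
  · exact Finset.sum_congr rfl fun ν _ => by ring

variable {T : Task D} (h₁ : LipschitzWith K₁ φ) (h₂ : LipschitzWith K₂ (deriv φ)) {γ lam δ : ℝ}
  (hγ : 0 ≤ γ) (hlam : 0 ≤ lam)

/-- Solutions of the single-site equations are trajectories of neurons. -/
theorem SolvesSiteEquations.eq_flow (hδ : 0 ≤ δ) {Δ : C(ℝ, Fin T.size → ℝ)} {τ : ℝ} {h₀ : Input D → ℝ} {ψ : ℝ}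
    {h : Input D → ℝ → ℝ} {z : ℝ → ℝ}
    (H : SolvesSiteEquations φ γ lam δ T Δ (Icc 0 τ) h₀ ψ h z)
    (hhc : ∀ x, ContinuousOn (h x) (Icc 0 τ)) (hzc : ContinuousOn z (Icc 0 τ))
    {W₀ : Fin D → ℝ} (hW : ∀ ν, h₀ (T.x ν) = preactL (T.x ν) W₀) {t : ℝ} (ht : t ∈ Icc 0 τ) :
    z t = ((neuronModel T h₁ h₂ hγ hlam δ).flow Δ (W₀, ψ) t).2 ∧ ∀ x, h₀ x = preactL x W₀ →
      h x t = preactL x ((neuronModel T h₁ h₂ hγ hlam δ).flow Δ (W₀, ψ) t).1 := by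
  have hΔc : ∀ ν, Continuous fun s => Δ s ν := fun ν => (continuous_apply ν).comp Δ.continuous
  set b : Fin T.size → ℝ → ℝ := fun ν s => Δ s ν * (deriv φ (h (T.x ν) s) * z s) with hb
  have hbc : ∀ ν, ContinuousOn (b ν) (Icc 0 τ) := fun ν =>
    (hΔc ν).continuousOn.mul ((h₂.continuous.comp_continuousOn (hhc _)).mul hzc)
  set F : ℝ → Fin D → ℝ := fun s => δ • W₀ + ∑ ν, (γ * b ν s) • scaledInput (T.x ν) with hF
  have hFc : ContinuousOn F (Icc 0 τ) :=
    continuousOn_const.add (continuousOn_finsetSum _ fun ν _ =>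
      (continuousOn_const.mul (hbc ν)).smul continuousOn_const)
  -- The site gives only preactivations. Hidden weights are reconstructed by Duhamel's formula with
  -- the forcing read off from h and z; since they reproduce h at the patterns, the pair (W, z) is a
  -- neuron path.
  set W : ℝ → Fin D → ℝ := fun t => Real.exp (-(lam + δ) * t) • W₀ +
    ∫ s in (0)..t, Real.exp (-(lam + δ) * (t - s)) • F s with hWdef
  have hWh : ∀ t ∈ Icc 0 τ, ∀ x, h₀ x = preactL x W₀ → h x t = preactL x (W t) := by
    intro t ht x hx
    rw [H.eq_h x t ht, hx, hWdef]
    exact (preactL_duhamel hlam hδ γ T W₀ ht.1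
      (fun ν => (hbc ν).mono (Icc_subset_Icc_right ht.2)) x).symm
  set f : ℝ → ℝ := fun s => ∑ ν, Δ s ν * (γ * φ (h (T.x ν) s)) with hf
  have hfc : ContinuousOn f (Icc 0 τ) := continuousOn_finsetSum _ fun ν _ =>
    (hΔc ν).continuousOn.mul
      (continuousOn_const.mul (h₁.continuous.comp_continuousOn (hhc _)))
  have hz : ∀ t ∈ Icc 0 τ, z t = Real.exp (-lam * t) • ψ +
      ∫ s in (0)..t, Real.exp (-lam * (t - s)) • f s := by
    intro t ht
    rw [H.eq_z t ht, smul_eq_mul, ← intervalIntegral.integral_const_mul]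
    congr 1
    refine intervalIntegral.integral_congr fun s _ => ?_
    simp only [hf, smul_eq_mul, Finset.mul_sum]
    exact Finset.sum_congr rfl fun ν _ => by ring
  have h0 : (0 : ℝ) ∈ Icc 0 τ := ⟨le_rfl, ht.1.trans ht.2⟩
  have hW0 : W 0 = W₀ := by simp [hWdef]
  have hz0 : z 0 = ψ := by simp [hz 0 h0]
  have hpath : (neuronModel T h₁ h₂ hγ hlam δ).IsPath Δ τ fun t => (W t, z t) := by
    intro s hs
    have hd₁ := hasDerivWithinAt_duhamel (lam + δ) W₀ hFc hs
    have hd₂ := (hasDerivWithinAt_duhamel lam ψ hfc hs).congr (f₁ := z) hz (hz s hs)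
    rw [← hz s hs] at hd₂
    refine (hd₁.prodMk hd₂).congr_deriv (Prod.ext ?_ ?_)
    · rw [drift_fst]
      change -(lam + δ) • W s + F s = -(lam + δ) • W s + δ • W 0 + _
      rw [hW0, hF, ← add_assoc]
      congr 1
      refine Finset.sum_congr rfl fun ν _ => ?_
      simp only [hb, ← hWh s hs _ (hW ν)]
      congr 1
      ring
    · rw [drift_snd]
      simp only [hf, ← hWh s hs _ (hW _), smul_eq_mul]
  have := (neuronModel T h₁ h₂ hγ hlam δ).flow_eq Δ hpath ht
  rw [hW0, hz0] at this
  rw [← this]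
  exact ⟨rfl, fun x hx => hWh t ht x hx⟩

/-- Trajectories of neurons solve the single-site equations. -/
theorem solvesSiteEquations_flow (hδ : 0 ≤ δ) (Δ : C(ℝ, Fin T.size → ℝ)) {h₀ : Input D → ℝ} {W₀ : Fin D → ℝ}
    (hW : ∀ ν, h₀ (T.x ν) = preactL (T.x ν) W₀) (ψ : ℝ) :
    SolvesSiteEquations φ γ lam δ T Δ (Ici 0) h₀ ψ
      (fun x t => preactL x ((neuronModel T h₁ h₂ hγ hlam δ).flow Δ (W₀, ψ) t).1 +
        retention lam δ t * (h₀ x - preactL x W₀))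
      (fun t => ((neuronModel T h₁ h₂ hγ hlam δ).flow Δ (W₀, ψ) t).2) := by
  set M := neuronModel T h₁ h₂ hγ hlam δ
  set u := M.flow Δ (W₀, ψ) with hu
  have hu0 : u 0 = (W₀, ψ) := M.flow_zero Δ _
  have huc : Continuous u := M.continuous_flow Δ _
  have hΔc : ∀ ν, Continuous fun s => Δ s ν := fun ν => (continuous_apply ν).comp Δ.continuous
  set b : Fin T.size → ℝ → ℝ := fun ν s => Δ s ν * (deriv φ (preactL (T.x ν) (u s).1) * (u s).2)
    with hb
  have hbc : ∀ ν, Continuous (b ν) := fun ν =>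
    (hΔc ν).mul ((h₂.continuous.comp ((preactL _).continuous.comp huc.fst)).mul huc.snd)
  have hpath := M.isPath_flow Δ (W₀, ψ)
  rw [← hu] at hpath
  constructor
  · intro x t ht
    have ht' : t ∈ Icc 0 t := ⟨ht, le_rfl⟩
    have hd : ∀ s ∈ Icc 0 t, HasDerivWithinAt (fun s => (u s).1)
        (-(lam + δ) • (u s).1 + (δ • W₀ + ∑ ν, (γ * b ν s) • scaledInput (T.x ν))) (Icc 0 t) s := by
      intro s hs
      refine (hasFDerivAt_fst.comp_hasDerivWithinAt s (hpath t s hs)).congr_deriv ?_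
      change (M.drift (Δ s) (u 0) (u s)).1 = _
      rw [drift_fst, hu0, ← add_assoc]
      congr 1
      refine Finset.sum_congr rfl fun ν _ => ?_
      simp only [hb]
      congr 1
      ring
    have hFc : ContinuousOn (fun s => δ • W₀ + ∑ ν, (γ * b ν s) • scaledInput (T.x ν))
        (Icc 0 t) :=
      continuousOn_const.add (continuousOn_finsetSum _ fun ν _ =>
        (continuousOn_const.mul (hbc ν).continuousOn).smul continuousOn_const)
    simp only [hW, sub_self, mul_zero, add_zero]
    rw [eq_duhamel hFc hd ht', hu0, preactL_duhamel hlam hδ γ T W₀ ht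
      (fun ν => (hbc ν).continuousOn) x]
    simp only [hb]
    ring
  · intro t ht
    have ht' : t ∈ Icc 0 t := ⟨ht, le_rfl⟩
    have hd : ∀ s ∈ Icc 0 t, HasDerivWithinAt (fun s => (u s).2)
        (-lam • (u s).2 + ∑ ν, Δ s ν * (γ * φ (preactL (T.x ν) (u s).1))) (Icc 0 t) s := by
      intro s hs
      refine (hasFDerivAt_snd.comp_hasDerivWithinAt s (hpath t s hs)).congr_deriv ?_
      change (M.drift (Δ s) (u 0) (u s)).2 = _
      rw [drift_snd, smul_eq_mul]
    have hfc : Continuous fun s => ∑ ν, Δ s ν * (γ * φ (preactL (T.x ν) (u s).1)) :=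
      continuous_finsetSum _ fun ν _ => (hΔc ν).mul
        (continuous_const.mul (h₁.continuous.comp ((preactL _).continuous.comp huc.fst)))
    simp only [hW, sub_self, mul_zero, add_zero]
    rw [eq_duhamel hfc.continuousOn hd ht', hu0, smul_eq_mul,
      ← intervalIntegral.integral_const_mul]
    congr 1
    refine intervalIntegral.integral_congr fun s _ => ?_
    simp only [smul_eq_mul, Finset.mul_sum]
    exact Finset.sum_congr rfl fun ν _ => by ring

end Path

/-! ### The single-site system and the neuron flow -/

section Site

variable {D : ℕ} {φ : ℝ → ℝ} {K₁ K₂ : ℝ≥0} {T : Task D} {γ lam δ : ℝ}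
  {Ω : Type*} [MeasurableSpace Ω] {P : Measure Ω} {h₀ : Input D → Ω → ℝ} {ψ : Ω → ℝ}
  {h : Input D → ℝ → Ω → ℝ} {z : ℝ → Ω → ℝ}

theorem IsDMFT.mono {S S' : Set ℝ} (H : IsDMFT φ γ lam δ T S P h₀ ψ h z) (hS : S' ⊆ S) :
    IsDMFT φ γ lam δ T S' P h₀ ψ h z where
  aemeasurable_h x t ht := H.aemeasurable_h x t (hS ht)
  aemeasurable_z t ht := H.aemeasurable_z t (hS ht)
  continuous_h := H.continuous_h.mono fun _ hω x => (hω x).mono hS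
  continuous_z := H.continuous_z.mono fun _ hω => hω.mono hS
  integrable x t ht := H.integrable x t (hS ht)
  continuous_predictor x := (H.continuous_predictor x).mono hS
  eq_h := H.eq_h.mono fun _ hω x t ht => hω x t (hS ht)
  eq_z := H.eq_z.mono fun _ hω t ht => hω t (hS ht)

/-- Quadratic growth at an arbitrary test input; the bound on `contrib` covers only the training
patterns. -/
theorem abs_readout_mul_le (h₁ : LipschitzWith K₁ φ) (x : Input D) (u : Neuron D) :
    |u.2 * φ (preactL x u.1)| ≤ (|φ 0| + K₁ * ‖preactL x‖) * (1 + ‖u‖) ^ 2 := by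
  have h4 : |preactL x u.1| ≤ ‖preactL x‖ * ‖u‖ :=
    ((preactL x).le_opNorm _).trans (by gcongr; exact norm_fst_le u)
  have h5 : |φ (preactL x u.1)| ≤ |φ 0| + K₁ * (‖preactL x‖ * ‖u‖) := by
    have h6 : |φ (preactL x u.1) - φ 0| ≤ K₁ * |preactL x u.1 - 0| := h₁.dist_le_mul _ _
    rw [sub_zero] at h6
    have h7 : K₁ * |preactL x u.1| ≤ K₁ * (‖preactL x‖ * ‖u‖) := by gcongr
    linarith [abs_sub_abs_le_abs_sub (φ (preactL x u.1)) (φ 0)]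
  have hu := norm_nonneg u
  rw [abs_mul]
  calc |u.2| * |φ (preactL x u.1)| ≤ ‖u‖ * (|φ 0| + K₁ * (‖preactL x‖ * ‖u‖)) := by
        gcongr
        exact norm_snd_le u
    _ ≤ _ := by
      have p1 := abs_nonneg (φ 0)
      have p2 : 0 ≤ K₁ * ‖preactL x‖ := by positivity
      nlinarith [mul_nonneg p1 hu, mul_nonneg p2 hu, mul_nonneg p1 (mul_nonneg hu hu)]

variable (h₁ : LipschitzWith K₁ φ) (h₂ : LipschitzWith K₂ (deriv φ)) (hγ : 0 < γ)
  (hlam : 0 ≤ lam)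

theorem continuous_readout_mul (h₁ : LipschitzWith K₁ φ) (x : Input D) :
    Continuous fun u : Neuron D => u.2 * φ (preactL x u.1) :=
  continuous_snd.mul (h₁.continuous.comp ((preactL x).continuous.comp continuous_fst))

/-- The predictor of a site with prescribed trajectories. -/
theorem sitePredictor_eq {W₀ : Ω → Fin D → ℝ} (hW₀ : AEMeasurable W₀ P) (hψ : AEMeasurable ψ P)
    (h₁ : LipschitzWith K₁ φ) (M : NeuronModel (Neuron D) (Fin T.size))
    (Δ : C(ℝ, Fin T.size → ℝ)) {x : Input D} {t : ℝ}
    (hflow : ∀ᵐ ω ∂P, h x t ω = preactL x (M.flow Δ (W₀ ω, ψ ω) t).1 ∧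
      z t ω = (M.flow Δ (W₀ ω, ψ ω) t).2) :
    sitePredictor φ γ P h z x t = γ⁻¹ * ∫ u, (M.flow Δ u t).2 * φ (preactL x (M.flow Δ u t).1)
      ∂(P.map fun ω => (W₀ ω, ψ ω)) := by
  have hc : Continuous fun u => (M.flow Δ u t).2 * φ (preactL x (M.flow Δ u t).1) :=
    (continuous_readout_mul h₁ x).comp (M.continuous_flow_left Δ t)
  rw [sitePredictor, integral_map (hW₀.prodMk hψ) hc.aestronglyMeasurable]
  congr 1
  refine integral_congr_ae ?_
  filter_upwards [hflow] with ω hω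
  rw [hω.1, hω.2]

theorem inv_sq_mul_meanContrib (μ : Measure (Neuron D)) (Δ : C(ℝ, Fin T.size → ℝ))
    (ν : Fin T.size) (t : ℝ) :
    (γ ^ 2)⁻¹ * (neuronModel T h₁ h₂ hγ.le hlam δ).meanContrib μ Δ ν t =
      γ⁻¹ * ∫ u, ((neuronModel T h₁ h₂ hγ.le hlam δ).flow Δ u t).2 *
        φ (preactL (T.x ν) ((neuronModel T h₁ h₂ hγ.le hlam δ).flow Δ u t).1) ∂μ := by
  rw [NeuronModel.meanContrib]
  simp only [contrib_eq]
  rw [integral_const_mul, ← mul_assoc]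
  congr 1
  have := hγ.ne'
  field_simp

/-- A solution of the single-site system consists of trajectories of neurons, driven by
self-consistent error signals. -/
theorem IsDMFT.exists_flow {S : Set ℝ} (H : IsDMFT φ γ lam δ T S P h₀ ψ h z) (hδ : 0 ≤ δ)
    (hS : ∀ t ∈ S, 0 ≤ t ∧ Icc 0 t ⊆ S) {r : ℝ → ℝ} (hr : Continuous r) (hrS : ∀ t, r t ∈ S)
    (hrt : ∀ t ∈ S, r t = t) {W₀ : Ω → Fin D → ℝ} (hW₀ : AEMeasurable W₀ P)
    (hψ : AEMeasurable ψ P) (hW : ∀ x, ∀ᵐ ω ∂P, h₀ x ω = preactL x (W₀ ω)) :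
    ∃ Δ : C(ℝ, Fin T.size → ℝ),
      (∀ t ∈ S, (neuronModel T h₁ h₂ hγ.le hlam δ).IsSelfConsistent
        (P.map fun ω => (W₀ ω, ψ ω)) (γ ^ 2)⁻¹ T.y Δ t) ∧
      ∀ x, ∀ t ∈ S, ∀ᵐ ω ∂P,
        h x t ω = preactL x
          ((neuronModel T h₁ h₂ hγ.le hlam δ).flow Δ (W₀ ω, ψ ω) t).1 ∧
        z t ω = ((neuronModel T h₁ h₂ hγ.le hlam δ).flow Δ (W₀ ω, ψ ω) t).2 := by
  set M := neuronModel T h₁ h₂ hγ.le hlam δ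
  -- The retraction r onto the time set extends the solution's own error signals continuously to the
  -- line. They are deterministic, so each path solves the neuron equation with given signals.
  have hc : Continuous fun t => fun ν => siteError φ γ P h z T ν (r t) :=
    continuous_pi fun ν => continuous_const.sub
      ((H.continuous_predictor (T.x ν)).comp_continuous hr hrS)
  set Δ : C(ℝ, Fin T.size → ℝ) := ⟨_, hc⟩ with hΔ
  have hΔS : ∀ t ∈ S, ∀ ν, siteError φ γ P h z T ν t = Δ t ν := fun t ht ν => by
    simp [hΔ, hrt t ht]
  have hpath : ∀ x, ∀ t ∈ S, ∀ᵐ ω ∂P,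
      h x t ω = preactL x (M.flow Δ (W₀ ω, ψ ω) t).1 ∧ z t ω = (M.flow Δ (W₀ ω, ψ ω) t).2 := by
    intro x t ht
    filter_upwards [H.continuous_h, H.continuous_z, H.eq_h, H.eq_z, hW x,
      ae_all_iff.2 fun ν => hW (T.x ν)] with ω hhc hzc hh hz hx hT
    have hI : ∀ s ∈ Icc 0 t, Icc 0 s ⊆ S := fun s hs =>
      (hS s ((hS t ht).2 hs)).2
    have hsol : SolvesSiteEquations φ γ lam δ T Δ (Icc 0 t) (fun x => h₀ x ω) (ψ ω)
        (fun x t => h x t ω) (fun t => z t ω) := by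
      constructor
      · intro x s hs
        rw [hh x s ((hS t ht).2 hs), retention, add_mul]
        congr 2
        refine intervalIntegral.integral_congr fun s' hs' => ?_
        rw [uIcc_of_le hs.1] at hs'
        simp only [hΔS s' (hI s hs hs'), siteGrad]
      · intro s hs
        rw [hz s ((hS t ht).2 hs)]
        congr 2
        refine intervalIntegral.integral_congr fun s' hs' => ?_
        rw [uIcc_of_le hs.1] at hs'
        simp only [hΔS s' (hI s hs hs')]
    have := hsol.eq_flow h₁ h₂ hγ.le hlam hδ (fun x => (hhc x).mono (hS t ht).2)
      (hzc.mono (hS t ht).2) hT ⟨(hS t ht).1, le_rfl⟩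
    exact ⟨this.2 x hx, this.1⟩
  refine ⟨Δ, fun t ht s hs ν => ?_, hpath⟩
  have hs' : s ∈ S := (hS t ht).2 hs
  rw [← hΔS s hs', siteError, sitePredictor_eq hW₀ hψ h₁ M Δ (hpath _ s hs'),
    inv_sq_mul_meanContrib h₁ h₂ hγ hlam]

/-- Self-consistent error signals give a solution of the single-site system. -/
theorem exists_isDMFT [IsProbabilityMeasure P] (h₁ : LipschitzWith K₁ φ)
    (h₂ : LipschitzWith K₂ (deriv φ)) (hγ : 0 < γ) (hlam : 0 ≤ lam) (hδ : 0 ≤ δ) {W₀ : Ω → Fin D → ℝ}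
    (hW₀ : AEMeasurable W₀ P) (hψ : AEMeasurable ψ P)
    (hW : ∀ x, ∀ᵐ ω ∂P, h₀ x ω = preactL x (W₀ ω))
    (hμ : HasExpMoments (P.map fun ω => (W₀ ω, ψ ω))) :
    ∃ h z, IsDMFT φ γ lam δ T (Ici 0) P h₀ ψ h z := by
  set M := neuronModel T h₁ h₂ hγ.le hlam δ
  have hm : AEMeasurable (fun ω => (W₀ ω, ψ ω)) P := hW₀.prodMk hψ
  have : IsProbabilityMeasure (P.map fun ω => (W₀ ω, ψ ω)) := Measure.isProbabilityMeasure_map hm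
  obtain ⟨Δ, hΔ⟩ := M.exists_isSelfConsistent hμ (by positivity : 0 ≤ (γ ^ 2)⁻¹) T.y
  have hu : ∀ t, AEMeasurable (fun ω => M.flow Δ (W₀ ω, ψ ω) t) P := fun t =>
    (M.continuous_flow_left Δ t).measurable.comp_aemeasurable hm
  -- The initial field is linear in x only up to a null set depending on x, whereas the equation
  -- must hold for all x off a single null set. The correction carries the discrepancy along; it
  -- vanishes almost surely for each fixed x, hence simultaneously at the finitely many patterns,
  -- where it could affect the driving terms.
  set h : Input D → ℝ → Ω → ℝ := fun x t ω => preactL x (M.flow Δ (W₀ ω, ψ ω) t).1 +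
    retention lam δ t * (h₀ x ω - preactL x (W₀ ω)) with hh
  set z : ℝ → Ω → ℝ := fun t ω => (M.flow Δ (W₀ ω, ψ ω) t).2 with hz
  have hflow : ∀ x t, ∀ᵐ ω ∂P,
      h x t ω = preactL x (M.flow Δ (W₀ ω, ψ ω) t).1 ∧ z t ω = (M.flow Δ (W₀ ω, ψ ω) t).2 := by
    intro x t
    filter_upwards [hW x] with ω hω
    simp [hh, hz, hω]
  have hpred : ∀ x t, sitePredictor φ γ P h z x t = γ⁻¹ * ∫ u, (M.flow Δ u t).2 *
      φ (preactL x (M.flow Δ u t).1) ∂(P.map fun ω => (W₀ ω, ψ ω)) := fun x t =>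
    sitePredictor_eq hW₀ hψ h₁ M Δ (hflow x t)
  have herr : ∀ t, 0 ≤ t → ∀ ν, siteError φ γ P h z T ν t = Δ t ν := by
    intro t ht ν
    rw [siteError, hpred, hΔ t t ⟨ht, le_rfl⟩ ν, inv_sq_mul_meanContrib h₁ h₂ hγ hlam]
  have hsol : ∀ᵐ ω ∂P, SolvesSiteEquations φ γ lam δ T Δ (Ici 0) (fun x => h₀ x ω) (ψ ω)
      (fun x t => h x t ω) (fun t => z t ω) := by
    filter_upwards [ae_all_iff.2 fun ν => hW (T.x ν)] with ω hω
    exact solvesSiteEquations_flow h₁ h₂ hγ.le hlam hδ Δ hω (ψ ω)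
  refine ⟨h, z, ?_, fun t _ => (hu t).snd, ?_, ?_, ?_, ?_, ?_, ?_⟩
  · intro x t _
    refine AEMeasurable.congr ?_ ((hflow x t).mono fun ω hω => hω.1.symm)
    exact (preactL x).continuous.measurable.comp_aemeasurable (hu t).fst
  · refine Eventually.of_forall fun ω x => Continuous.continuousOn ?_
    have hr : Continuous (retention lam δ) := by unfold retention; fun_prop
    exact ((preactL x).continuous.comp (M.continuous_flow Δ _).fst).add
      (hr.mul continuous_const)
  · exact Eventually.of_forall fun ω => (M.continuous_flow Δ _).snd.continuousOn
  · intro x t _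
    have := (M.integrable_comp_flow hμ Δ (continuous_readout_mul h₁ x)
      (abs_readout_mul_le h₁ x) t).comp_aemeasurable hm
    refine this.congr ?_
    filter_upwards [hflow x t] with ω hω
    rw [hω.1, hω.2]
    rfl
  · intro x
    refine Continuous.continuousOn ?_
    rw [funext (hpred x)]
    exact continuous_const.mul (M.continuous_integral_comp_flow hμ Δ (continuous_readout_mul h₁ x)
      (abs_readout_mul_le h₁ x))
  · filter_upwards [hsol] with ω hω x t ht
    rw [hω.eq_h x t ht, retention, add_mul]
    congr 2
    refine intervalIntegral.integral_congr fun s hs => ?_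
    rw [uIcc_of_le ht] at hs
    simp only [herr s hs.1, siteGrad]
  · filter_upwards [hsol] with ω hω t ht
    rw [hω.eq_z t ht]
    congr 2
    refine intervalIntegral.integral_congr fun s hs => ?_
    rw [uIcc_of_le ht] at hs
    simp only [herr s hs.1]

end Site

end TransferDMFT

/-- The supremum norm is at most the sum of the absolute coordinates, so the exponential is
dominated by a product of one-dimensional integrable factors. -/
theorem hasExpMoments_pi_gaussianReal (κ : Type*) [Fintype κ] :
    HasExpMoments (Measure.pi fun _ : κ => gaussianReal 0 1) := by
  intro c
  have h : Integrable (fun x : κ → ℝ => ∏ k, Real.exp (|c| * |x k|))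
      (Measure.pi fun _ => gaussianReal 0 1) :=
    Integrable.fintype_prod fun _ =>
      integrable_exp_mul_abs (integrable_exp_mul_gaussianReal _) (integrable_exp_mul_gaussianReal _)
  refine h.mono' (by fun_prop : Continuous fun x : κ → ℝ =>
    Real.exp (c * ‖x‖)).aestronglyMeasurable (Eventually.of_forall fun x => ?_)
  rw [Real.norm_of_nonneg (Real.exp_nonneg _), ← Real.exp_sum, ← Finset.mul_sum]
  refine Real.exp_le_exp.2 (mul_le_mul (le_abs_self c) ?_ (norm_nonneg _) (abs_nonneg _))
  refine (pi_norm_le_iff_of_nonneg (Finset.sum_nonneg fun _ _ => abs_nonneg _)).2 fun k => ?_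
  exact Finset.single_le_sum (f := fun k => |x k|) (fun _ _ => abs_nonneg _) (Finset.mem_univ k)

namespace TransferDMFT

/-! ### The law of the initial data -/

/-- The random initial data of one neuron: its source hidden weights, its source readout weight and
its target readout weight. -/
abbrev NeuronNoise (D : ℕ) := (Fin D ⊕ Unit) ⊕ Unit → ℝ

/-- The standard Gaussian law on the initial data of one neuron. -/
noncomputable def noiseLaw (D : ℕ) : Measure (NeuronNoise D) :=
  Measure.pi fun _ => gaussianReal 0 1

instance (D : ℕ) : IsProbabilityMeasure (noiseLaw D) := by
  unfold noiseLaw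
  infer_instance

theorem hasExpMoments_noiseLaw (D : ℕ) : HasExpMoments (noiseLaw D) :=
  hasExpMoments_pi_gaussianReal _

/-- The source network's initial state of a neuron. -/
def sourceInit {D : ℕ} (x : NeuronNoise D) : Neuron D :=
  (fun j => x (Sum.inl (Sum.inl j)), x (Sum.inl (Sum.inr ())))

/-- The initial target readout weight of a neuron. -/
def targetReadout {D : ℕ} (x : NeuronNoise D) : ℝ := x (Sum.inr ())

theorem continuous_sourceInit {D : ℕ} : Continuous (sourceInit (D := D)) := by
  unfold sourceInit
  fun_prop

theorem continuous_targetReadout {D : ℕ} : Continuous (targetReadout (D := D)) := by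
  unfold targetReadout
  fun_prop

theorem norm_sourceInit_le {D : ℕ} (x : NeuronNoise D) : ‖sourceInit x‖ ≤ ‖x‖ :=
  max_le ((pi_norm_le_iff_of_nonneg (norm_nonneg _)).2 fun _ => norm_le_pi_norm x _)
    (norm_le_pi_norm x _)

theorem norm_targetReadout_le {D : ℕ} (x : NeuronNoise D) : ‖targetReadout x‖ ≤ ‖x‖ :=
  norm_le_pi_norm x _

section Network

variable {N D : ℕ} {Ω : Type*} {θbar θ : Ω → ℝ → Params N D}

/-- The index of a weight of the `i`-th neuron. -/
def weightIndex {N D : ℕ} (i : Fin N) :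
    (Fin D ⊕ Unit) ⊕ Unit → ((Fin N × Fin D) ⊕ Fin N) ⊕ Fin N :=
  Sum.map (Sum.map (fun j => (i, j)) fun _ => i) fun _ => i

theorem injective_weightIndex :
    Function.Injective fun p : Fin N × ((Fin D ⊕ Unit) ⊕ Unit) => weightIndex p.1 p.2 := by
  rintro ⟨i, (j | _) | _⟩ ⟨i', (j' | _) | _⟩ h <;> simp_all [weightIndex]

/-- The initial data of the neurons of a network. -/
def neuronNoise (θbar θ : Ω → ℝ → Params N D) (ω : Ω) (i : Fin N) : NeuronNoise D :=
  fun k => initialWeights θbar θ (weightIndex i k) ω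

theorem sourceInit_neuronNoise (ω : Ω) (i : Fin N) :
    sourceInit (neuronNoise θbar θ ω i) = neuron (θbar ω 0) i := rfl

theorem targetReadout_neuronNoise (ω : Ω) (i : Fin N) :
    targetReadout (neuronNoise θbar θ ω i) = (neuron (θ ω 0) i).2 := rfl

/-- Grouping the independent weights by neuron, through an injective index map and currying, makes
the neurons' initial data i.i.d., as the laws of large numbers require. -/
theorem hasLaw_neuronNoise [MeasurableSpace Ω] {P : Measure Ω}
    (hi : iIndepFun (initialWeights θbar θ) P)
    (hl : ∀ k, HasLaw (initialWeights θbar θ k) (gaussianReal 0 1) P) :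
    HasLaw (neuronNoise θbar θ) (Measure.pi fun _ => noiseLaw D) P := by
  have h1 := (hi.precomp (injective_weightIndex (N := N) (D := D))).hasLaw_pi fun p => hl _
  have h2 : HasLaw (MeasurableEquiv.curry (Fin N) ((Fin D ⊕ Unit) ⊕ Unit) ℝ)
      (Measure.pi fun _ : Fin N => noiseLaw D)
      (Measure.pi fun _ : Fin N × ((Fin D ⊕ Unit) ⊕ Unit) => gaussianReal 0 1) := by
    refine ⟨(MeasurableEquiv.measurable _).aemeasurable, ?_⟩
    have := Measure.infinitePi_map_curry
      (fun (_ : Fin N) (_ : (Fin D ⊕ Unit) ⊕ Unit) => gaussianReal 0 1)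
    rw [Measure.infinitePi_eq_pi] at this
    rw [this, Measure.infinitePi_eq_pi]
    congr 1
    funext i
    exact Measure.infinitePi_eq_pi _
  exact h2.comp h1

end Network

section Site

variable {D : ℕ} {Ω : Type*} {ξ : Input D → Ω → ℝ} {ψbar ψ : Ω → ℝ}

/-- The hidden weights of a site. -/
noncomputable def siteWeights (ξ : Input D → Ω → ℝ) (ω : Ω) (j : Fin D) : ℝ :=
  √(D : ℝ) * ξ (EuclideanSpace.single j 1) ω

/-- The initial data of a site. -/
noncomputable def siteNoise (ξ : Input D → Ω → ℝ) (ψbar ψ : Ω → ℝ) (ω : Ω) : NeuronNoise D :=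
  Sum.elim (Sum.elim (siteWeights ξ ω) fun _ => ψbar ω) fun _ => ψ ω

theorem gram_single (x : Input D) (j : Fin D) :
    gram x (EuclideanSpace.single j 1) = x j / D := by
  simp [gram]

variable [MeasurableSpace Ω] {P : Measure Ω}

theorem IsSiteNoise.memLp (hN : IsSiteNoise P ξ ψbar ψ) (x : Input D) : MemLp (ξ x) 2 P :=
  (hN.gaussian.hasGaussianLaw_eval x).memLp_two

/-- The covariance is bilinear in the inputs, so the variance of ξ(x) minus the combination Σ x_j
ξ(e_j) is zero. The exceptional null set may depend on x. -/
theorem IsSiteNoise.field_eq (hN : IsSiteNoise P ξ ψbar ψ) (x : Input D) :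
    ∀ᵐ ω ∂P, ξ x ω = preactL x (siteWeights ξ ω) := by
  set e : Fin D → Input D := fun j => EuclideanSpace.single j 1 with he
  have hint : ∀ x x', Integrable (fun ω => ξ x ω * ξ x' ω) P := fun x x' =>
    (hN.memLp x).integrable_mul (hN.memLp x')
  have hW : ∀ ω, preactL x (siteWeights ξ ω) = ∑ j, x j * ξ (e j) ω := by
    intro ω
    rw [preactL_apply, Finset.sum_div]
    refine Finset.sum_congr rfl fun j _ => ?_
    have hD : √(D : ℝ) ≠ 0 := (Real.sqrt_pos.2 (Nat.cast_pos.2 (Fin.pos j))).ne'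
    simp only [siteWeights, he]
    field_simp
  have hexp : ∀ ω, (ξ x ω - ∑ j, x j * ξ (e j) ω) ^ 2 = ξ x ω * ξ x ω -
      2 * ∑ j, x j * (ξ x ω * ξ (e j) ω) + ∑ i, ∑ j, x i * x j * (ξ (e i) ω * ξ (e j) ω) := by
    intro ω
    rw [sub_sq, sq (∑ j, x j * ξ (e j) ω), Finset.sum_mul_sum, Finset.mul_sum, Finset.mul_sum, sq]
    congr 1
    · congr 1
      exact Finset.sum_congr rfl fun j _ => by ring
    · exact Finset.sum_congr rfl fun i _ => Finset.sum_congr rfl fun j _ => by ring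
  have i1 := hint x x
  have i2 : Integrable (fun ω => 2 * ∑ j, x j * (ξ x ω * ξ (e j) ω)) P :=
    (integrable_finsetSum _ fun j _ => (hint x (e j)).const_mul (x j)).const_mul 2
  have i3 : Integrable (fun ω => ∑ i, ∑ j, x i * x j * (ξ (e i) ω * ξ (e j) ω)) P :=
    integrable_finsetSum _ fun i _ => integrable_finsetSum _ fun j _ =>
      (hint (e i) (e j)).const_mul (x i * x j)
  have hsq : ∫ ω, (ξ x ω - ∑ j, x j * ξ (e j) ω) ^ 2 ∂P = 0 := by
    simp only [hexp]
    have i12 : Integrable (fun ω => ξ x ω * ξ x ω - 2 * ∑ j, x j * (ξ x ω * ξ (e j) ω)) P :=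
      i1.sub i2
    rw [integral_add i12 i3, integral_sub i1 i2, hN.cov, integral_const_mul,
      integral_finsetSum _ fun j _ => (hint x (e j)).const_mul (x j),
      integral_finsetSum _ fun i _ => integrable_finsetSum _ fun j _ =>
        (hint (e i) (e j)).const_mul (x i * x j)]
    have h1 : ∀ j, ∫ ω, x j * (ξ x ω * ξ (e j) ω) ∂P = x j * x j / D := by
      intro j
      rw [integral_const_mul, hN.cov, gram_single, mul_div_assoc]
    have h2 : ∀ i, ∫ ω, ∑ j, x i * x j * (ξ (e i) ω * ξ (e j) ω) ∂P = x i * x i / D := by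
      intro i
      rw [integral_finsetSum _ fun j _ => (hint (e i) (e j)).const_mul (x i * x j)]
      simp only [integral_const_mul, hN.cov, gram_single, he]
      rw [Finset.sum_eq_single i (fun j _ hj => by simp [hj]) (by simp)]
      simp
      ring
    rw [Finset.sum_congr rfl fun j _ => h1 j, Finset.sum_congr rfl fun i _ => h2 i, gram,
      Finset.sum_div]
    ring
  have isq : Integrable (fun ω => (ξ x ω - ∑ j, x j * ξ (e j) ω) ^ 2) P := by
    simp only [hexp]
    exact (i1.sub i2).add i3
  filter_upwards [(integral_eq_zero_iff_of_nonneg (fun ω => sq_nonneg _) isq).1 hsq] with ω hω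
  rw [hW]
  exact sub_eq_zero.1 (pow_eq_zero_iff two_ne_zero |>.1 hω)

variable [IsProbabilityMeasure P]

/-- The values √D ξ(e_j) are jointly Gaussian with identity covariance, and uncorrelated jointly
Gaussian variables are independent. -/
theorem IsSiteNoise.hasLaw_siteWeights (hN : IsSiteNoise P ξ ψbar ψ) :
    HasLaw (siteWeights ξ) (Measure.pi fun _ => gaussianReal 0 1) P := by
  set X : Fin D → Ω → ℝ := fun j ω => √(D : ℝ) * ξ (EuclideanSpace.single j 1) ω with hX
  have hXp : IsGaussianProcess X P :=
    (hN.gaussian.comp_right fun j : Fin D => (EuclideanSpace.single j 1 : Input D)).smul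
      fun _ => √(D : ℝ)
  have hXg : HasGaussianLaw (fun ω => (X · ω)) P :=
    (hXp.hasGaussianLaw Finset.univ).map_fun (ContinuousLinearMap.pi fun j =>
      ContinuousLinearMap.proj (R := ℝ) (φ := fun _ : (Finset.univ : Finset (Fin D)) => ℝ)
        ⟨j, Finset.mem_univ j⟩)
  have hmean : ∀ j, ∫ ω, X j ω ∂P = 0 := fun j => by
    simp only [hX]
    rw [integral_const_mul, hN.mean, mul_zero]
  have hmem : ∀ j, MemLp (X j) 2 P := fun j => (hN.memLp _).const_mul _
  have hcov : ∀ i j, cov[X i, X j; P] = if i = j then 1 else 0 := by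
    intro i j
    have hD : (D : ℝ) ≠ 0 := Nat.cast_ne_zero.2 (Fin.pos i).ne'
    rw [covariance_eq_sub (hmem i) (hmem j), hmean, zero_mul, sub_zero]
    have : ∀ ω, (X i * X j) ω = (D : ℝ) * (ξ (EuclideanSpace.single i 1) ω *
        ξ (EuclideanSpace.single j 1) ω) := by
      intro ω
      simp only [hX, Pi.mul_apply]
      calc _ = √(D : ℝ) * √(D : ℝ) * (ξ (EuclideanSpace.single i 1) ω *
            ξ (EuclideanSpace.single j 1) ω) := by ring
        _ = _ := by rw [Real.mul_self_sqrt (Nat.cast_nonneg D)]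
    simp only [this]
    rw [integral_const_mul, hN.cov, gram_single]
    by_cases hij : i = j
    · subst hij
      simp [hD]
    · simp [hij, Ne.symm hij]
  have hind : iIndepFun X P := hXg.iIndepFun_of_covariance_eq_zero fun i j hij => by
    rw [hcov, if_neg hij]
  refine hind.hasLaw_pi fun j => ⟨(hXp.aemeasurable j), ?_⟩
  change P.map (X j) = _
  rw [(hXp.hasGaussianLaw_eval j).map_eq_gaussianReal, hmean,
    ← covariance_self (hXp.aemeasurable j), hcov, if_pos rfl, Real.toNNReal_one]

theorem IsSiteNoise.hasLaw_siteNoise (hN : IsSiteNoise P ξ ψbar ψ) :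
    HasLaw (siteNoise ξ ψbar ψ) (noiseLaw D) P := by
  have h1 : IndepFun (siteWeights ξ) (fun ω => (ψbar ω, ψ ω)) P := by
    refine hN.indep_field.comp (φ := fun (f : Input D → ℝ) (j : Fin D) =>
      √(D : ℝ) * f (EuclideanSpace.single j 1)) ?_ measurable_id
    fun_prop
  have h2 := h1.hasLaw_prod hN.hasLaw_siteWeights
    (hN.indep_readouts.hasLaw_prod hN.law_psibar hN.law_psi)
  set g : (Fin D → ℝ) × ℝ × ℝ → NeuronNoise D := fun p =>
    Sum.elim (Sum.elim p.1 fun _ => p.2.1) fun _ => p.2.2 with hg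
  have hgm : Measurable g := by
    refine measurable_pi_lambda _ ?_
    rintro ((j | _) | _) <;> simp only [hg, Sum.elim_inl, Sum.elim_inr] <;> fun_prop
  have h3 : HasLaw g (noiseLaw D) ((Measure.pi fun _ => gaussianReal 0 1).prod
      ((gaussianReal 0 1).prod (gaussianReal 0 1))) := by
    refine ⟨hgm.aemeasurable, (Measure.pi_eq fun s hs => ?_).symm⟩
    have hpre : g ⁻¹' univ.pi s = (univ.pi fun j => s (Sum.inl (Sum.inl j))) ×ˢ
        (s (Sum.inl (Sum.inr ())) ×ˢ s (Sum.inr ())) := by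
      ext p
      simp [hg, Set.mem_pi]
      tauto
    rw [Measure.map_apply hgm (MeasurableSet.univ_pi hs), hpre, Measure.prod_prod,
      Measure.prod_prod, Measure.pi_pi, Fintype.prod_sum_type, Fintype.prod_sum_type]
    simp [mul_assoc]
  exact h3.comp h2

end Site

end TransferDMFT

theorem NeuronModel.exists_norm_flow_le {E ι : Type*} [NormedAddCommGroup E] [NormedSpace ℝ E]
    [CompleteSpace E] [Fintype ι] (M : NeuronModel E ι) (Δ : C(ℝ, ι → ℝ)) (τ : ℝ) :
    ∃ C, ∀ u₀, ∀ t ∈ Icc 0 τ, ‖M.flow Δ u₀ t‖ ≤ C * (1 + ‖u₀‖) := by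
  refine ⟨M.growth τ (∫ s in (0)..τ, ‖Δ s‖), fun u₀ t ht => ?_⟩
  have := (M.isPath_flow Δ u₀ τ).norm_le Δ.continuous le_rfl ht
  rwa [flow_zero] at this

namespace TransferDMFT

/-! ### Chaining the source and target stages -/

section TwoStage

variable {D : ℕ} {T₁ T₂ : Task D} {φ : ℝ → ℝ} {K₁ K₂ : ℝ≥0} {γbar γ lam δ τ : ℝ}

/-- The state in which a neuron starts the second stage, having followed the neuron model `M` up to
time `τ` in the first one. -/
noncomputable def targetInit {ι : Type*} [Fintype ι] (M : NeuronModel (Neuron D) ι)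
    (Δ : C(ℝ, ι → ℝ)) (τ : ℝ) (x : NeuronNoise D) : Neuron D :=
  ((M.flow Δ (sourceInit x) τ).1, targetReadout x)

theorem continuous_targetInit {ι : Type*} [Fintype ι] (M : NeuronModel (Neuron D) ι)
    (Δ : C(ℝ, ι → ℝ)) (τ : ℝ) : Continuous (targetInit M Δ τ) :=
  ((M.continuous_flow_left Δ τ).comp continuous_sourceInit).fst.prodMk continuous_targetReadout

theorem exists_norm_targetInit_le {ι : Type*} [Fintype ι] (M : NeuronModel (Neuron D) ι)
    (Δ : C(ℝ, ι → ℝ)) (hτ : 0 ≤ τ) : ∃ C, ∀ x, ‖targetInit M Δ τ x‖ ≤ C * (1 + ‖x‖) := by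
  obtain ⟨C, hC⟩ := M.exists_norm_flow_le Δ τ
  have hC0 : 0 ≤ C := by simpa using (norm_nonneg _).trans (hC 0 τ ⟨hτ, le_rfl⟩)
  refine ⟨C + 1, fun x => max_le ?_ ?_⟩
  · have := norm_sourceInit_le x
    change ‖(M.flow Δ (sourceInit x) τ).1‖ ≤ _
    refine (norm_fst_le (M.flow Δ (sourceInit x) τ)).trans ((hC _ τ ⟨hτ, le_rfl⟩).trans ?_)
    gcongr
    linarith
  · refine (norm_targetReadout_le x).trans ?_
    nlinarith [norm_nonneg x]

theorem norm_sourceInit_le_one_mul (x : NeuronNoise D) : ‖sourceInit x‖ ≤ 1 * (1 + ‖x‖) := by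
  linarith [norm_sourceInit_le x]

section Site

variable {Ω : Type*} [MeasurableSpace Ω] {P : Measure Ω} [IsProbabilityMeasure P]
  {ξ : Input D → Ω → ℝ} {ψbar ψ : Ω → ℝ} {hbar : Input D → ℝ → Ω → ℝ} {zbar : ℝ → Ω → ℝ}

/-- The initial state of a site has the law of that of a network neuron, so self-consistency for the
site is self-consistency for the limit of the networks. -/
theorem IsSiteNoise.map_sourceInit (hN : IsSiteNoise P ξ ψbar ψ) :
    P.map (fun ω => (siteWeights ξ ω, ψbar ω)) = (noiseLaw D).map sourceInit := by
  rw [← hN.hasLaw_siteNoise.map_eq, AEMeasurable.map_map_of_aemeasurable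
    continuous_sourceInit.measurable.aemeasurable hN.hasLaw_siteNoise.aemeasurable]
  rfl

variable (h₁ : LipschitzWith K₁ φ) (h₂ : LipschitzWith K₂ (deriv φ)) (hγbar : 0 < γbar)
  (hγ : 0 < γ) (hlam : 0 ≤ lam)

/-- The source stage of a site. -/
theorem IsDMFT.exists_source_flow
    (H : IsDMFT φ γbar lam 0 T₁ (Icc 0 τ) P ξ ψbar hbar zbar) (hτ : 0 ≤ τ)
    (hN : IsSiteNoise P ξ ψbar ψ) :
    ∃ Δ : C(ℝ, Fin T₁.size → ℝ),
      (neuronModel T₁ h₁ h₂ hγbar.le hlam 0).IsSelfConsistent ((noiseLaw D).map sourceInit)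
        (γbar ^ 2)⁻¹ T₁.y Δ τ ∧
      ∀ x, ∀ᵐ ω ∂P, hbar x τ ω = preactL x
        (targetInit (neuronModel T₁ h₁ h₂ hγbar.le hlam 0) Δ τ (siteNoise ξ ψbar ψ ω)).1 := by
  have hW := hN.hasLaw_siteWeights.aemeasurable
  obtain ⟨Δ, hΔ, hflow⟩ := H.exists_flow h₁ h₂ hγbar hlam le_rfl
    (fun t ht => ⟨ht.1, Icc_subset_Icc_right ht.2⟩)
    (r := fun t => max 0 (min τ t)) (by fun_prop)
    (fun t => ⟨le_max_left _ _, max_le hτ (min_le_left _ _)⟩)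
    (fun t ht => by rw [min_eq_right ht.2, max_eq_right ht.1]) hW hN.law_psibar.aemeasurable
    hN.field_eq
  rw [hN.map_sourceInit] at hΔ
  exact ⟨Δ, hΔ τ ⟨hτ, le_rfl⟩, fun x => (hflow x τ ⟨hτ, le_rfl⟩).mono fun ω hω => hω.1⟩

theorem IsSiteNoise.map_targetInit (hN : IsSiteNoise P ξ ψbar ψ) {ι : Type*} [Fintype ι]
    (M : NeuronModel (Neuron D) ι) (Δ : C(ℝ, ι → ℝ)) (τ : ℝ) :
    P.map (fun ω => ((targetInit M Δ τ (siteNoise ξ ψbar ψ ω)).1, ψ ω)) =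
      (noiseLaw D).map (targetInit M Δ τ) := by
  rw [← hN.hasLaw_siteNoise.map_eq, AEMeasurable.map_map_of_aemeasurable
    (continuous_targetInit M Δ τ).measurable.aemeasurable hN.hasLaw_siteNoise.aemeasurable]
  rfl

theorem IsSiteNoise.aemeasurable_targetInit (hN : IsSiteNoise P ξ ψbar ψ) {ι : Type*} [Fintype ι]
    (M : NeuronModel (Neuron D) ι) (Δ : C(ℝ, ι → ℝ)) (τ : ℝ) :
    AEMeasurable (fun ω => (targetInit M Δ τ (siteNoise ξ ψbar ψ ω)).1) P :=
  ((continuous_targetInit M Δ τ).measurable.comp_aemeasurable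
    hN.hasLaw_siteNoise.aemeasurable).fst

/-- The source solution is first identified with a neuron flow. This makes its final field linear in
finitely many weights with exponential moments, as the existence result for the target stage
requires. -/
theorem exists_isTwoStageDMFT (h₁ : LipschitzWith K₁ φ) (h₂ : LipschitzWith K₂ (deriv φ))
    (hγbar : 0 < γbar) (hγ : 0 < γ) (hlam : 0 ≤ lam) (hδ : 0 ≤ δ) (hτ : 0 ≤ τ)
    (hN : IsSiteNoise P ξ ψbar ψ) :
    ∃ hbar zbar h z, IsTwoStageDMFT φ γbar γ lam δ τ T₁ T₂ P ξ ψbar ψ hbar zbar h z := by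
  have hm₁ : HasExpMoments ((noiseLaw D).map sourceInit) :=
    (hasExpMoments_noiseLaw D).map_of_linear_growth continuous_sourceInit.measurable
      norm_sourceInit_le_one_mul
  obtain ⟨hbar, zbar, H₁⟩ := exists_isDMFT (T := T₁) h₁ h₂ hγbar hlam le_rfl
    hN.hasLaw_siteWeights.aemeasurable hN.law_psibar.aemeasurable hN.field_eq
    (by rwa [hN.map_sourceInit])
  have H₁' := H₁.mono (Icc_subset_Ici_self : Icc 0 τ ⊆ Ici 0)
  obtain ⟨Δ, -, hflow⟩ := H₁'.exists_source_flow h₁ h₂ hγbar hlam hτ hN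
  obtain ⟨C, hC⟩ := exists_norm_targetInit_le (neuronModel T₁ h₁ h₂ hγbar.le hlam 0) Δ hτ
  have hm₂ := (hasExpMoments_noiseLaw D).map_of_linear_growth
    (continuous_targetInit (neuronModel T₁ h₁ h₂ hγbar.le hlam 0) Δ τ).measurable hC
  obtain ⟨h, z, H₂⟩ := exists_isDMFT (T := T₂) h₁ h₂ hγ hlam hδ
    (hN.aemeasurable_targetInit _ Δ τ) hN.law_psi.aemeasurable hflow
    (by rwa [hN.map_targetInit])
  exact ⟨hbar, zbar, h, z, H₁', H₂⟩

/-- The target stage of a site. -/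
theorem IsDMFT.exists_target_flow {h : Input D → ℝ → Ω → ℝ} {z : ℝ → Ω → ℝ}
    (H : IsDMFT φ γ lam δ T₂ (Ici 0) P (fun x => hbar x τ) ψ h z) (hδ : 0 ≤ δ)
    (hN : IsSiteNoise P ξ ψbar ψ) {ι : Type*} [Fintype ι] (M : NeuronModel (Neuron D) ι)
    (Δ : C(ℝ, ι → ℝ)) (hW : ∀ x, ∀ᵐ ω ∂P,
      hbar x τ ω = preactL x (targetInit M Δ τ (siteNoise ξ ψbar ψ ω)).1) :
    ∃ Δ' : C(ℝ, Fin T₂.size → ℝ),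
      (∀ t, 0 ≤ t → (neuronModel T₂ h₁ h₂ hγ.le hlam δ).IsSelfConsistent
        ((noiseLaw D).map (targetInit M Δ τ)) (γ ^ 2)⁻¹ T₂.y Δ' t) ∧
      ∀ x, ∀ t, 0 ≤ t → ∀ᵐ ω ∂P,
        h x t ω = preactL x ((neuronModel T₂ h₁ h₂ hγ.le hlam δ).flow Δ'
          (targetInit M Δ τ (siteNoise ξ ψbar ψ ω)) t).1 ∧
        z t ω = ((neuronModel T₂ h₁ h₂ hγ.le hlam δ).flow Δ'
          (targetInit M Δ τ (siteNoise ξ ψbar ψ ω)) t).2 := by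
  obtain ⟨Δ', hΔ', hflow⟩ := H.exists_flow h₁ h₂ hγ hlam hδ
    (fun t ht => ⟨ht, Icc_subset_Ici_self⟩)
    (r := fun t => max t 0) (by fun_prop) (fun t => mem_Ici.2 (le_max_right _ _))
    (fun t ht => max_eq_left ht) (hN.aemeasurable_targetInit M Δ τ) hN.law_psi.aemeasurable hW
  rw [hN.map_targetInit] at hΔ'
  exact ⟨Δ', hΔ', hflow⟩

end Site

section Networks

variable {Ω : ℕ → Type*} [∀ N, MeasurableSpace (Ω N)] {P : ∀ N, Measure (Ω N)}
  {θbar θ : ∀ N, Ω N → ℝ → Params N D} (h₁ : LipschitzWith K₁ φ) (h₂ : LipschitzWith K₂ (deriv φ))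
  (hγbar : 0 < γbar) (hγ : 0 < γ) (hlam : 0 ≤ lam)

/-- The coupling is exact at time zero: the independent neurons start from the network's own
weights. -/
theorem tracks_source
    (hθ : ∀ N, IsTwoStageTraining φ γbar γ lam δ τ T₁ T₂ (P N) (θbar N) (θ N))
    (hφ : Differentiable ℝ φ) (hτ : 0 ≤ τ) {Δ : C(ℝ, Fin T₁.size → ℝ)}
    (hΔ : (neuronModel T₁ h₁ h₂ hγbar.le hlam 0).IsSelfConsistent
      ((noiseLaw D).map sourceInit) (γbar ^ 2)⁻¹ T₁.y Δ τ) :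
    Tracks P (fun N => neuronNoise (θbar N) (θ N)) (fun N ω i t => neuron (θbar N ω t) i)
      (fun x => (neuronModel T₁ h₁ h₂ hγbar.le hlam 0).flow Δ (sourceInit x)) (Icc 0 τ) := by
  refine (neuronModel T₁ h₁ h₂ hγbar.le hlam 0).tracks (hasExpMoments_noiseLaw D)
    (fun N => hasLaw_neuronNoise (hθ N).init_indep (hθ N).init_law) (by positivity) hτ
    continuous_sourceInit.measurable norm_sourceInit_le_one_mul hΔ
    (fun N => (hθ N).source_flow.mono fun ω hω => hω.exists_isNetwork h₁ h₂ hγbar hlam hφ hτ)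
    ⟨0, le_rfl, fun η hη => HoldsInProb.of_ae fun N => Eventually.of_forall fun ω i t ht => ?_⟩
  rw [mem_singleton_iff.1 ht]
  simp only [sourceInit_neuronNoise, sub_self, norm_zero]
  positivity

/-- The initial error is the source tracking error at time τ in the hidden weights and zero in the
fresh readouts. -/
theorem tracks_target
    (hθ : ∀ N, IsTwoStageTraining φ γbar γ lam δ τ T₁ T₂ (P N) (θbar N) (θ N))
    (hφ : Differentiable ℝ φ) (hτ : 0 ≤ τ) {σ : ℝ} (hσ : 0 ≤ σ)
    {ι : Type*} [Fintype ι] (M : NeuronModel (Neuron D) ι) {Δ : C(ℝ, ι → ℝ)}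
    (hM : Tracks P (fun N => neuronNoise (θbar N) (θ N)) (fun N ω i t => neuron (θbar N ω t) i)
      (fun x => M.flow Δ (sourceInit x)) (Icc 0 τ))
    {Δ' : C(ℝ, Fin T₂.size → ℝ)}
    (hΔ' : (neuronModel T₂ h₁ h₂ hγ.le hlam δ).IsSelfConsistent
      ((noiseLaw D).map (targetInit M Δ τ)) (γ ^ 2)⁻¹ T₂.y Δ' σ) :
    Tracks P (fun N => neuronNoise (θbar N) (θ N)) (fun N ω i t => neuron (θ N ω t) i)
      (fun x => (neuronModel T₂ h₁ h₂ hγ.le hlam δ).flow Δ' (targetInit M Δ τ x)) (Icc 0 σ) := by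
  obtain ⟨C, hC⟩ := exists_norm_targetInit_le M Δ hτ
  obtain ⟨B, hB, hM⟩ := hM
  refine (neuronModel T₂ h₁ h₂ hγ.le hlam δ).tracks (hasExpMoments_noiseLaw D)
    (fun N => hasLaw_neuronNoise (hθ N).init_indep (hθ N).init_law) (by positivity) hσ
    (continuous_targetInit M Δ τ).measurable hC hΔ' (fun N => ?_)
    ⟨B, hB, fun η hη => (hM η hη).mono (Eventually.of_forall fun N => ?_)⟩
  · filter_upwards [(hθ N).init_hidden, (hθ N).target_flow] with ω h0 hω
    rw [← h0] at hω
    exact hω.exists_isNetwork h₁ h₂ hγ hlam δ hφ hσ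
  · filter_upwards [(hθ N).init_hidden] with ω h0 hω i t ht
    rw [mem_singleton_iff.1 ht]
    rw [Prod.norm_def]
    refine max_le ?_ ?_
    · have h1 : hidden (θ N ω 0) i = (neuron (θbar N ω τ) i).1 := congrFun h0 i
      refine le_trans ?_ (hω i τ ⟨hτ, le_rfl⟩)
      change ‖hidden (θ N ω 0) i - _‖ ≤ _
      rw [h1]
      exact norm_fst_le (neuron (θbar N ω τ) i - M.flow Δ (sourceInit _) τ)
    · change ‖(neuron (θ N ω 0) i).2 - targetReadout (neuronNoise (θbar N) (θ N) ω i)‖ ≤ _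
      rw [targetReadout_neuronNoise, sub_self, norm_zero]
      positivity

end Networks

variable {Ω : ℕ → Type*} [∀ N, MeasurableSpace (Ω N)] {P : ∀ N, Measure (Ω N)}
  {θbar θ : ∀ N, Ω N → ℝ → Params N D}
  {Ω' : Type*} [MeasurableSpace Ω'] {P' : Measure Ω'} [IsProbabilityMeasure P']
  {ξ : Input D → Ω' → ℝ} {ψbar ψ : Ω' → ℝ} {hbar h : Input D → ℝ → Ω' → ℝ}
  {zbar z : ℝ → Ω' → ℝ}

/-- The weights of the target network follow a process `U` through which the single-site processes
factor. -/
theorem exists_siteState (hφ : Differentiable ℝ φ) (h₁ : LipschitzWith K₁ φ)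
    (h₂ : LipschitzWith K₂ (deriv φ)) (hγbar : 0 < γbar) (hγ : 0 < γ) (hlam : 0 ≤ lam)
    (hδ : 0 ≤ δ) (hτ : 0 ≤ τ)
    (hθ : ∀ N, IsTwoStageTraining φ γbar γ lam δ τ T₁ T₂ (P N) (θbar N) (θ N))
    (hN : IsSiteNoise P' ξ ψbar ψ)
    (H : IsTwoStageDMFT φ γbar γ lam δ τ T₁ T₂ P' ξ ψbar ψ hbar zbar h z) :
    ∃ U : Ω' → ℝ → Neuron D,
      (∀ x t, 0 ≤ t → ∀ᵐ ω ∂P', h x t ω = preactL x (U ω t).1 ∧ z t ω = (U ω t).2) ∧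
      ∀ (k : ℕ) (t : Fin k → ℝ), (∀ a, 0 ≤ t a) → ∀ G : (Fin k → Neuron D) → ℝ, Continuous G →
        ∀ C : ℝ, (∀ e, |G e| ≤ C * (1 + ‖e‖) ^ 2) → ∀ ε : ℝ, 0 < ε → HoldsInProb P fun N ω =>
          |(∑ i, G fun a => neuron (θ N ω (t a)) i) / N - ∫ ω', G (fun a => U ω' (t a)) ∂P'|
            < ε := by
  obtain ⟨Δ, hΔ, hW⟩ := H.source.exists_source_flow h₁ h₂ hγbar hlam hτ hN
  set M₁ := neuronModel T₁ h₁ h₂ hγbar.le hlam 0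
  obtain ⟨Δ', hΔ', hflow⟩ := H.target.exists_target_flow h₁ h₂ hγ hlam hδ hN M₁ Δ hW
  set M₂ := neuronModel T₂ h₁ h₂ hγ.le hlam δ
  refine ⟨fun ω => M₂.flow Δ' (targetInit M₁ Δ τ (siteNoise ξ ψbar ψ ω)), hflow, ?_⟩
  intro k t ht G hG C hGC ε hε
  -- The sum of the nonnegative times is a common horizon, including when there are none.
  set σ := ∑ a, t a with hσ
  have hσ0 : 0 ≤ σ := Finset.sum_nonneg fun a _ => ht a
  have htσ : ∀ a, t a ∈ Icc 0 σ := fun a =>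
    ⟨ht a, Finset.single_le_sum (fun a _ => ht a) (Finset.mem_univ a)⟩
  have htracks := tracks_target h₁ h₂ hγ hlam hθ hφ hτ hσ0 M₁
    (tracks_source h₁ h₂ hγbar hlam hθ hφ hτ hΔ) (hΔ' σ hσ0)
  obtain ⟨C₁, hC₁⟩ := exists_norm_targetInit_le M₁ Δ hτ
  obtain ⟨C₂, hC₂⟩ := M₂.exists_norm_flow_le Δ' σ
  have hC₂0 : 0 ≤ C₂ := by simpa using (norm_nonneg _).trans (hC₂ 0 σ ⟨hσ0, le_rfl⟩)
  have hVc : ∀ t, Continuous fun x => M₂.flow Δ' (targetInit M₁ Δ τ x) t := fun t =>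
    (M₂.continuous_flow_left Δ' t).comp (continuous_targetInit M₁ Δ τ)
  have hV : ∀ x, ∀ t ∈ Icc 0 σ, ‖M₂.flow Δ' (targetInit M₁ Δ τ x) t‖ ≤
      C₂ * (1 + C₁) * (1 + ‖x‖) := by
    intro x t ht
    refine (hC₂ _ t ht).trans ?_
    rw [mul_assoc]
    refine mul_le_mul_of_nonneg_left ?_ hC₂0
    have := hC₁ x
    nlinarith [norm_nonneg x]
  have := htracks.holdsInProb_abs_avg_sub_lt (hasExpMoments_noiseLaw D)
    (fun N => hasLaw_neuronNoise (hθ N).init_indep (hθ N).init_law)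
    (fun t _ => by
      rw [← BorelSpace.measurable_eq (α := Neuron D)]
      exact (hVc t).measurable) hV htσ hG hGC hε
  -- The limit is an integral over the neuron noise; the equality in law with the site noise turns
  -- it into an expectation over the given solution.
  have hi : ∫ x, G (fun a => M₂.flow Δ' (targetInit M₁ Δ τ x) (t a)) ∂(noiseLaw D) =
      ∫ ω', G (fun a => M₂.flow Δ' (targetInit M₁ Δ τ (siteNoise ξ ψbar ψ ω')) (t a)) ∂P' := by
    have hc : Continuous fun x => G fun a => M₂.flow Δ' (targetInit M₁ Δ τ x) (t a) :=
      hG.comp (continuous_pi fun a => hVc (t a))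
    exact (hN.hasLaw_siteNoise.integral_comp hc.aestronglyMeasurable).symm
  rwa [hi] at this

end TwoStage

end TransferDMFT

open TransferDMFT

/-! ### Convergence of the predictor and of the empirical law -/

theorem theorem2 {D : ℕ} (T₁ T₂ : Task D) (φ : ℝ → ℝ)
    (hφ : Differentiable ℝ φ) (hφ_lip : ∃ K : ℝ≥0, LipschitzWith K φ)
    (hφ'_lip : ∃ K : ℝ≥0, LipschitzWith K (deriv φ))
    (γbar γ lam δ τ : ℝ) (hγbar : 0 < γbar) (hγ : 0 < γ) (hlam : 0 ≤ lam) (hδ : 0 ≤ δ)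
    (hlamδ : 0 < lam + δ) (hτ : 0 ≤ τ)
    -- the networks of all widths, trained in two stages
    {Ω : ℕ → Type*} [∀ N, MeasurableSpace (Ω N)] (P : ∀ N, Measure (Ω N))
    [∀ N, IsProbabilityMeasure (P N)]
    (θbar θ : ∀ N, Ω N → ℝ → Params N D)
    (hθ : ∀ N, IsTwoStageTraining φ γbar γ lam δ τ T₁ T₂ (P N) (θbar N) (θ N))
    -- the single-site initial data
    {Ω' : Type*} [MeasurableSpace Ω'] (P' : Measure Ω') [IsProbabilityMeasure P']
    (ξ : Input D → Ω' → ℝ) (ψbar ψ : Ω' → ℝ) (hnoise : IsSiteNoise P' ξ ψbar ψ) :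
    (∃ hbar zbar h z, IsTwoStageDMFT φ γbar γ lam δ τ T₁ T₂ P' ξ ψbar ψ hbar zbar h z) ∧
    ∀ hbar zbar h z, IsTwoStageDMFT φ γbar γ lam δ τ T₁ T₂ P' ξ ψbar ψ hbar zbar h z →
      -- the predictor converges in probability
      (∀ (x₀ : Input D) (t : ℝ), 0 ≤ t → ∀ ε : ℝ, 0 < ε →
        Tendsto
          (fun N => P N {ω | ε ≤ |network φ γ (θ N ω t) x₀ - sitePredictor φ γ P' h z x₀ t|})
          atTop (𝓝 0)) ∧
      -- the neurons follow the single-site processes: their empirical law converges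
      (∀ (k : ℕ) (x : Fin k → Input D) (t : Fin k → ℝ), (∀ a, 0 ≤ t a) →
        ∀ (F : (Fin k → ℝ × ℝ × ℝ) →ᵇ ℝ) (ε : ℝ), 0 < ε →
          Tendsto
            (fun N => P N {ω | ε ≤
              |(∑ i : Fin N, F (fun a => (preact (θ N ω (t a)) (x a) i, readout (θ N ω (t a)) i,
                  networkGrad φ γ (θ N ω (t a)) (x a) i))) / N
                - ∫ ω', F (fun a => (h (x a) (t a) ω', z (t a) ω',
                    siteGrad φ h z (x a) (t a) ω')) ∂P'|})
            atTop (𝓝 0)) := by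
  obtain ⟨K₁, h₁⟩ := hφ_lip
  obtain ⟨K₂, h₂⟩ := hφ'_lip
  refine ⟨exists_isTwoStageDMFT h₁ h₂ hγbar hγ hlam hδ hτ hnoise, fun hbar zbar h z H => ?_⟩
  obtain ⟨U, hU, hconv⟩ := exists_siteState hφ h₁ h₂ hγbar hγ hlam hδ hτ hθ hnoise H
  constructor
  · intro x₀ t ht ε hε
    set g : Neuron D → ℝ := fun u => γ⁻¹ * (u.2 * φ (preactL x₀ u.1)) with hg
    have hgc : Continuous g := continuous_const.mul (continuous_readout_mul h₁ x₀)
    have := hconv 1 (fun _ => t) (fun _ => ht) (fun e => g (e 0))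
      (hgc.comp (continuous_apply 0)) (γ⁻¹ * (|φ 0| + K₁ * ‖preactL x₀‖)) (fun e => by
        rw [hg, abs_mul, abs_of_pos (inv_pos.2 hγ), mul_assoc]
        refine mul_le_mul_of_nonneg_left ((abs_readout_mul_le h₁ x₀ (e 0)).trans ?_)
          (inv_nonneg.2 hγ.le)
        have := norm_le_pi_norm e 0
        gcongr) ε hε
    refine this.congr fun N => ?_
    congr 1
    ext ω
    have e1 : network φ γ (θ N ω t) x₀ = (∑ i, g (neuron (θ N ω t) i)) / N := by
      rw [network_eq hγ.ne', hg, ← Finset.mul_sum, ← Finset.mul_sum]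
      field_simp
    have e2 : sitePredictor φ γ P' h z x₀ t = ∫ ω', g (U ω' t) ∂P' := by
      rw [sitePredictor, hg, integral_const_mul]
      congr 1
      refine integral_congr_ae ?_
      filter_upwards [hU x₀ t ht] with ω hω
      rw [hω.1, hω.2]
    simp only [mem_ofPred_eq, not_lt, e1, e2]
  · intro k x t ht F ε hε
    -- The preactivation, readout and gradient at each time are continuous functions of the neuron
    -- state, since φ' is continuous. Bounded observables of them are therefore admissible test
    -- functions of the states.
    set p : (Fin k → Neuron D) → Fin k → ℝ × ℝ × ℝ := fun e a =>
      (preactL (x a) (e a).1, (e a).2, deriv φ (preactL (x a) (e a).1) * (e a).2) with hp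
    have hpc : Continuous p := by
      refine continuous_pi fun a => ?_
      have c1 : Continuous fun e : Fin k → Neuron D => preactL (x a) (e a).1 :=
        (preactL (x a)).continuous.comp (continuous_apply a).fst
      have c2 : Continuous fun e : Fin k → Neuron D => (e a).2 := (continuous_apply a).snd
      exact c1.prodMk (c2.prodMk ((h₂.continuous.comp c1).mul c2))
    have := hconv k t ht (fun e => F (p e)) (F.continuous.comp hpc) ‖F‖ (fun e => by
        refine (F.norm_coe_le_norm _).trans (le_mul_of_one_le_right (norm_nonneg _) ?_)
        exact one_le_pow₀ (by linarith [norm_nonneg e])) ε hε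
    refine this.congr fun N => ?_
    congr 1
    ext ω
    have e1 : ∀ i, F (fun a => (preact (θ N ω (t a)) (x a) i, readout (θ N ω (t a)) i,
        networkGrad φ γ (θ N ω (t a)) (x a) i)) = F (p fun a => neuron (θ N ω (t a)) i) := by
      intro i
      congr 1
      funext a
      rw [networkGrad_eq hφ hγ.ne', preact_eq]
      rfl
    have e2 : ∫ ω', F (fun a => (h (x a) (t a) ω', z (t a) ω',
        siteGrad φ h z (x a) (t a) ω')) ∂P' = ∫ ω', F (p fun a => U ω' (t a)) ∂P' := by
      refine integral_congr_ae ?_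
      filter_upwards [ae_all_iff.2 fun a => hU (x a) (t a) (ht a)] with ω hω
      simp only [siteGrad, hp, (hω _).1, (hω _).2]
    simp only [mem_ofPred_eq, not_lt, e1, e2]
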